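/- **Setting.** A (simple stochastic) game consists of a finite directed graph $(V,E)$, a finite set $\Pi$ of players, a partition of $V$ into sets $V_i$ ($i\in\Pi$) of vertices controlled by player $i$ and a set $V_?$ of stochastic vertices, for each non-terminal stochastic vertex $u$ a probability distribution over the set $E(u)$ of outgoing edges of $u$, and a reward $\mu_i(t)\in\mathbb R$ for each player $i$ and each terminal vertex $t$ (a vertex without outgoing edges). A play starts in a given initial vertex $v_0$ and ends when it reaches a terminal vertex $t$, and player $i$ then gets the payoff $\mu_i(t)$; if no terminal vertex is reached, all players get the payoff $0$. A strategy of player $i$ maps each history that ends in a non-terminal vertex $u\in V_i$ to a probability distribution over $E(u)$; it is stationary if this distribution depends only on $u$. Let $(P,O)$ be a partition of $\Pi$ into pessimists and optimists. For a strategy profile $\bar\sigma$, let $\mathbb X_i(\bar\sigma)$ be the essential infimum of the payoff of player $i$ under $\bar\sigma$ if $i\in P$, and its essential supremum if $i\in O$. The profile $\bar\sigma$ is an *extreme risk-sensitive equilibrium* (XRSE) if there are no player $i$ and strategy $\tau_i$ of player $i$ with $\mathbb X_i(\bar\sigma_{-i},\tau_i)>\mathbb X_i(\bar\sigma)$. A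 set $F\subseteq E$ *represents a stationary XRSE* if every non-terminal vertex controlled by a player has an outgoing edge in $F$, and every stationary profile in which, at each such vertex $u$, the support of the chosen distribution is exactly the set of outgoing edges of $u$ in $F$, is an XRSE. **Theorem.** Let a game with initial vertex $v_0$ be given in which all the rewards $\mu_i(t)$ are non-negative, and let $(P,O)$ be a partition of the set of players. Then there exists a stationary XRSE. Moreover, there is an algorithm that, given such a game, $v_0$ and $(P,O)$, outputs a set $F\subseteq E$ of edges that represents a stationary XRSE, in time $O(m^2p)$, where $m$ is the number of edges and $p$ the number of pessimists. Precisely: there are a program for a random access machine (unit-cost instructions, addition and subtraction of integers, real inputs that can only be read and compared, the game being given by its list of edges with their probabilities, the controller of each vertex, the list of pessimists and the table of rewards) and a constant $C$ such that, on every such input, the program halts with a correct output after at most $C\cdot\max(1,m)^2\cdot\max(1,p)$ steps. -/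

import Mathlib

open MeasureTheory ProbabilityTheory

namespace StochGame

/-! ## Simple stochastic multiplayer games -/

/-- A game with finite vertex set `V` and player set `I`, without the initial vertex. -/
structure Game (V I : Type*) where
  /-- The edges of the underlying directed graph. -/
  edges : Finset (V × V)
  /-- The player that controls a vertex; `none` marks the stochastic vertices. -/
  owner : V → Option I
  /-- The distribution over successors; only its values at stochastic vertices matter. -/
  prob : V → PMF V
  /-- At a stochastic vertex with successors, `prob` is a distribution over the outgoing edges. -/
  prob_edge : ∀ u, owner u = none → (∃ v, (u, v) ∈ edges) →
    ∀ v, prob u v ≠ 0 → (u, v) ∈ edges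
  /-- The payoffs of the players; only the values at terminal vertices matter. -/
  payoff : V → I → ℝ

/-- Histories with `n` edges, as sequences of `n + 1` vertices. -/
abbrev Hist (V : Type*) (n : ℕ) : Type _ := Finset.Iic n → V

/-- The last vertex of a history. -/
def Hist.last {V : Type*} {n : ℕ} (h : Hist V n) : V := h ⟨n, Finset.mem_Iic.2 le_rfl⟩

namespace Game

variable {V I : Type*} (G : Game V I)

/-- A terminal vertex is a vertex without outgoing edges. -/
def Terminal (u : V) : Prop := ∀ v, (u, v) ∉ G.edges

/-- All the rewards at terminal vertices are non-negative. -/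
def NonnegRewards : Prop := ∀ t, G.Terminal t → ∀ i, 0 ≤ G.payoff t i

/-- The payoff of player `i` in a play: the reward of the terminal vertex that is reached,
and `0` if there is none. -/
noncomputable def reward (i : I) (ω : ℕ → V) : ℝ :=
  open Classical in
  if h : ∃ n, G.Terminal (ω n) then G.payoff (ω (Nat.find h)) i else 0

/-- `h` is a path of the graph that starts in `v₀`. -/
def IsPath (v₀ : V) {n : ℕ} (h : Hist V n) : Prop :=
  h ⟨0, Finset.mem_Iic.2 (Nat.zero_le n)⟩ = v₀ ∧
  ∀ (k : ℕ) (hk : k < n), (h ⟨k, Finset.mem_Iic.2 hk.le⟩, h ⟨k + 1, Finset.mem_Iic.2 hk⟩) ∈ G.edges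

/-- `h` is a history of the game from `v₀` in which it is player `i`'s turn. -/
def IsHistOf (v₀ : V) (i : I) {n : ℕ} (h : Hist V n) : Prop :=
  G.IsPath v₀ h ∧ G.owner h.last = some i ∧ ¬ G.Terminal h.last

/-- A strategy of player `i` in the game from `v₀`: after each history in which it is player `i`'s
turn, a distribution over the outgoing edges of the last vertex. (The values of `act` on other
sequences are never used.) -/
structure Strategy (v₀ : V) (i : I) where
  act : ∀ n : ℕ, Hist V n → PMF V
  act_edge : ∀ (n : ℕ) (h : Hist V n), G.IsHistOf v₀ i h →
    ∀ v, act n h v ≠ 0 → (h.last, v) ∈ G.edges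

/-- A strategy profile. -/
abbrev Profile (v₀ : V) : Type _ := ∀ i : I, G.Strategy v₀ i

variable {G}

/-- The profile in which player `i` switches to `τ` and the other players follow `σ`. -/
noncomputable def Profile.deviate {v₀ : V} (σ : G.Profile v₀) (i : I) (τ : G.Strategy v₀ i) :
    G.Profile v₀ :=
  open Classical in Function.update σ i τ

/-- A profile is stationary if every player's choice depends only on the last vertex. -/
def Profile.Stationary {v₀ : V} (σ : G.Profile v₀) : Prop :=
  ∀ (i : I) (n n' : ℕ) (h : Hist V n) (h' : Hist V n'),
    G.IsHistOf v₀ i h → G.IsHistOf v₀ i h' → h.last = h'.last → (σ i).act n h = (σ i).act n' h'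

/-- After each history, the controlling player randomises among exactly the outgoing edges of the
last vertex that belong to `F`. -/
def Profile.HasSupport {v₀ : V} (σ : G.Profile v₀) (F : Set (V × V)) : Prop :=
  ∀ (i : I) (n : ℕ) (h : Hist V n), G.IsHistOf v₀ i h →
    ∀ v, (σ i).act n h v ≠ 0 ↔ (h.last, v) ∈ F

/-- The distribution of the next vertex. Terminal vertices are repeated forever, so that the plays
that reach a terminal vertex are infinite sequences as well. -/
noncomputable def Profile.next {v₀ : V} (σ : G.Profile v₀) (n : ℕ) (h : Hist V n) : PMF V :=
  open Classical in
  if G.Terminal h.last then PMF.pure h.last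
  else match G.owner h.last with
    | none => G.prob h.last
    | some i => (σ i).act n h

variable [Finite V] [MeasurableSpace V] [DiscreteMeasurableSpace V]

/-- `Profile.next` as a transition kernel. -/
noncomputable def Profile.kernel {v₀ : V} (σ : G.Profile v₀) (n : ℕ) : Kernel (Hist V n) V :=
  Kernel.ofFunOfCountable fun h => (σ.next n h).toMeasure

instance {v₀ : V} (σ : G.Profile v₀) (n : ℕ) : IsMarkovKernel (σ.kernel n) :=
  ⟨fun h => inferInstanceAs (IsProbabilityMeasure (σ.next n h).toMeasure)⟩

/-- The law of the play from `v₀` when the profile `σ` is followed (Ionescu-Tulcea). -/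
noncomputable def Profile.law {v₀ : V} (σ : G.Profile v₀) : Measure (ℕ → V) :=
  Kernel.traj (X := fun _ => V) σ.kernel 0 (fun _ => v₀)

/-- The extreme risk measure of player `i`: the essential infimum of the payoff if `i` is a
pessimist (`i ∈ P`), and its essential supremum if `i` is an optimist (`i ∉ P`). -/
noncomputable def Profile.extremeRisk {v₀ : V} (σ : G.Profile v₀) (P : Set I) (i : I) : ℝ :=
  open Classical in
  if i ∈ P then essInf (G.reward i) σ.law else essSup (G.reward i) σ.law

/-- `σ` is an extreme risk-sensitive equilibrium when `P` is the set of pessimists and its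
complement the set of optimists: no player has a profitable deviation. -/
def Profile.IsXRSE {v₀ : V} (σ : G.Profile v₀) (P : Set I) : Prop :=
  ∀ (i : I) (τ : G.Strategy v₀ i),
    ¬ (σ.deviate i τ).extremeRisk P i > σ.extremeRisk P i

variable (G) in
/-- The set of edges `F` represents a stationary extreme risk-sensitive equilibrium: it leaves an
outgoing edge to every non-terminal vertex of a player, and all the stationary profiles in which,
at each vertex `u`, the controlling player randomises with positive probabilities among exactly
the outgoing edges of `u` in `F`, are extreme risk-sensitive equilibria. -/
def RepresentsXRSE (v₀ : V) (P : Set I) (F : Set (V × V)) : Prop :=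
  F ⊆ ↑G.edges ∧
  (∀ u i, G.owner u = some i → ¬ G.Terminal u → ∃ v, (u, v) ∈ F) ∧
  ∀ σ : G.Profile v₀, σ.Stationary → σ.HasSupport F → σ.IsXRSE P

end Game

/-! ## Random access machines

Programs over finitely many integer registers and integer arrays, with real inputs that can only
be read and compared. Every instruction and every evaluation of a test takes one unit of time;
the expressions in an instruction have a fixed size, which depends on the program only. There is
no multiplication. -/

/-- The memory of the machine. -/
structure State where
  /-- Integer registers. -/
  reg : ℕ → ℕ
  /-- Integer arrays: `arr a k` is the cell `k` of the array `a`. -/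
  arr : ℕ → ℕ → ℕ
  /-- Real registers. -/
  rreg : ℕ → ℝ
  /-- Real input tables, which are read-only: `table a k l` is the entry `(k, l)` of table `a`. -/
  table : ℕ → ℕ → ℕ → ℝ

/-- Integer expressions. The names of registers and arrays are fixed in the program, the index of
a cell is computed. -/
inductive Expr
  | lit (c : ℕ)
  | reg (x : ℕ)
  | get (a : ℕ) (k : Expr)
  | add (e₁ e₂ : Expr)
  | sub (e₁ e₂ : Expr)

/-- The value of an expression (subtraction is truncated at `0`). -/
def Expr.eval (s : State) : Expr → ℕ
  | .lit c => c
  | .reg x => s.reg x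
  | .get a k => s.arr a (k.eval s)
  | .add e₁ e₂ => e₁.eval s + e₂.eval s
  | .sub e₁ e₂ => e₁.eval s - e₂.eval s

/-- Real expressions: there is no real arithmetic. -/
inductive RExpr
  | zero
  | reg (r : ℕ)
  | get (a : ℕ) (k l : Expr)

/-- The value of a real expression. -/
def RExpr.eval (s : State) : RExpr → ℝ
  | .zero => 0
  | .reg r => s.rreg r
  | .get a k l => s.table a (k.eval s) (l.eval s)

/-- Tests: comparisons of integers, comparisons of reals, and their Boolean combinations. -/
inductive Test
  | le (e₁ e₂ : Expr)
  | rle (e₁ e₂ : RExpr)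
  | not (b : Test)
  | and (b₁ b₂ : Test)

/-- The test is passed. -/
def Test.Holds (s : State) : Test → Prop
  | .le e₁ e₂ => e₁.eval s ≤ e₂.eval s
  | .rle e₁ e₂ => e₁.eval s ≤ e₂.eval s
  | .not b => ¬ b.Holds s
  | .and b₁ b₂ => b₁.Holds s ∧ b₂.Holds s

/-- Programs. -/
inductive Prog
  | skip
  | set (x : ℕ) (e : Expr)
  | put (a : ℕ) (k e : Expr)
  | rset (r : ℕ) (e : RExpr)
  | seq (c d : Prog)
  | ite (b : Test) (c d : Prog)
  | loop (b : Test) (c : Prog)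

/-- `Runs c s s' t`: the program `c`, started in `s`, halts in `s'` after `t` units of time. -/
inductive Runs : Prog → State → State → ℕ → Prop
  | skip (s : State) : Runs .skip s s 1
  | set (x : ℕ) (e : Expr) (s : State) :
      Runs (.set x e) s { s with reg := Function.update s.reg x (e.eval s) } 1
  | put (a : ℕ) (k e : Expr) (s : State) :
      Runs (.put a k e) s
        { s with arr := Function.update s.arr a
                          (Function.update (s.arr a) (k.eval s) (e.eval s)) } 1
  | rset (r : ℕ) (e : RExpr) (s : State) :
      Runs (.rset r e) s { s with rreg := Function.update s.rreg r (e.eval s) } 1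
  | seq {c d : Prog} {s s' s'' : State} {t t' : ℕ} :
      Runs c s s' t → Runs d s' s'' t' → Runs (.seq c d) s s'' (t + t')
  | ite_true {b : Test} {c d : Prog} {s s' : State} {t : ℕ} :
      b.Holds s → Runs c s s' t → Runs (.ite b c d) s s' (t + 1)
  | ite_false {b : Test} {c d : Prog} {s s' : State} {t : ℕ} :
      ¬ b.Holds s → Runs d s s' t → Runs (.ite b c d) s s' (t + 1)
  | loop_true {b : Test} {c : Prog} {s s' s'' : State} {t t' : ℕ} :
      b.Holds s → Runs c s s' t → Runs (.loop b c) s' s'' t' → Runs (.loop b c) s s'' (t + t' + 1)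
  | loop_false {b : Test} {c : Prog} {s : State} :
      ¬ b.Holds s → Runs (.loop b c) s s 1

/-- The input for a game with vertices `0, …, n - 1` and players `0, …, q - 1`, with the edges
listed in `el` and the pessimists listed in `pl`:
* registers `0, …, 4` hold `n`, `q`, the number of edges, the number of pessimists, and `v₀`;
* arrays `0` and `1` hold the source and the target of each edge, in the order of `el`;
* array `2` holds the owner of each vertex: `0` for stochastic, `i + 1` for player `i`;
* array `3` holds the pessimists, in the order of `pl`;
* table `0` holds the payoff of each player at each vertex;
* table `1` holds, in column `0`, the probability of each edge, in the order of `el`.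
Everything else is `0`. -/
noncomputable def inputState {n q : ℕ} (G : Game (Fin n) (Fin q)) (v₀ : Fin n)
    (el : List (Fin n × Fin n)) (pl : List (Fin q)) : State where
  reg x := match x with
    | 0 => n
    | 1 => q
    | 2 => el.length
    | 3 => pl.length
    | 4 => v₀
    | _ => 0
  arr a k := match a with
    | 0 => (el[k]?).elim 0 fun e => e.1
    | 1 => (el[k]?).elim 0 fun e => e.2
    | 2 => if hk : k < n then (G.owner ⟨k, hk⟩).elim 0 fun i => i + 1 else 0
    | 3 => (pl[k]?).elim 0 fun i => i
    | _ => 0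
  rreg _ := 0
  table a k l := match a with
    | 0 => if hk : k < n then if hl : l < q then G.payoff ⟨k, hk⟩ ⟨l, hl⟩ else 0 else 0
    | 1 => if l = 0 then (el[k]?).elim 0 fun e => (G.prob e.1 e.2).toReal else 0
    | _ => 0

/-- The set of edges that is read off at the end of the computation: the edges that are marked in
array `4`. -/
def outputEdges {n : ℕ} (el : List (Fin n × Fin n)) (s : State) : Set (Fin n × Fin n) :=
  {e | ∃ k, el[k]? = some e ∧ s.arr 4 k ≠ 0}

end StochGame

/-!
A stationary equilibrium is obtained by eliminating edges of pessimists, and it is enough to look at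
the supports of the strategies, that is, at graphs.

*Elimination.* At first all edges of positive probability are allowed. If all of them are used, the
optimists have nothing to gain from a deviation (`Game.Inv.essSup_le`). A pessimist `i` who gets `0`
can only improve by a strategy by which a terminal vertex is reached almost surely; later, when `i`
gets at least the payoff of a worst terminal vertex among the live vertices `A`, only by one that
almost surely reaches a terminal vertex better than that. In terms of the graph, such a strategy
corresponds to a set that contains `v₀`, that the others cannot leave, and inside which the goal can
be reached from everywhere (`Game.Win`); such sets are closed under unions. If there is one, then
`i` gives up all the edges that leave the largest one, `W`, and `W` is the new set of live vertices
(`Game.Inv.elim`). After the first elimination, every elimination removes at least a worst terminal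
vertex (`Game.Win.ssubset`), so that the process ends.

*Equilibrium.* Under a stationary profile whose support is given by the remaining edges, the play
stays in `A`. After an elimination it almost surely reaches a terminal vertex: the expected number
of visits to each other vertex of `A` is finite, by induction along a path to a terminal vertex
(`Game.Profile.tsum_visits_ne_top`), and the Borel-Cantelli lemma applies (`Game.Inv.ae_terminal`).
Hence a pessimist who profits from a deviation almost surely reaches a better terminal vertex than a
worst one of `A`. The vertices visited after the deviation form a set described by `Game.IsDevSet`
(`Game.Profile.isDevSet_visited`). The deviation may use edges that have been given up, but the
invariant `Game.Inv.dev` excludes that it leaves `A`; hence it stems from a `Win` set, which does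
not exist at the end (`Game.Inv.not_isDevSet`, `Game.Inv.essInf_le`).

*Running time.* The largest `Win` set of a player is the greatest fixed point of a map `Game.Att`,
one application of which is a backward search in time `O(m)` (`does_search`, `does_round`). The
iterations for all the pessimists whose candidate set still contains `v₀` are run in lock-step, one
application for each in a sweep, until one of them reaches its fixed point. If this takes `d` sweeps
after the preceding one, then the fixed point has lost `d - 1` or more of the live vertices, and it
is the new set of live vertices. Therefore there are `O(m)` sweeps altogether (`potential`,
`does_sweep`), each of which takes time `O(mp)`. Programs are verified with a Hoare logic for time
bounds (`Does`), in which the rule for loops has a potential that pays for the running time.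
-/

namespace StochGame

/-! ### Elimination of edges in a graph -/

/-- `PathIn F S T u`: the graph `F` has a path from `u` to a vertex of `T` that stays in `S`. -/
inductive PathIn {V : Type*} (F : Set (V × V)) (S T : Set V) : V → Prop
  | base {u : V} : u ∈ S → u ∈ T → PathIn F S T u
  | step {u v : V} : u ∈ S → (u, v) ∈ F → PathIn F S T v → PathIn F S T u

namespace PathIn

variable {V : Type*} {F F' : Set (V × V)} {S S' T T' : Set V} {u : V}

theorem mem (h : PathIn F S T u) : u ∈ S := by
  cases h <;> assumption

theorem mono (h : PathIn F S T u) (hS : S ⊆ S') (hT : ∀ t ∈ S, t ∈ T → t ∈ T')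
    (hF : ∀ u ∈ S, ∀ v ∈ S, (u, v) ∈ F → (u, v) ∈ F') : PathIn F' S' T' u := by
  induction h with
  | base hu ht => exact .base (hS hu) (hT _ hu ht)
  | step hu hv hp ih => exact .step (hS hu) (hF _ hu _ hp.mem hv) ih

end PathIn

namespace Game

variable {V I : Type*} (G : Game V I)

/-- The edges that can be taken: at stochastic vertices, those of positive probability. -/
def effEdges : Set (V × V) :=
  {e | e ∈ G.edges ∧ (G.owner e.1 = none → G.prob e.1 e.2 ≠ 0)}

/-- The terminal vertices of `A` that player `i` aims at: all of them if `st` is false, and those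
that are not worst for `i` among the terminal vertices of `A` if `st` is true. -/
def Good (i : I) (A : Set V) (st : Prop) : Set V :=
  {t | t ∈ A ∧ G.Terminal t ∧ (st → ∃ s ∈ A, G.Terminal s ∧ G.payoff s i < G.payoff t i)}

/-- In the graph `F`, player `i` can stay in `S` forever and, whenever `i` randomises among the
edges inside `S`, reaches `Good i A st` almost surely from all vertices of `S`. -/
def Win (i : I) (A : Set V) (F : Set (V × V)) (st : Prop) (S : Set V) : Prop :=
  S ⊆ A ∧
  (∀ u ∈ S, G.owner u ≠ some i → ∀ v, (u, v) ∈ F → v ∈ S) ∧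
  ∀ u ∈ S, PathIn F S (G.Good i A st) u

/-- One step of the greatest-fixed-point iteration that computes the largest `Win` set: the
vertices of `X` from which `Good i A st` is reached along vertices whose successors cannot leave
`X` against the will of player `i`. -/
def Att (i : I) (A : Set V) (F : Set (V × V)) (st : Prop) (X : Set V) : Set V :=
  {u | PathIn F {u | u ∈ X ∧ (u ∈ G.Good i A st ∨
    (G.owner u ≠ some i → ∀ v, (u, v) ∈ F → v ∈ X))} (G.Good i A st) u}

/-- The set of the vertices visited with positive probability when player `i` deviates from a
stationary profile with support `F` and thereby almost surely reaches `Good i A st`, described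
by the properties of its graph: it consists of vertices reachable from `v₀`, it is closed
under the moves of the others, and `Good i A st` can be reached inside it. -/
structure IsDevSet (v₀ : V) (i : I) (A : Set V) (F : Set (V × V)) (st : Prop) (S : Set V) :
    Prop where
  init_mem : v₀ ∈ S
  reach : ∀ Z : Set V, v₀ ∈ Z →
    (∀ u ∈ Z, u ∈ S → ∀ v ∈ S, (u, v) ∈ G.effEdges →
      (G.owner u ≠ some i → (u, v) ∈ F) → v ∈ Z) → S ⊆ Z
  closed : ∀ u ∈ S, G.owner u ≠ some i → ∀ v, (u, v) ∈ F → v ∈ S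
  path : ∀ u ∈ S, PathIn G.effEdges S
    {t | G.Terminal t ∧ (st → ∃ s ∈ A, G.Terminal s ∧ G.payoff s i < G.payoff t i)} u

/-- The invariant of the elimination process, with the set `A` of live vertices, the set `F` of
remaining edges, and `st` telling whether an elimination has taken place already. -/
structure Inv (v₀ : V) (P : Set I) (A : Set V) (F : Set (V × V)) (st : Prop) : Prop where
  init_mem : v₀ ∈ A
  sub : F ⊆ G.effEdges
  inside : ∀ u ∈ A, ∀ v ∈ A, (u, v) ∈ G.effEdges → (u, v) ∈ F
  closed : ∀ u ∈ A, ∀ v, (u, v) ∈ F → v ∈ A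
  full : ∀ u, (∀ i, G.owner u = some i → i ∉ P) → ∀ v, (u, v) ∈ G.effEdges → (u, v) ∈ F
  total : ∀ u, ¬ G.Terminal u → ∃ v, (u, v) ∈ F
  term : st → ∀ u ∈ A, PathIn F A {t | G.Terminal t} u
  /-- Now and after all later eliminations, it is useless for a player to leave `A`. -/
  dev : ∀ i ∈ P, ∀ (A' : Set V) (F' : Set (V × V)) (st' : Prop), A' ⊆ A → F' ⊆ F →
    (∀ u, u ∉ A → ∀ v, (u, v) ∈ F → (u, v) ∈ F') → (∀ u ∈ A, ∀ v, (u, v) ∈ F' → v ∈ A) →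
    (st → st') → ∀ S, G.IsDevSet v₀ i A' F' st' S → S ⊆ A

variable {G} {v₀ : V} {P : Set I} {A : Set V} {F : Set (V × V)} {st : Prop} {i : I}

theorem Good.mono {A' : Set V} {st' : Prop} {t : V}
    (h : G.Terminal t ∧ (st' → ∃ s ∈ A', G.Terminal s ∧ G.payoff s i < G.payoff t i))
    (hA : A' ⊆ A) (hst : st → st') (ht : t ∈ A) : t ∈ G.Good i A st := by
  refine ⟨ht, h.1, fun h0 => ?_⟩
  obtain ⟨s, hs, h1⟩ := h.2 (hst h0)
  exact ⟨s, hA hs, h1⟩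

theorem Att_subset (X : Set V) : G.Att i A F st X ⊆ X := fun _ hu => (PathIn.mem hu).1

/-- The iteration keeps all `Win` sets. -/
theorem Win.subset_Att {S X : Set V} (h : G.Win i A F st S) (hX : S ⊆ X) :
    S ⊆ G.Att i A F st X := fun u hu =>
  (h.2.2 u hu).mono (fun v hv => ⟨hX hv, .inr fun ho w hw => hX (h.2.1 v hv ho w hw)⟩)
    (fun _ _ ht => ht) (fun _ _ _ _ he => he)

theorem Terminal.not_mem_of_sub (hF : F ⊆ G.effEdges) {u v : V} (hu : G.Terminal u) :
    (u, v) ∉ F := fun h => hu v (hF h).1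

/-- A fixed point of the iteration is a `Win` set. -/
theorem Win.of_Att_eq (hF : F ⊆ G.effEdges) {X : Set V} (hX : X ⊆ A)
    (h : X ⊆ G.Att i A F st X) : G.Win i A F st X := by
  have key : ∀ u ∈ X, G.owner u ≠ some i → ∀ v, (u, v) ∈ F → v ∈ X := by
    intro u hu ho v hv
    rcases (PathIn.mem (h hu)).2 with hg | hg
    · exact absurd hv (Terminal.not_mem_of_sub hF hg.2.1)
    · exact hg ho v hv
  exact ⟨hX, key, fun u hu => PathIn.mono (h hu) (fun _ hv => hv.1) (fun _ _ ht => ht)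
    (fun _ _ _ _ he => he)⟩

namespace Inv

/-- At the start all edges are present. -/
theorem start (hterm : ∀ u, ¬ G.Terminal u → ∃ v, (u, v) ∈ G.effEdges) (hv : v₀ ∈ A)
    (hA : ∀ u ∈ A, ∀ v, (u, v) ∈ G.effEdges → v ∈ A)
    (hst : st → ∀ u ∈ A, PathIn G.effEdges A {t | G.Terminal t} u) :
    G.Inv v₀ P A G.effEdges st where
  init_mem := hv
  sub := subset_rfl
  inside _ _ _ _ h := h
  closed := hA
  full _ _ _ h := h
  total := hterm
  term := hst
  dev _ _ _ _ _ _ _ _ _ _ _ hS := hS.reach A hv fun u hu _ v _ huv _ => hA u hu v huv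

/-- The elimination step: player `i` gives up the edges that leave the largest `Win` set `W`. Only
the clause `dev` of the invariant takes an argument. A later deviation set `S` of player `i` would
give the `Win` set `S ∪ W`, so that it is contained in `W`. A deviation set of another player
cannot leave `W`, since player `i` does not use the edges that leave `W` and the others have
none. -/
theorem elim (h : G.Inv v₀ P A F st) (hi : i ∈ P) {W : Set V} (hW : G.Win i A F st W)
    (hv : v₀ ∈ W) (hmax : ∀ S, G.Win i A F st S → S ⊆ W) :
    G.Inv v₀ P W (F \ {e | e.1 ∈ W ∧ e.2 ∉ W}) True := by
  have hWA := hW.1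
  have hpath : ∀ u ∈ W, PathIn (F \ {e | e.1 ∈ W ∧ e.2 ∉ W}) W {t | G.Terminal t} u := fun u hu =>
    (hW.2.2 u hu).mono subset_rfl (fun t _ ht => ht.2.1)
      (fun a ha b hb hab => ⟨hab, fun hc => hc.2 hb⟩)
  refine ⟨hv, fun e he => h.sub he.1, fun u hu v hv' he => ⟨h.inside u (hWA hu) v (hWA hv') he,
    fun hc => hc.2 hv'⟩, fun u hu v he => by_contra fun hc => he.2 ⟨hu, hc⟩, ?_, ?_, fun _ => hpath,
    ?_⟩
  · intro u ho v he
    have hF := h.full u ho v he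
    exact ⟨hF, fun hc => hc.2 (hW.2.1 u hc.1 (fun h' => ho i h' hi) v hF)⟩
  · intro u hu
    by_cases huW : u ∈ W
    · cases hpath u huW with
      | base _ ht => exact absurd ht hu
      | step _ hv' _ => exact ⟨_, hv'⟩
    · obtain ⟨v, hv'⟩ := h.total u hu
      exact ⟨v, hv', fun hc => huW hc.1⟩
  · intro j hj A' F' st' hA' hF' hout hin hst' S hS
    have hSA : S ⊆ A := by
      refine h.dev j hj A' F' st' (hA'.trans hWA) (fun e he => (hF' he).1) ?_ ?_
        (fun _ => hst' trivial) S hS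
      · exact fun u hu v he => hout u (fun hc => hu (hWA hc)) v ⟨he, fun hc => hu (hWA hc.1)⟩
      · exact fun u hu v he => h.closed u hu v (hF' he).1
    by_cases hji : j = i
    · subst hji
      -- `W` is the largest `Win` set and contains the union of `S` and `W`
      have : G.Win j A F st (S ∪ W) := by
        refine ⟨Set.union_subset hSA hWA, ?_, ?_⟩
        · intro u hu ho v he
          by_cases huW : u ∈ W
          · exact .inr (hW.2.1 u huW ho v he)
          · exact .inl (hS.closed u (hu.resolve_right huW) ho v
              (hout u huW v ⟨he, fun hc => huW hc.1⟩))
        · rintro u (hu | hu)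
          · exact (hS.path u hu).mono Set.subset_union_left
              (fun t hts ht => Good.mono ht (hA'.trans hWA) (fun _ => hst' trivial) (hSA hts))
              (fun a ha b hb hab => h.inside a (hSA ha) b (hSA hb) hab)
          · exact (hW.2.2 u hu).mono Set.subset_union_right (fun t _ ht => ht)
              (fun a _ b _ hab => hab)
      exact Set.subset_union_left.trans (hmax _ this)
    · refine hS.reach W hv fun u huW huS v hvS huv hF => ?_
      by_cases ho : G.owner u = some j
      · exact hW.2.1 u huW (by rw [ho]; simpa using hji) v
          (h.inside u (hSA huS) v (hSA hvS) huv)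
      · exact hin u huW v (hF ho)

/-- When no pessimist can win from `v₀` any more, no pessimist has a deviation that almost surely
reaches a terminal vertex which is not worst. -/
theorem not_isDevSet (h : G.Inv v₀ P A F st) (hi : i ∈ P)
    (hfin : ∀ S, G.Win i A F st S → v₀ ∉ S) (S : Set V) : ¬ G.IsDevSet v₀ i A F st S := by
  intro hS
  have hSA := h.dev i hi A F st subset_rfl subset_rfl (fun _ _ _ he => he) h.closed id S hS
  refine hfin S ⟨hSA, hS.closed, fun u hu => ?_⟩ hS.init_mem
  exact (hS.path u hu).mono subset_rfl
    (fun t hts ht => Good.mono ht subset_rfl id (hSA hts))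
    (fun a ha b hb hab => h.inside a (hSA ha) b (hSA hb) hab)

end Inv

theorem Win.sUnion {S : Set (Set V)} (h : ∀ s ∈ S, G.Win i A F st s) : G.Win i A F st (⋃₀ S) := by
  refine ⟨Set.sUnion_subset fun s hs => (h s hs).1, ?_, ?_⟩
  · rintro u ⟨s, hs, hu⟩ ho v he
    exact ⟨s, hs, (h s hs).2.1 u hu ho v he⟩
  · rintro u ⟨s, hs, hu⟩
    exact ((h s hs).2.2 u hu).mono (Set.subset_sUnion_of_mem hs) (fun _ _ ht => ht)
      (fun _ _ _ _ he => he)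

/-- An elimination for a player who was after the terminal vertices that are not worst removes a
vertex, provided that `v₀` can still win: the worst terminal vertex has been dropped. -/
theorem Win.ssubset [Finite V] (hF : F ⊆ G.effEdges) {W : Set V} (hW : G.Win i A F True W)
    (hv : v₀ ∈ W) : W ⊂ A := by
  refine hW.1.ssubset_of_ne fun heq => ?_
  subst heq
  have hne : ∃ t, t ∈ W ∧ G.Terminal t := by
    have := hW.2.2 v₀ hv
    clear hv
    induction this with
    | base hu ht => exact ⟨_, hu, ht.2.1⟩
    | step _ _ _ ih => exact ih
  obtain ⟨t, ht, hmin⟩ := Set.exists_min_image {t | t ∈ W ∧ G.Terminal t} (fun t => G.payoff t i)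
    (Set.toFinite _) hne
  have : t ∈ G.Good i W True := by
    rcases hW.2.2 t ht.1 with ⟨_, h⟩ | ⟨_, h, _⟩
    · exact h
    · exact absurd h (Terminal.not_mem_of_sub hF ht.2)
  obtain ⟨s, hs, hts, hlt⟩ := this.2.2 trivial
  exact absurd (hmin s ⟨hs, hts⟩) (not_le.2 hlt)

/-- The elimination process comes to an end. -/
theorem Inv.exists_final [Finite V] (h : G.Inv v₀ P A F st) :
    ∃ (A' : Set V) (F' : Set (V × V)) (st' : Prop), G.Inv v₀ P A' F' st' ∧
      ∀ i ∈ P, ∀ S, G.Win i A' F' st' S → v₀ ∉ S := by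
  have step : ∀ {A F st}, G.Inv v₀ P A F st →
      (∀ i ∈ P, ∀ S, G.Win i A F st S → v₀ ∉ S) ∨
      ∃ i W, G.Win i A F st W ∧ v₀ ∈ W ∧
        G.Inv v₀ P W (F \ {e | e.1 ∈ W ∧ e.2 ∉ W}) True := by
    intro A F st h
    by_contra! hc
    obtain ⟨⟨i, hi, S, hS, hv⟩, hc⟩ := hc
    have hU := Win.sUnion (S := {S | G.Win i A F st S}) fun s hs => hs
    have hSU : S ⊆ ⋃₀ {S | G.Win i A F st S} := Set.subset_sUnion_of_mem hS
    exact hc i _ hU (hSU hv) (h.elim hi hU (hSU hv) fun T hT => Set.subset_sUnion_of_mem hT)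
  -- all the eliminations but the first one remove a vertex
  have main : ∀ (n : ℕ) (A : Set V) (F : Set (V × V)), A.ncard ≤ n → G.Inv v₀ P A F True →
      ∃ (A' : Set V) (F' : Set (V × V)) (st' : Prop), G.Inv v₀ P A' F' st' ∧
        ∀ i ∈ P, ∀ S, G.Win i A' F' st' S → v₀ ∉ S := by
    intro n
    induction n with
    | zero =>
      intro A F hA h
      have := (Set.ncard_eq_zero (Set.toFinite A)).1 (Nat.le_zero.1 hA)
      exact absurd h.init_mem (by simp [this])
    | succ n ih =>
      intro A F hA h
      rcases step h with hf | ⟨i, W, hW, hv, h'⟩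
      · exact ⟨A, F, True, h, hf⟩
      · have := Set.ncard_lt_ncard (hW.ssubset h.sub hv) (Set.toFinite A)
        exact ih W _ (by omega) h'
  rcases step h with hf | ⟨i, W, hW, hv, h'⟩
  · exact ⟨A, F, st, h, hf⟩
  · exact main _ W _ le_rfl h'

end Game

/-! ### The law of a play -/

namespace Game

variable {V I : Type*} {G : Game V I} {v₀ : V}

/-- The play `ω` is possible under `σ`: it starts in `v₀`, and all its moves have positive
probability. -/
def Profile.Possible (σ : G.Profile v₀) (ω : ℕ → V) : Prop :=
  ω 0 = v₀ ∧ ∀ n, σ.next n (Preorder.frestrictLe n ω) (ω (n + 1)) ≠ 0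

section Law

variable [Finite V] [MeasurableSpace V] [DiscreteMeasurableSpace V]

instance (σ : G.Profile v₀) : IsProbabilityMeasure σ.law := by
  unfold Profile.law; infer_instance

variable (σ : G.Profile v₀)

/-- The disintegration of the law along the next move. -/
theorem Profile.law_next (n : ℕ) (B : Set (Hist V n)) (v : V) :
    σ.law {ω | Preorder.frestrictLe n ω ∈ B ∧ ω (n + 1) = v} =
      ∫⁻ h in B, σ.next n h v ∂(σ.law.map (Preorder.frestrictLe n)) := by
  have hc := Kernel.partialTraj_compProd_eq_map_traj (X := fun _ => V) (κ := σ.kernel)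
    (Nat.zero_le n) (x₀ := fun _ => v₀)
  have hB : MeasurableSet B := (Set.toFinite B).measurableSet
  have h1 := congrArg (fun μ => μ (B ×ˢ {v})) hc
  rw [Measure.compProd_apply_prod hB (measurableSet_singleton _),
    Measure.map_apply (by fun_prop) (hB.prod (measurableSet_singleton _)),
    ← Kernel.traj_map_frestrictLe_apply] at h1
  have hk : ∀ h, σ.kernel n h {v} = σ.next n h v := fun h =>
    PMF.toMeasure_apply_singleton _ _ (measurableSet_singleton _)
  simp only [hk] at h1
  exact h1.symm

theorem Profile.law_step (n : ℕ) (h : Hist V n) (v : V) :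
    σ.law {ω | Preorder.frestrictLe n ω = h ∧ ω (n + 1) = v} =
      σ.next n h v * σ.law {ω | Preorder.frestrictLe n ω = h} := by
  refine (σ.law_next n {h} v).trans ?_
  rw [lintegral_singleton, Measure.map_apply (by fun_prop) (measurableSet_singleton _)]
  rfl

theorem Profile.ae_possible : ∀ᵐ ω ∂σ.law, σ.Possible ω := by
  have h0 : ∀ᵐ ω ∂σ.law, ω 0 = v₀ := by
    have h1 := Kernel.traj_map_frestrictLe_apply (κ := σ.kernel) (X := fun _ => V) 0 0 (fun _ => v₀)
    rw [Kernel.partialTraj_self, Kernel.id_apply] at h1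
    have h2 : ∀ᵐ x ∂((σ.law).map (Preorder.frestrictLe (π := fun _ => V) 0)), x = fun _ => v₀ := by
      rw [Profile.law, h1, ae_dirac_eq]; rfl
    have h3 := ae_of_ae_map (by fun_prop) h2
    filter_upwards [h3] with ω hω
    exact congrFun hω ⟨0, Finset.mem_Iic.2 le_rfl⟩
  refine h0.and (ae_all_iff.2 fun n => ?_)
  have : ∀ (h : Hist V n) (v : V), ∀ᵐ ω ∂σ.law, Preorder.frestrictLe n ω = h → ω (n + 1) = v →
      σ.next n h v ≠ 0 := by
    intro h v
    by_cases hz : σ.next n h v = 0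
    · have h1 := σ.law_step n h v
      rw [hz, zero_mul] at h1
      filter_upwards [measure_eq_zero_iff_ae_notMem.1 h1] with ω hω ha hb
      exact absurd ⟨ha, hb⟩ hω
    · exact .of_forall fun _ _ _ => hz
  filter_upwards [ae_all_iff.2 fun h => ae_all_iff.2 (this h)] with ω hω
  exact hω _ _ rfl rfl

/-- The vertices that are visited with positive probability. -/
def Profile.visited : Set V := {u | ∃ n, σ.law {ω | ω n = u} ≠ 0}

theorem Profile.ae_visited : ∀ᵐ ω ∂σ.law, ∀ n, ω n ∈ σ.visited := by
  refine ae_all_iff.2 fun n => ?_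
  have : ∀ u, ∀ᵐ ω ∂σ.law, ω n = u → u ∈ σ.visited := by
    intro u
    by_cases hz : σ.law {ω | ω n = u} = 0
    · filter_upwards [measure_eq_zero_iff_ae_notMem.1 hz] with ω hω ha
      exact absurd ha hω
    · exact .of_forall fun _ _ => ⟨n, hz⟩
  filter_upwards [ae_all_iff.2 this] with ω hω
  exact hω _ rfl

/-- Almost sure properties hold for some play through each visited vertex. -/
theorem Profile.exists_of_visited {p : (ℕ → V) → Prop} (hp : ∀ᵐ ω ∂σ.law, p ω) {n : ℕ} {u : V}
    (hu : σ.law {ω | ω n = u} ≠ 0) : ∃ ω, ω n = u ∧ p ω := by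
  by_contra! hc
  refine hu (measure_mono_null ?_ hp)
  exact fun ω hω => hc ω hω

theorem Profile.init_visited : v₀ ∈ σ.visited := by
  obtain ⟨ω, h1, h2⟩ := (σ.ae_visited.and σ.ae_possible).exists
  exact h2.1 ▸ h1 0

end Law

section Possible

variable {σ : G.Profile v₀} {ω : ℕ → V} (h : σ.Possible ω)
include h

theorem Profile.Possible.of_terminal {n : ℕ} (ht : G.Terminal (ω n)) : ω (n + 1) = ω n := by
  have := h.2 n
  have ht' : G.Terminal (Hist.last (Preorder.frestrictLe (π := fun _ => V) n ω)) := ht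
  rw [Profile.next, if_pos ht', PMF.pure_apply] at this
  by_contra hc
  exact this (if_neg hc)

theorem Profile.Possible.terminal_of_le {n k : ℕ} (hnk : n ≤ k) (ht : G.Terminal (ω n)) :
    ω k = ω n := by
  induction k, hnk using Nat.le_induction with
  | base => rfl
  | succ k _ ih => rw [h.of_terminal (ih ▸ ht), ih]

theorem Profile.Possible.next_stoch {n : ℕ} (ht : ¬ G.Terminal (ω n))
    (ho : G.owner (ω n) = none) : G.prob (ω n) (ω (n + 1)) ≠ 0 := by
  have := h.2 n
  have ht' : ¬ G.Terminal (Hist.last (Preorder.frestrictLe (π := fun _ => V) n ω)) := ht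
  have ho' : G.owner (Hist.last (Preorder.frestrictLe (π := fun _ => V) n ω)) = none := ho
  rw [Profile.next, if_neg ht', ho'] at this
  exact this

theorem Profile.Possible.next_player {n : ℕ} (ht : ¬ G.Terminal (ω n)) {i : I}
    (ho : G.owner (ω n) = some i) :
    (σ i).act n (Preorder.frestrictLe n ω) (ω (n + 1)) ≠ 0 := by
  have := h.2 n
  have ht' : ¬ G.Terminal (Hist.last (Preorder.frestrictLe (π := fun _ => V) n ω)) := ht
  have ho' : G.owner (Hist.last (Preorder.frestrictLe (π := fun _ => V) n ω)) = some i := ho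
  rw [Profile.next, if_neg ht', ho'] at this
  exact this

theorem Profile.Possible.isPath {n : ℕ} (ht : ¬ G.Terminal (ω n)) :
    G.IsPath v₀ (n := n) (Preorder.frestrictLe n ω) := by
  induction n with
  | zero => exact ⟨h.1, fun k hk => absurd hk (Nat.not_lt_zero k)⟩
  | succ n ih =>
    have hn : ¬ G.Terminal (ω n) := fun hc => ht (h.of_terminal hc ▸ hc)
    have hp := ih hn
    refine ⟨h.1, fun k hk => ?_⟩
    rcases Nat.lt_succ_iff_lt_or_eq.1 hk with hk' | rfl
    · exact hp.2 k hk'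
    · change (ω k, ω (k + 1)) ∈ G.edges
      rcases ho : G.owner (ω k) with _ | i
      · obtain ⟨v, hv⟩ := not_forall_not.1 hn
        exact G.prob_edge _ ho ⟨v, hv⟩ _ (h.next_stoch hn ho)
      · exact (σ i).act_edge k _ ⟨hp, ho, hn⟩ _ (h.next_player hn ho)

theorem Profile.Possible.isHistOf {n : ℕ} (ht : ¬ G.Terminal (ω n)) {i : I}
    (ho : G.owner (ω n) = some i) : G.IsHistOf v₀ i (n := n) (Preorder.frestrictLe n ω) :=
  ⟨h.isPath ht, ho, ht⟩

theorem Profile.Possible.effEdge {n : ℕ} (ht : ¬ G.Terminal (ω n)) :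
    (ω n, ω (n + 1)) ∈ G.effEdges := by
  rcases ho : G.owner (ω n) with _ | i
  · obtain ⟨v, hv⟩ := not_forall_not.1 ht
    have := h.next_stoch ht ho
    exact ⟨G.prob_edge _ ho ⟨v, hv⟩ _ this, fun _ => this⟩
  · exact ⟨(σ i).act_edge n _ (h.isHistOf ht ho) _ (h.next_player ht ho),
      fun hc => by simp [ho] at hc⟩

end Possible

variable {σ : G.Profile v₀} {F : Set (V × V)} {i : I} {τ : G.Strategy v₀ i}

theorem Profile.deviate_of_ne {j : I} (h : j ≠ i) : σ.deviate i τ j = σ j := by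
  classical
  simp [Profile.deviate, Function.update_of_ne h]

theorem Profile.Possible.support_deviate (hF : σ.HasSupport F) {ω : ℕ → V}
    (h : (σ.deviate i τ).Possible ω) {n : ℕ} (ht : ¬ G.Terminal (ω n)) {j : I} (hj : j ≠ i)
    (ho : G.owner (ω n) = some j) : (ω n, ω (n + 1)) ∈ F := by
  have := h.next_player ht ho
  rw [Profile.deviate_of_ne hj] at this
  exact (hF j n _ (h.isHistOf ht ho) _).1 this

theorem Profile.Possible.support (hF : σ.HasSupport F) {ω : ℕ → V} (h : σ.Possible ω) {n : ℕ}
    (ht : ¬ G.Terminal (ω n)) {j : I} (ho : G.owner (ω n) = some j) : (ω n, ω (n + 1)) ∈ F :=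
  (hF j n _ (h.isHistOf ht ho) _).1 (h.next_player ht ho)

variable [Finite V] [MeasurableSpace V] [DiscreteMeasurableSpace V]

/-- A successor of a visited vertex is visited, if all the moves to it at possible histories have
positive probability. -/
theorem Profile.visited_step (σ : G.Profile v₀) {u v : V} (hu : u ∈ σ.visited)
    (hpos : ∀ n ω, σ.Possible ω → ω n = u → σ.next n (Preorder.frestrictLe n ω) v ≠ 0) :
    v ∈ σ.visited := by
  obtain ⟨n, hn⟩ := hu
  have : ∃ h : Hist V n, h.last = u ∧ σ.law {ω | Preorder.frestrictLe n ω = h} ≠ 0 := by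
    by_contra! hc
    refine hn (measure_mono_null (t := ⋃ h : {h : Hist V n // h.last = u},
      {ω | Preorder.frestrictLe n ω = h.1}) ?_ ?_)
    · intro ω hω
      exact Set.mem_iUnion.2 ⟨⟨Preorder.frestrictLe n ω, hω⟩, rfl⟩
    · exact measure_iUnion_null fun h => hc h.1 h.2
  obtain ⟨h, hl, hh⟩ := this
  have hx : ∃ ω, Preorder.frestrictLe n ω = h ∧ σ.Possible ω := by
    by_contra! hc
    exact hh (measure_mono_null (fun ω hω => hc ω hω) σ.ae_possible)
  obtain ⟨ω, h1, h2⟩ := hx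
  have hp := hpos n ω h2 (by rw [← hl, ← h1]; rfl)
  rw [h1] at hp
  refine ⟨n + 1, fun hc => ?_⟩
  have := σ.law_step n h v
  rw [measure_mono_null (fun ω hω => hω.2) hc] at this
  exact mul_ne_zero hp hh this.symm

end Game

/-! ### Payoffs and their extremes -/

namespace Game

variable {V I : Type*} {G : Game V I} {v₀ : V}

theorem reward_of_terminal {i : I} {ω : ℕ → V}
    (hω : ∀ n k, n ≤ k → G.Terminal (ω n) → ω k = ω n) {n : ℕ} (ht : G.Terminal (ω n)) :
    G.reward i ω = G.payoff (ω n) i := by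
  classical
  have hx : ∃ n, G.Terminal (ω n) := ⟨n, ht⟩
  rw [reward, dif_pos hx, hω _ n (Nat.find_min' hx ht) (Nat.find_spec hx)]

theorem reward_eq_zero {i : I} {ω : ℕ → V} (h : ∀ n, ¬ G.Terminal (ω n)) :
    G.reward i ω = 0 := by
  rw [reward, dif_neg (by simpa using h)]

theorem reward_nonneg (hG : G.NonnegRewards) (i : I) (ω : ℕ → V) : 0 ≤ G.reward i ω := by
  classical
  rw [reward]
  split_ifs with hx
  · exact hG _ (Nat.find_spec hx) i
  · exact le_rfl

theorem exists_reward_le [Finite V] (i : I) : ∃ B : ℝ, ∀ ω, G.reward i ω ≤ B := by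
  classical
  obtain ⟨B, hB⟩ := (Set.finite_range fun t => G.payoff t i).bddAbove
  refine ⟨max B 0, fun ω => ?_⟩
  rw [reward]
  split_ifs with hx
  · exact le_max_of_le_left (hB ⟨_, rfl⟩)
  · exact le_max_right _ _

section Ess

variable [MeasurableSpace V] {μ : Measure (ℕ → V)}

theorem reward_bdd_ge (hG : G.NonnegRewards) (i : I) :
    Filter.IsBoundedUnder (· ≥ ·) (ae μ) (G.reward i) :=
  Filter.isBoundedUnder_of ⟨0, fun ω => reward_nonneg hG i ω⟩

theorem reward_bdd_le [Finite V] (i : I) : Filter.IsBoundedUnder (· ≤ ·) (ae μ) (G.reward i) := by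
  obtain ⟨B, hB⟩ := exists_reward_le (G := G) i
  exact Filter.isBoundedUnder_of ⟨B, hB⟩

theorem le_essInf_reward [Finite V] [IsProbabilityMeasure μ] {i : I} {c : ℝ}
    (h : ∀ᵐ ω ∂μ, c ≤ G.reward i ω) : c ≤ essInf (G.reward i) μ :=
  le_essInf_of_ae_le c h (reward_bdd_le i).isCoboundedUnder_ge

theorem essSup_reward_le [IsProbabilityMeasure μ] (hG : G.NonnegRewards) {i : I} {c : ℝ}
    (h : ∀ᵐ ω ∂μ, G.reward i ω ≤ c) : essSup (G.reward i) μ ≤ c :=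
  essSup_le_of_ae_le c h (reward_bdd_ge hG i).isCoboundedUnder_le

end Ess

variable {A : Set V} {F : Set (V × V)} {st : Prop} {P : Set I}

/-- Where `ρ` plays like a profile with support `F`, the edges of `F` have positive probability. -/
theorem Profile.next_ne_zero {σ ρ : G.Profile v₀} (hF : σ.HasSupport F) (hsub : F ⊆ G.effEdges)
    {u v : V} (hρ : ∀ j, G.owner u = some j → ρ j = σ j) (huv : (u, v) ∈ F) {n : ℕ} {ω : ℕ → V}
    (h : ρ.Possible ω) (hu : ω n = u) : ρ.next n (Preorder.frestrictLe n ω) v ≠ 0 := by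
  subst hu
  have ht : ¬ G.Terminal (ω n) := fun ht => ht v (hsub huv).1
  have ht' : ¬ G.Terminal (Hist.last (Preorder.frestrictLe (π := fun _ => V) n ω)) := ht
  rw [Profile.next, if_neg ht']
  rcases ho : G.owner (ω n) with _ | j
  · have ho' : G.owner (Hist.last (Preorder.frestrictLe (π := fun _ => V) n ω)) = none := ho
    rw [ho']
    exact (hsub huv).2 ho
  · have ho' : G.owner (Hist.last (Preorder.frestrictLe (π := fun _ => V) n ω)) = some j := ho
    rw [ho']
    simp only [hρ j ho]
    exact (hF j n _ (h.isHistOf ht ho) v).2 huv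

theorem Profile.Possible.mem_of_closed {ρ : G.Profile v₀} {ω : ℕ → V} (h : ρ.Possible ω)
    {Z : Set V} (hv : v₀ ∈ Z)
    (hZ : ∀ n, ω n ∈ Z → ¬ G.Terminal (ω n) → ω (n + 1) ∈ Z) (n : ℕ) : ω n ∈ Z := by
  induction n with
  | zero => rw [h.1]; exact hv
  | succ n ih =>
    by_cases ht : G.Terminal (ω n)
    · rw [h.of_terminal ht]; exact ih
    · exact hZ n ih ht

/-- A stationary profile repeats the same distribution at each visit of a vertex. -/
theorem Profile.Stationary.next_eq {σ : G.Profile v₀} (hσ : σ.Stationary) {n n' : ℕ}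
    {ω ω' : ℕ → V} (h : σ.Possible ω) (h' : σ.Possible ω') (he : ω n = ω' n')
    (ht : ¬ G.Terminal (ω n)) :
    σ.next n (Preorder.frestrictLe n ω) = σ.next n' (Preorder.frestrictLe n' ω') := by
  have h1 : ¬ G.Terminal (Hist.last (Preorder.frestrictLe (π := fun _ => V) n ω)) := ht
  have h2 : ¬ G.Terminal (Hist.last (Preorder.frestrictLe (π := fun _ => V) n' ω')) := by
    rw [he] at ht; exact ht
  have hl : Hist.last (Preorder.frestrictLe (π := fun _ => V) n ω) =
    Hist.last (Preorder.frestrictLe (π := fun _ => V) n' ω') := he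
  rw [Profile.next, Profile.next, if_neg h1, if_neg h2, hl]
  rcases ho : G.owner (ω' n') with _ | j
  · have ho' : G.owner (Hist.last (Preorder.frestrictLe (π := fun _ => V) n' ω')) = none := ho
    rw [ho']
  · have ho' : G.owner (Hist.last (Preorder.frestrictLe (π := fun _ => V) n' ω')) = some j := ho
    rw [ho']
    exact hσ j n n' _ _ (h.isHistOf ht (he ▸ ho)) (h'.isHistOf (he ▸ ht) ho) he

variable [Finite V] [MeasurableSpace V] [DiscreteMeasurableSpace V]

/-- A deviation by which player `i` almost surely reaches a set `T` of terminal vertices visits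
only vertices of a deviation set. -/
theorem Profile.isDevSet_visited {σ : G.Profile v₀} (hF : σ.HasSupport F)
    (hsub : F ⊆ G.effEdges)
    (hst : ∀ u, G.owner u = none → ∀ v, (u, v) ∈ G.effEdges → (u, v) ∈ F)
    {i : I} {τ : G.Strategy v₀ i}
    (hwin : ∀ᵐ ω ∂(σ.deviate i τ).law, ∃ n, G.Terminal (ω n) ∧
      (st → ∃ s ∈ A, G.Terminal s ∧ G.payoff s i < G.payoff (ω n) i)) :
    G.IsDevSet v₀ i A F st (σ.deviate i τ).visited where
  init_mem := Profile.init_visited _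
  reach Z hv hZ u hu := by
    obtain ⟨n, hn⟩ := hu
    obtain ⟨ω, rfl, hω, hvis⟩ := Profile.exists_of_visited _
      ((Profile.ae_possible _).and (Profile.ae_visited _)) hn
    refine hω.mem_of_closed hv (fun n hn ht => ?_) n
    refine hZ _ hn (hvis n) _ (hvis (n + 1)) (hω.effEdge ht) fun ho => ?_
    rcases ho' : G.owner (ω n) with _ | j
    · exact hst _ ho' _ (hω.effEdge ht)
    · exact hω.support_deviate hF ht (fun hc => ho (by rw [ho', hc])) ho'
  closed u hu ho v huv := Profile.visited_step _ hu fun n ω hω hn =>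
    Profile.next_ne_zero hF hsub
      (fun j hj => Profile.deviate_of_ne fun hc => ho (by rw [hj, hc])) huv hω hn
  path u hu := by
    obtain ⟨n, hn⟩ := hu
    obtain ⟨ω, rfl, hω, hvis, N, htN, hN⟩ := Profile.exists_of_visited _
      ((Profile.ae_possible _).and ((Profile.ae_visited _).and hwin)) hn
    have key : ∀ d n, N ≤ n + d → PathIn G.effEdges (σ.deviate i τ).visited
        {t | G.Terminal t ∧ (st → ∃ s ∈ A, G.Terminal s ∧ G.payoff s i < G.payoff t i)} (ω n) := by
      intro d
      induction d with
      | zero =>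
        intro n hn
        have := hω.terminal_of_le (k := n) hn htN
        exact .base (hvis n) (by rw [this]; exact ⟨htN, hN⟩)
      | succ d ih =>
        intro n hn
        by_cases ht : G.Terminal (ω n)
        · refine .base (hvis n) ?_
          rcases le_total N n with hle | hle
          · rw [hω.terminal_of_le hle htN]; exact ⟨htN, hN⟩
          · rw [← hω.terminal_of_le hle ht]; exact ⟨htN, hN⟩
        · exact .step (hvis n) (hω.effEdge ht) (ih (n + 1) (by omega))
    exact key N n (by omega)

theorem Profile.law_step_vertex {σ : G.Profile v₀} (hσ : σ.Stationary) {u : V} (v : V)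
    (ht : ¬ G.Terminal u) {m : ℕ} {ω' : ℕ → V} (hω' : σ.Possible ω') (hm : ω' m = u) (n : ℕ) :
    σ.law {ω | ω n = u ∧ ω (n + 1) = v} =
      σ.next m (Preorder.frestrictLe m ω') v * σ.law {ω | ω n = u} := by
  have hf : Measurable (Preorder.frestrictLe (π := fun _ : ℕ => V) n) :=
    Preorder.measurable_frestrictLe n
  have hB : MeasurableSet {h : Hist V n | Hist.last h = u} := (Set.toFinite _).measurableSet
  have hae : ∀ᵐ h ∂(σ.law.map (Preorder.frestrictLe (π := fun _ : ℕ => V) n)),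
      h ∈ {h : Hist V n | Hist.last h = u} →
      σ.next n h v = σ.next m (Preorder.frestrictLe m ω') v := by
    rw [ae_map_iff hf.aemeasurable (Set.toFinite _).measurableSet]
    filter_upwards [σ.ae_possible] with ω hω hu
    have hu' : ω n = u := hu
    rw [hσ.next_eq hω hω' (hu'.trans hm.symm) (by rw [hu']; exact ht)]
  calc σ.law {ω | ω n = u ∧ ω (n + 1) = v}
      = ∫⁻ h in {h : Hist V n | Hist.last h = u}, σ.next n h v
          ∂(σ.law.map (Preorder.frestrictLe n)) := σ.law_next n {h | Hist.last h = u} v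
    _ = ∫⁻ h in {h : Hist V n | Hist.last h = u}, σ.next m (Preorder.frestrictLe m ω') v
          ∂(σ.law.map (Preorder.frestrictLe n)) := setLIntegral_congr_fun_ae hB hae
    _ = σ.next m (Preorder.frestrictLe m ω') v * σ.law {ω | ω n = u} := by
        rw [setLIntegral_const, Measure.map_apply hf hB]
        rfl

/-- Under a stationary profile with support `F`, a non-terminal vertex with a path to a terminal
vertex is almost surely visited only finitely often, since the expected number of visits is
finite. -/
theorem Profile.tsum_visits_ne_top {σ : G.Profile v₀} (hσ : σ.Stationary) (hF : σ.HasSupport F)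
    (hsub : F ⊆ G.effEdges) {u : V} (hp : PathIn F A {t | G.Terminal t} u)
    (hu : ¬ G.Terminal u) : ∑' n, σ.law {ω | ω n = u} ≠ ⊤ := by
  induction hp with
  | base _ ht => exact absurd ht hu
  | @step u v _ huv hp ih =>
    by_cases hx : ∃ m ω', σ.Possible ω' ∧ ω' m = u
    · obtain ⟨m, ω', hω', hm⟩ := hx
      have hpos : σ.next m (Preorder.frestrictLe m ω') v ≠ 0 :=
        Profile.next_ne_zero hF hsub (fun _ _ => rfl) huv hω' hm
      have hle : ∀ n, σ.next m (Preorder.frestrictLe m ω') v * σ.law {ω | ω n = u} ≤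
        σ.law {ω | ω n = u ∧ ω (n + 1) = v} := fun n =>
          (Profile.law_step_vertex hσ v hu hω' hm n).ge
      have hfin : ∑' n, σ.law {ω | ω n = u ∧ ω (n + 1) = v} ≠ ⊤ := by
        by_cases hv : G.Terminal v
        · -- the play enters `v` at most once
          have hd : Pairwise (Function.onFun (AEDisjoint σ.law)
              fun n => {ω : ℕ → V | ω n = u ∧ ω (n + 1) = v}) := by
            have hd' : ∀ n k, n < k → AEDisjoint σ.law {ω : ℕ → V | ω n = u ∧ ω (n + 1) = v}
                {ω : ℕ → V | ω k = u ∧ ω (k + 1) = v} := by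
              intro n k hnk
              refine measure_mono_null ?_ σ.ae_possible
              rintro ω ⟨⟨h1, h2⟩, h3, h4⟩ hω
              refine hu ?_
              rw [← h3, hω.terminal_of_le (n := n + 1) hnk (h2 ▸ hv), h2]
              exact hv
            intro n k hnk
            rcases lt_or_gt_of_ne hnk with h | h
            · exact hd' n k h
            · exact (hd' k n h).symm
          refine ne_top_of_le_ne_top (measure_ne_top σ.law Set.univ)
            (tsum_measure_le_measure_univ (fun n => ?_) hd)
          refine MeasurableSet.nullMeasurableSet ?_
          exact (measurableSet_eq_fun (measurable_pi_apply n) measurable_const).inter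
            (measurableSet_eq_fun (measurable_pi_apply (n + 1)) measurable_const)
        · refine ne_top_of_le_ne_top (ih hv) ?_
          calc ∑' n, σ.law {ω | ω n = u ∧ ω (n + 1) = v}
              ≤ ∑' n, σ.law {ω | ω (n + 1) = v} :=
                ENNReal.tsum_le_tsum fun n => measure_mono fun ω hω => hω.2
            _ ≤ ∑' n, σ.law {ω | ω n = v} :=
                ENNReal.tsum_comp_le_tsum_of_injective (add_left_injective 1)
                  (fun n => σ.law {ω | ω n = v})
      have hmul := ne_top_of_le_ne_top hfin (ENNReal.tsum_le_tsum hle)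
      rw [ENNReal.tsum_mul_left] at hmul
      intro hc
      rw [hc, ENNReal.mul_top hpos] at hmul
      exact hmul rfl
    · have : ∀ n, σ.law {ω | ω n = u} = 0 := fun n =>
        measure_mono_null (fun ω hω hc => hx ⟨n, ω, hc, hω⟩) σ.ae_possible
      simp [this]

end Game

/-! ### Equilibria from final states of the elimination -/

namespace Game

variable {V I : Type*} {G : Game V I} {v₀ : V}

variable {A : Set V} {F : Set (V × V)} {st : Prop} {P : Set I} {σ : G.Profile v₀}

/-- The plays under a profile with support `F` stay among the live vertices. -/
theorem Inv.mem_of_possible (h : G.Inv v₀ P A F st) (hF : σ.HasSupport F) {ω : ℕ → V}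
    (hω : σ.Possible ω) (n : ℕ) : ω n ∈ A := by
  refine hω.mem_of_closed h.init_mem (fun n hn ht => h.closed _ hn _ ?_) n
  rcases ho : G.owner (ω n) with _ | j
  · exact h.full _ (by simp [ho]) _ (hω.effEdge ht)
  · exact hω.support hF ht ho

section Finite

variable [Finite V] [MeasurableSpace V] [DiscreteMeasurableSpace V]

/-- After an elimination, the plays almost surely reach a terminal vertex. -/
theorem Inv.ae_terminal (h : G.Inv v₀ P A F True) (hσ : σ.Stationary) (hF : σ.HasSupport F) :
    ∀ᵐ ω ∂σ.law, ∃ n, ω n ∈ A ∧ G.Terminal (ω n) := by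
  have hfin : ∀ u, ∀ᵐ ω ∂σ.law, u ∈ A → ¬ G.Terminal u → ∀ᶠ n in Filter.atTop, ω n ≠ u := by
    intro u
    by_cases hu : u ∈ A ∧ ¬ G.Terminal u
    · filter_upwards [ae_eventually_notMem
        (Profile.tsum_visits_ne_top hσ hF h.sub (h.term trivial u hu.1) hu.2)] with ω hω _ _
      exact hω
    · exact .of_forall fun ω h1 h2 => absurd ⟨h1, h2⟩ hu
  filter_upwards [ae_all_iff.2 hfin, σ.ae_possible] with ω h1 hω
  have hA := h.mem_of_possible hF hω
  by_contra! hc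
  have h2 : ∀ᶠ n in Filter.atTop, ∀ u, ω n ≠ u := by
    rw [Filter.eventually_all]
    intro u
    by_cases hu : u ∈ A ∧ ¬ G.Terminal u
    · exact h1 u hu.1 hu.2
    · exact .of_forall fun n hn => hu (hn ▸ ⟨hA n, hc n (hA n)⟩)
  obtain ⟨n, hn⟩ := h2.exists
  exact hn _ rfl

/-- No pessimist profits from a deviation in a final state: to do better, the pessimist would have
to win almost surely. -/
theorem Inv.essInf_le (hG : G.NonnegRewards) (h : G.Inv v₀ P A F st) (hσ : σ.Stationary)
    (hF : σ.HasSupport F) {i : I} (hi : i ∈ P) (hfin : ∀ S, G.Win i A F st S → v₀ ∉ S)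
    (τ : G.Strategy v₀ i) :
    essInf (G.reward i) (σ.deviate i τ).law ≤ essInf (G.reward i) σ.law := by
  by_contra! hlt
  have hae := ae_lt_of_lt_essInf hlt (reward_bdd_ge hG i)
  have h0 : 0 ≤ essInf (G.reward i) σ.law :=
    le_essInf_reward (.of_forall fun ω => reward_nonneg hG i ω)
  refine h.not_isDevSet hi hfin _ (Profile.isDevSet_visited (τ := τ) hF h.sub
    (fun u hu v he => h.full u (by simp [hu]) v he) ?_)
  -- the plays under `σ` guarantee the payoff of a worst terminal vertex of `A`
  have hworst : st → ∃ s ∈ A, G.Terminal s ∧ G.payoff s i ≤ essInf (G.reward i) σ.law := by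
    intro hst
    have hst' : st = True := eq_true hst
    subst hst'
    have hterm := h.ae_terminal hσ hF
    obtain ⟨ω, n, hn⟩ := hterm.exists
    obtain ⟨s, hs, hmin⟩ := Set.exists_min_image {t | t ∈ A ∧ G.Terminal t}
      (fun t => G.payoff t i) (Set.toFinite _) ⟨_, hn⟩
    refine ⟨s, hs.1, hs.2, le_essInf_reward ?_⟩
    filter_upwards [hterm, σ.ae_possible] with ω hn hω
    obtain ⟨n, hn⟩ := hn
    rw [reward_of_terminal (fun n k => hω.terminal_of_le) hn.2]
    exact hmin _ hn
  filter_upwards [hae, Profile.ae_possible _] with ω hω hp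
  have hx : ∃ n, G.Terminal (ω n) := by
    by_contra! hc
    rw [reward_eq_zero hc] at hω
    exact absurd hω (not_lt.2 h0)
  obtain ⟨n, hn⟩ := hx
  refine ⟨n, hn, fun hst => ?_⟩
  obtain ⟨s, hs, hts, hle⟩ := hworst hst
  refine ⟨s, hs, hts, hle.trans_lt ?_⟩
  rwa [reward_of_terminal (fun n k => hp.terminal_of_le) hn] at hω

/-- No optimist profits from a deviation: all the edges of the optimists are used with positive
probability, so that every vertex that is visited after the deviation is visited already without
it. -/
theorem Inv.essSup_le (hG : G.NonnegRewards) (h : G.Inv v₀ P A F st)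
    (hF : σ.HasSupport F) {i : I} (hi : i ∉ P) (τ : G.Strategy v₀ i) :
    essSup (G.reward i) (σ.deviate i τ).law ≤ essSup (G.reward i) σ.law := by
  have hle : ∀ᵐ ω ∂σ.law, G.reward i ω ≤ essSup (G.reward i) σ.law :=
    ae_le_essSup (reward_bdd_le i)
  refine essSup_reward_le hG ?_
  filter_upwards [Profile.ae_possible (σ.deviate i τ)] with ω hω
  by_cases hx : ∃ n, G.Terminal (ω n)
  · obtain ⟨n, hn⟩ := hx
    rw [reward_of_terminal (fun n k => hω.terminal_of_le) hn]
    have hvis : ω n ∈ σ.visited := by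
      refine hω.mem_of_closed (Profile.init_visited σ) (fun n hn ht => ?_) n
      have hFe : (ω n, ω (n + 1)) ∈ F := by
        rcases ho : G.owner (ω n) with _ | j
        · exact h.full _ (by simp [ho]) _ (hω.effEdge ht)
        · by_cases hj : j = i
          · exact h.full _ (fun k hk => by
              rw [ho, Option.some_inj] at hk; rw [← hk, hj]; exact hi) _ (hω.effEdge ht)
          · exact hω.support_deviate hF ht hj ho
      exact Profile.visited_step σ hn fun m ω' hω' hm =>
        Profile.next_ne_zero hF h.sub (fun _ _ => rfl) hFe hω' hm
    obtain ⟨m, hm⟩ := hvis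
    obtain ⟨ω', he, hω', hr⟩ := Profile.exists_of_visited σ (σ.ae_possible.and hle) hm
    rw [← he]
    rwa [reward_of_terminal (fun n k => hω'.terminal_of_le) (he ▸ hn : G.Terminal (ω' m))] at hr
  · rw [reward_eq_zero (not_exists.1 hx)]
    obtain ⟨ω', hr⟩ := hle.exists
    exact (reward_nonneg hG i ω').trans hr

/-- A final state of the elimination process represents a stationary equilibrium. -/
theorem Inv.representsXRSE (hG : G.NonnegRewards) (h : G.Inv v₀ P A F st)
    (hfin : ∀ i ∈ P, ∀ S, G.Win i A F st S → v₀ ∉ S) : G.RepresentsXRSE v₀ P F := by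
  refine ⟨fun e he => (h.sub he).1, fun u i _ hu => h.total u hu, fun σ hσ hF i τ => not_lt.2 ?_⟩
  unfold Profile.extremeRisk
  split_ifs with hi
  · exact h.essInf_le hG hσ hF hi (hfin i hi) τ
  · exact h.essSup_le hG hF hi τ

end Finite

theorem exists_effEdge (u : V) (hu : ¬ G.Terminal u) : ∃ v, (u, v) ∈ G.effEdges := by
  obtain ⟨v, hv⟩ := not_forall_not.1 hu
  rcases ho : G.owner u with _ | i
  · obtain ⟨w, hw⟩ := (G.prob u).support_nonempty
    rw [PMF.mem_support_iff] at hw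
    exact ⟨w, G.prob_edge u ho ⟨v, hv⟩ w hw, fun _ => hw⟩
  · exact ⟨v, hv, fun hc => by simp [ho] at hc⟩

/-- Every set of edges that leaves a choice to all players is the support of a stationary
profile. -/
theorem exists_stationary [Finite V] (hFE : F ⊆ ↑G.edges)
    (hF : ∀ u, ¬ G.Terminal u → ∃ v, (u, v) ∈ F) :
    ∃ σ : G.Profile v₀, σ.Stationary ∧ σ.HasSupport F := by
  classical
  have hx : ∀ u, ∃ p : PMF V, ¬ G.Terminal u → ∀ v, p v ≠ 0 ↔ (u, v) ∈ F := by
    intro u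
    by_cases hu : G.Terminal u
    · exact ⟨PMF.pure u, fun hc => absurd hu hc⟩
    · obtain ⟨w, hw⟩ := hF u hu
      have hne : (Set.toFinite {v | (u, v) ∈ F}).toFinset.Nonempty := ⟨w, by simpa using hw⟩
      refine ⟨PMF.uniformOfFinset _ hne, fun _ v => ?_⟩
      rw [← PMF.mem_support_iff, PMF.mem_support_uniformOfFinset_iff]
      simp
  choose p hp using hx
  refine ⟨fun i => ⟨fun n h => p h.last, fun n h hh v hv => hFE ((hp _ hh.2.2 v).1 hv)⟩, ?_, ?_⟩
  · exact fun i n n' h h' _ _ he => by simp only [he]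
  · exact fun i n h hh v => hp _ hh.2.2 v

theorem exists_stationary_isXRSE [Finite V] [MeasurableSpace V] [DiscreteMeasurableSpace V]
    (G : Game V I) (v₀ : V) (P : Set I) (hG : G.NonnegRewards) :
    ∃ σ : G.Profile v₀, σ.Stationary ∧ σ.IsXRSE P := by
  have h0 : G.Inv v₀ P Set.univ G.effEdges False :=
    Inv.start exists_effEdge trivial (fun _ _ _ _ => trivial) False.elim
  obtain ⟨A, F, st, h, hfin⟩ := h0.exists_final
  obtain ⟨σ, hσ, hF⟩ := exists_stationary (v₀ := v₀) (fun e he => (h.sub he).1) h.total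
  exact ⟨σ, hσ, (h.representsXRSE hG hfin).2.2 σ hσ hF⟩

end Game

/-! ### Reasoning about programs -/

namespace Prog

open Classical in
/-- The effect of a program without loops (loops are ignored). -/
noncomputable def exec : Prog → State → State
  | .skip, s => s
  | .set x e, s => { s with reg := Function.update s.reg x (e.eval s) }
  | .put a k e, s =>
      { s with arr := Function.update s.arr a (Function.update (s.arr a) (k.eval s) (e.eval s)) }
  | .rset r e, s => { s with rreg := Function.update s.rreg r (e.eval s) }
  | .seq c d, s => d.exec (c.exec s)
  | .ite b c d, s => if b.Holds s then c.exec s else d.exec s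
  | .loop _ _, s => s

/-- The program has no loops. -/
def simple : Prog → Bool
  | .seq c d => c.simple && d.simple
  | .ite _ c d => c.simple && d.simple
  | .loop _ _ => false
  | _ => true

/-- A bound for the running time of a program without loops. -/
def cost : Prog → ℕ
  | .seq c d => c.cost + d.cost
  | .ite _ c d => c.cost + d.cost + 1
  | _ => 1

/-- The registers that a program may change. -/
def wreg : Prog → List ℕ
  | .set x _ => [x]
  | .seq c d => c.wreg ++ d.wreg
  | .ite _ c d => c.wreg ++ d.wreg
  | .loop _ c => c.wreg
  | _ => []

/-- The arrays that a program may change. -/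
def warr : Prog → List ℕ
  | .put a _ _ => [a]
  | .seq c d => c.warr ++ d.warr
  | .ite _ c d => c.warr ++ d.warr
  | .loop _ c => c.warr
  | _ => []

theorem runs_exec (c : Prog) (hc : c.simple) (s : State) :
    ∃ t ≤ c.cost, Runs c s (c.exec s) t := by
  induction c generalizing s with
  | skip => exact ⟨1, le_rfl, .skip s⟩
  | set x e => exact ⟨1, le_rfl, .set x e s⟩
  | put a k e => exact ⟨1, le_rfl, .put a k e s⟩
  | rset r e => exact ⟨1, le_rfl, .rset r e s⟩
  | seq c d ihc ihd =>
    simp only [simple, Bool.and_eq_true] at hc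
    obtain ⟨t, ht, h⟩ := ihc hc.1 s
    obtain ⟨t', ht', h'⟩ := ihd hc.2 (c.exec s)
    exact ⟨t + t', Nat.add_le_add ht ht', .seq h h'⟩
  | ite b c d ihc ihd =>
    simp only [simple, Bool.and_eq_true] at hc
    by_cases hb : b.Holds s
    · obtain ⟨t, ht, h⟩ := ihc hc.1 s
      refine ⟨t + 1, by simp only [cost]; omega, ?_⟩
      rw [exec, if_pos hb]
      exact .ite_true hb h
    · obtain ⟨t, ht, h⟩ := ihd hc.2 s
      refine ⟨t + 1, by simp only [cost]; omega, ?_⟩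
      rw [exec, if_neg hb]
      exact .ite_false hb h
  | loop b c => simp [simple] at hc

end Prog

/-- `s'` agrees with `s` where the program `c` cannot change anything. -/
structure Frame (c : Prog) (s s' : State) : Prop where
  reg : ∀ x, x ∉ c.wreg → s'.reg x = s.reg x
  arr : ∀ a, a ∉ c.warr → s'.arr a = s.arr a
  table : s'.table = s.table

theorem Frame.refl (c : Prog) (s : State) : Frame c s s :=
  ⟨fun _ _ => rfl, fun _ _ => rfl, rfl⟩

theorem Frame.comp {c d e : Prog} {s s' s'' : State} (h : Frame c s s') (h' : Frame d s' s'')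
    (hr : c.wreg ++ d.wreg ⊆ e.wreg) (ha : c.warr ++ d.warr ⊆ e.warr) : Frame e s s'' := by
  rw [List.append_subset] at hr ha
  refine ⟨fun x hx => ?_, fun a hx => ?_, h'.table.trans h.table⟩
  · rw [h'.reg x fun hc => hx (hr.2 hc), h.reg x fun hc => hx (hr.1 hc)]
  · rw [h'.arr a fun hc => hx (ha.2 hc), h.arr a fun hc => hx (ha.1 hc)]

theorem Frame.mono {c e : Prog} {s s' : State} (h : Frame c s s')
    (hr : c.wreg ⊆ e.wreg) (ha : c.warr ⊆ e.warr) : Frame e s s' :=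
  ⟨fun x hx => h.reg x fun hc => hx (hr hc), fun a hx => h.arr a fun hc => hx (ha hc), h.table⟩

theorem Runs.frame {c : Prog} {s s' : State} {t : ℕ} (h : Runs c s s' t) : Frame c s s' := by
  induction h with
  | skip s => exact .refl _ _
  | set x e s =>
    refine ⟨fun y hy => Function.update_of_ne ?_ _ _, fun _ _ => rfl, rfl⟩
    simpa [Prog.wreg] using hy
  | put a k e s =>
    refine ⟨fun _ _ => rfl, fun b hb => Function.update_of_ne ?_ _ _, rfl⟩
    simpa [Prog.warr] using hb
  | rset r e s => exact ⟨fun _ _ => rfl, fun _ _ => rfl, rfl⟩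
  | seq _ _ ih ih' => exact ih.comp ih' (by simp [Prog.wreg]) (by simp [Prog.warr])
  | ite_true _ _ ih => exact ih.mono (by simp [Prog.wreg]) (by simp [Prog.warr])
  | ite_false _ _ ih => exact ih.mono (by simp [Prog.wreg]) (by simp [Prog.warr])
  | loop_true _ _ _ ih ih' => exact ih.comp ih' (by simp [Prog.wreg]) (by simp [Prog.warr])
  | loop_false _ => exact .refl _ _

/-- The program `c`, started in `s`, halts within `T` units of time in a state that satisfies
`Q`. -/
def Does (c : Prog) (T : ℕ) (s : State) (Q : State → Prop) : Prop :=
  ∃ s' t, Runs c s s' t ∧ t ≤ T ∧ Q s'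

namespace Does

variable {c d : Prog} {s : State} {T T' : ℕ} {Q R : State → Prop}

theorem simple (c : Prog) (hc : c.simple) (h : Q (c.exec s)) : Does c c.cost s Q := by
  obtain ⟨t, ht, hr⟩ := c.runs_exec hc s
  exact ⟨_, t, hr, ht, h⟩

/-- Consequence, with the knowledge of what the program leaves alone. -/
theorem mono (h : Does c T s R) (hT : T ≤ T') (hQ : ∀ s', Frame c s s' → R s' → Q s') :
    Does c T' s Q := by
  obtain ⟨s', t, hr, ht, hs'⟩ := h
  exact ⟨s', t, hr, ht.trans hT, hQ s' hr.frame hs'⟩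

theorem seq (h : Does c T s R) (h' : ∀ s', Frame c s s' → R s' → Does d T' s' Q) :
    Does (.seq c d) (T + T') s Q := by
  obtain ⟨s', t, hr, ht, hs'⟩ := h
  obtain ⟨s'', t', hr', ht', hs''⟩ := h' s' hr.frame hs'
  exact ⟨s'', t + t', .seq hr hr', by omega, hs''⟩

theorem ite {b : Test} (h : b.Holds s → Does c T s Q) (h' : ¬ b.Holds s → Does d T s Q) :
    Does (.ite b c d) (T + 1) s Q := by
  by_cases hb : b.Holds s
  · obtain ⟨s', t, hr, ht, hs'⟩ := h hb
    exact ⟨s', t + 1, .ite_true hb hr, by omega, hs'⟩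
  · obtain ⟨s', t, hr, ht, hs'⟩ := h' hb
    exact ⟨s', t + 1, .ite_false hb hr, by omega, hs'⟩

/-- The rule for loops: `J φ s` says that `s` satisfies the invariant and has potential `φ`, and
the potential pays for the running time. -/
theorem loop {b : Test} (J : ℕ → State → Prop)
    (step : ∀ φ s', Frame (.loop b c) s s' → J φ s' → b.Holds s' → ∃ T, Does c T s' fun s'' =>
      ∃ φ', J φ' s'' ∧ T + 1 + φ' ≤ φ) {φ : ℕ} (h : J φ s) :
    Does (.loop b c) (φ + 1) s fun s' => (∃ φ', J φ' s') ∧ ¬ b.Holds s' := by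
  have key : ∀ φ s', Frame (.loop b c) s s' → J φ s' →
      Does (.loop b c) (φ + 1) s' fun s' => (∃ φ', J φ' s') ∧ ¬ b.Holds s' := by
    intro φ
    induction φ using Nat.strong_induction_on with
    | _ φ ih =>
      intro s' hf hs'
      by_cases hb : b.Holds s'
      · obtain ⟨T, s'', t, hr, ht, φ', hJ, hφ⟩ := step φ s' hf hs' hb
        obtain ⟨s₃, t', hr', ht', h₃⟩ := ih φ' (by omega) s''
          (hf.comp hr.frame (by simp [Prog.wreg]) (by simp [Prog.warr])) hJ
        exact ⟨s₃, t + t' + 1, .loop_true hb hr hr', by omega, h₃⟩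
      · exact ⟨s', 1, .loop_false hb, by omega, ⟨φ, hs'⟩, hb⟩
  exact key φ s (.refl _ _) h

end Does

/-- Advance the edge counter (register `5`). -/
abbrev nextEdge : Prog := .set 5 (.add (.reg 5) (.lit 1))

/-- A loop over all the edges, with the edge counter in register `5`. -/
def Prog.forEdges (c : Prog) : Prog :=
  .seq (.set 5 (.lit 0)) (.loop (.not (.le (.reg 2) (.reg 5))) (.seq c nextEdge))

/-- The rule for loops over the edges: `J e` is the invariant after `e` edges. It does not see the
edge counter that `nextEdge` advances. -/
theorem Does.forEdges {c : Prog} {s : State} {m : ℕ} (hm : s.reg 2 = m) (hc : c.simple)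
    (h2 : 2 ∉ c.wreg) (h5 : 5 ∉ c.wreg) (J : ℕ → State → Prop)
    (h0 : J 0 { s with reg := Function.update s.reg 5 0 })
    (step : ∀ e s', e < m → Frame c.forEdges s s' → s'.reg 5 = e → J e s' →
      ∀ s'', s''.arr = (c.exec s').arr → (∀ x ≠ 5, s''.reg x = (c.exec s').reg x) →
        s''.table = s'.table → J (e + 1) s'') :
    Does c.forEdges ((c.cost + 2) * m + 2) s (J m) := by
  have hwr : (Prog.set 5 (.lit 0)).wreg ++
      (Prog.loop (.not (.le (.reg 2) (.reg 5))) (.seq c nextEdge)).wreg ⊆ c.forEdges.wreg := by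
    simp [Prog.forEdges, Prog.wreg]
  have hwa : (Prog.set 5 (.lit 0)).warr ++
      (Prog.loop (.not (.le (.reg 2) (.reg 5))) (.seq c nextEdge)).warr ⊆ c.forEdges.warr := by
    simp [Prog.forEdges, Prog.warr]
  have hsimp : (Prog.seq c nextEdge).simple := by simp [Prog.simple, hc]
  have h1 : Does (.set 5 (.lit 0)) 1 s
      (fun s' => s' = { s with reg := Function.update s.reg 5 0 }) :=
    Does.simple (.set 5 (.lit 0)) rfl rfl
  refine (h1.seq (T' := (c.cost + 2) * m + 1) (Q := J m) ?_).mono (by omega) fun _ _ h => h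
  rintro s₁ hf₁ rfl
  refine (Does.loop (fun φ s' => ∃ e ≤ m, s'.reg 5 = e ∧ s'.reg 2 = m ∧ J e s' ∧
    φ = (c.cost + 2) * (m - e)) ?_ ⟨0, Nat.zero_le m, by simp, by simpa using hm, h0,
      rfl⟩).mono le_rfl ?_
  · rintro φ s' hf ⟨e, hem, h5', h2', hJ, rfl⟩ hb
    have hlt : e < m := by
      simpa [Test.Holds, Expr.eval, h5', h2'] using hb
    refine ⟨_, Does.simple _ hsimp ⟨_, ⟨e + 1, hlt, ?_, ?_, ?_, rfl⟩, ?_⟩⟩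
    · obtain ⟨t, -, hr⟩ := c.runs_exec hc s'
      simp [Prog.exec, Expr.eval, hr.frame.reg 5 h5, h5']
    · obtain ⟨t, -, hr⟩ := c.runs_exec hc s'
      simp [Prog.exec, hr.frame.reg 2 h2, h2']
    · obtain ⟨t, -, hr⟩ := c.runs_exec hc s'
      exact step e s' hlt (hf₁.comp hf hwr hwa) h5' hJ _ rfl
        (fun x hx => Function.update_of_ne hx _ _) hr.frame.table
    · obtain ⟨k, rfl⟩ := Nat.exists_eq_add_of_lt hlt
      have h1 : e + k + 1 - (e + 1) = k := by omega
      have h2 : e + k + 1 - e = k + 1 := by omega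
      rw [h1, h2]
      simp only [Prog.cost]
      ring_nf
      omega
  · rintro s' - ⟨⟨φ, e, hem, h5', h2', hJ, -⟩, hb⟩
    have : m ≤ e := by simpa [Test.Holds, Expr.eval, h5', h2'] using hb
    rwa [le_antisymm this hem]

/-! ### Data representation -/

/-- The test `e = 0`. -/
abbrev Test.isZero (e : Expr) : Test := .le e (.lit 0)

/-- The test `e ≠ 0`. -/
abbrev Test.nonzero (e : Expr) : Test := .not (.le e (.lit 0))

/-- The source of the current edge. -/
abbrev srcE : Expr := .get 0 (.reg 5)

/-- The target of the current edge. -/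
abbrev tgtE : Expr := .get 1 (.reg 5)

section Rep

variable {n q : ℕ} (G : Game (Fin n) (Fin q)) (v₀ : Fin n) (el : List (Fin n × Fin n))
  (pl : List (Fin q))

/-- The edge number `k`, with a junk value if there are fewer edges. -/
def edgeAt (k : ℕ) : Fin n × Fin n := el.getD k (v₀, v₀)

/-- The endpoints of the edges. -/
def ends : Set (Fin n) := {v | ∃ k < el.length, (edgeAt v₀ el k).1 = v ∨ (edgeAt v₀ el k).2 = v}

/-- One plus the number of the last edge before number `k` that ends in `v`, and `0` if there is
none. -/
def prevOcc (v : Fin n) : ℕ → ℕ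
  | 0 => 0
  | k + 1 => if (edgeAt v₀ el k).2 = v then k + 1 else prevOcc v k

theorem prevOcc_le (v : Fin n) (k : ℕ) : prevOcc v₀ el v k ≤ k := by
  induction k with
  | zero => exact le_rfl
  | succ k ih => rw [prevOcc]; split_ifs <;> omega

theorem prevOcc_tgt (v : Fin n) (k : ℕ) (h : prevOcc v₀ el v k ≠ 0) :
    (edgeAt v₀ el (prevOcc v₀ el v k - 1)).2 = v := by
  induction k with
  | zero => exact absurd rfl h
  | succ k ih =>
    rw [prevOcc] at h ⊢
    split_ifs with hk
    · simpa using hk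
    · rw [if_neg hk] at h; exact ih h

theorem lt_prevOcc (v : Fin n) {k l : ℕ} (hl : l < k) (h : (edgeAt v₀ el l).2 = v) :
    l < prevOcc v₀ el v k := by
  induction k with
  | zero => omega
  | succ k ih =>
    rw [prevOcc]
    split_ifs with hk
    · exact hl
    · exact ih (lt_of_le_of_ne (Nat.lt_succ_iff.1 hl) fun hc => hk (hc ▸ h))

/-- The read-only part of the input. -/
structure Input (s : State) : Prop where
  size : s.reg 0 = n
  len : s.reg 2 = el.length
  plen : s.reg 3 = pl.length
  init : s.reg 4 = v₀
  src : ∀ k < el.length, s.arr 0 k = (edgeAt v₀ el k).1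
  tgt : ∀ k < el.length, s.arr 1 k = (edgeAt v₀ el k).2
  owner : ∀ u : Fin n, s.arr 2 u = (G.owner u).elim 0 fun i => (i : ℕ) + 1
  pess : ∀ (j : ℕ) (hj : j < pl.length), s.arr 3 j = pl[j]
  payoff : ∀ (v : Fin n) (i : Fin q), s.table 0 v i = G.payoff v i
  prob : ∀ k < el.length,
    s.table 1 k 0 = (G.prob (edgeAt v₀ el k).1 (edgeAt v₀ el k).2).toReal

/-- The input and the tables that are computed once: array `6` marks the vertices that are not
terminal, and arrays `7` and `8` hold, for each vertex, a linked list of the edges that end in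
it. -/
structure Static (s : State) : Prop extends Input G v₀ el pl s where
  nonterm : ∀ v : Fin n, s.arr 6 v ≠ 0 ↔ ¬ G.Terminal v
  head : ∀ v : Fin n, s.arr 7 v = prevOcc v₀ el v el.length
  next : ∀ k < el.length, s.arr 8 k = prevOcc v₀ el (edgeAt v₀ el k).2 k

variable {G v₀ el pl}

theorem Input.of_eq {s s' : State} (h : Input G v₀ el pl s)
    (hr : ∀ x ∈ [0, 2, 3, 4], s'.reg x = s.reg x)
    (ha : ∀ a ∈ [0, 1, 2, 3], s'.arr a = s.arr a) (ht : s'.table = s.table) :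
    Input G v₀ el pl s' := by
  obtain ⟨h1, h2, h3, h4, h5, h6, h7, h8, h9, h10⟩ := h
  refine ⟨?_, ?_, ?_, ?_, ?_, ?_, ?_, ?_, ?_, ?_⟩
  · rwa [hr 0 (by simp)]
  · rwa [hr 2 (by simp)]
  · rwa [hr 3 (by simp)]
  · rwa [hr 4 (by simp)]
  · rwa [ha 0 (by simp)]
  · rwa [ha 1 (by simp)]
  · rwa [ha 2 (by simp)]
  · rwa [ha 3 (by simp)]
  · rwa [ht]
  · rwa [ht]

theorem Input.of_frame {c : Prog} {s s' : State} (h : Input G v₀ el pl s) (hf : Frame c s s')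
    (hr : ∀ x ∈ [0, 2, 3, 4], x ∉ c.wreg) (ha : ∀ a ∈ [0, 1, 2, 3], a ∉ c.warr) :
    Input G v₀ el pl s' :=
  h.of_eq (fun x hx => hf.reg x (hr x hx)) (fun a hx => hf.arr a (ha a hx)) hf.table

theorem Static.of_frame {c : Prog} {s s' : State} (h : Static G v₀ el pl s) (hf : Frame c s s')
    (hr : ∀ x ∈ [0, 2, 3, 4], x ∉ c.wreg)
    (ha : ∀ a ∈ [0, 1, 2, 3, 6, 7, 8], a ∉ c.warr) : Static G v₀ el pl s' := by
  refine ⟨h.toInput.of_frame hf hr fun a hx => ha a ?_, ?_, ?_, ?_⟩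
  · simp only [List.mem_cons, List.not_mem_nil, or_false] at hx ⊢; omega
  · rw [hf.arr 6 (ha 6 (by simp))]; exact h.nonterm
  · rw [hf.arr 7 (ha 7 (by simp))]; exact h.head
  · rw [hf.arr 8 (ha 8 (by simp))]; exact h.next

theorem Input.owner_eq {s : State} (h : Input G v₀ el pl s) (u : Fin n) (i : Fin q) :
    s.arr 2 u = (i : ℕ) + 1 ↔ G.owner u = some i := by
  rw [h.owner]
  rcases G.owner u with _ | j
  · simp
  · simp [Fin.ext_iff]

theorem edgeAt_mem {k : ℕ} (hk : k < el.length) : edgeAt v₀ el k ∈ el := by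
  rw [edgeAt, List.getD_eq_getElem _ _ hk]
  exact List.getElem_mem hk

theorem exists_edgeAt {e : Fin n × Fin n} (he : e ∈ el) :
    ∃ k < el.length, edgeAt v₀ el k = e := by
  obtain ⟨k, hk, h⟩ := List.getElem_of_mem he
  exact ⟨k, hk, by rw [edgeAt, List.getD_eq_getElem _ _ hk, h]⟩

theorem src_mem_ends {k : ℕ} (hk : k < el.length) : (edgeAt v₀ el k).1 ∈ ends v₀ el :=
  ⟨k, hk, .inl rfl⟩

theorem tgt_mem_ends {k : ℕ} (hk : k < el.length) : (edgeAt v₀ el k).2 ∈ ends v₀ el :=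
  ⟨k, hk, .inr rfl⟩

/-- The array `a` is the characteristic function of the set `S` of vertices. -/
def Rep (a : ℕ → ℕ) (S : Set (Fin n)) : Prop := ∀ v : Fin n, a v ≠ 0 ↔ v ∈ S

variable (v₀ el) in
/-- The array `a` is the characteristic function of the set `F` of edges. -/
def RepEdges (a : ℕ → ℕ) (F : Set (Fin n × Fin n)) : Prop :=
  ∀ k < el.length, a k ≠ 0 ↔ edgeAt v₀ el k ∈ F

theorem length_le_of_ends {L : List (Fin n)} (hL : L.Nodup) (h : ∀ v ∈ L, v ∈ ends v₀ el) :
    L.length ≤ 2 * el.length := by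
  have hsub : L ⊆ el.map Prod.fst ++ el.map Prod.snd := by
    intro v hv
    obtain ⟨k, hk, h | h⟩ := h v hv
    · exact List.mem_append_left _ (List.mem_map.2 ⟨_, edgeAt_mem hk, h⟩)
    · exact List.mem_append_right _ (List.mem_map.2 ⟨_, edgeAt_mem hk, h⟩)
  have := (hL.subperm hsub).length_le
  simp only [List.length_append, List.length_map] at this
  omega

theorem ncard_ends_le : (ends v₀ el).ncard ≤ 2 * el.length := by
  classical
  have := length_le_of_ends (v₀ := v₀) (el := el) (L := (Set.toFinite (ends v₀ el)).toFinset.toList)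
    (Finset.nodup_toList _) (by simp)
  rwa [Finset.length_toList, ← Set.ncard_eq_toFinset_card] at this

/-! ### One step of the fixed-point iteration -/

/-- The body of the loop that finds a worst live terminal vertex. -/
def worstBody : Prog :=
  .ite (.and (.isZero (.get 6 tgtE)) (.and (.nonzero (.get 5 tgtE))
      (.not (.and (.nonzero (.reg 11))
        (.not (.rle (.get 0 tgtE (.reg 10)) (.get 0 (.sub (.reg 11) (.lit 1)) (.reg 10))))))))
    (.set 11 (.add tgtE (.lit 1))) .skip

/-- Register `11` holds one plus a worst live terminal vertex for the current player, or `0`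
if an elimination has not taken place yet. -/
def worstProg : Prog :=
  .seq (.set 11 (.lit 0)) (.ite (.nonzero (.reg 15)) worstBody.forEdges .skip)

/-- The body of the loop that clears arrays `10` and `11`. -/
def clearBody : Prog :=
  .seq (.put 10 srcE (.lit 0)) (.seq (.put 10 tgtE (.lit 0)) (.put 11 srcE (.lit 0)))

/-- The body of the loop that marks in array `11` the vertices from which the others can leave the
current row of array `9`. -/
def taintBody : Prog :=
  .ite (.and (.nonzero (.get 4 (.reg 5))) (.and (.isZero (.get 9 (.add (.reg 9) tgtE)))
      (.not (.and (.le (.get 2 srcE) (.add (.reg 10) (.lit 1)))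
        (.le (.add (.reg 10) (.lit 1)) (.get 2 srcE))))))
    (.put 11 srcE (.lit 1)) .skip

/-- The body of the loop that puts the good terminal vertices of the current row into the queue
(array `12`, with length in register `12`). -/
def seedBody : Prog :=
  .ite (.and (.and (.isZero (.get 6 tgtE)) (.isZero (.get 10 tgtE)))
      (.and (.nonzero (.get 9 (.add (.reg 9) tgtE)))
      (.not (.and (.nonzero (.reg 11))
        (.rle (.get 0 tgtE (.reg 10)) (.get 0 (.sub (.reg 11) (.lit 1)) (.reg 10)))))))
    (.seq (.put 10 tgtE (.lit 1)) (.seq (.put 12 (.reg 12) tgtE)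
      (.set 12 (.add (.reg 12) (.lit 1))))) .skip

variable {F : Set (Fin n × Fin n)} {A X : Set (Fin n)} {st : Prop} {i : Fin q} {s : State}

/-- The comparison with register `11` decides whether a live terminal vertex `v` is good: an
elimination has not taken place yet, or `v` is better for player `i` than a worst live terminal
vertex. -/
theorem does_worst (hs : Static G v₀ el pl s) (hel : ∀ e, e ∈ el ↔ e ∈ G.edges)
    (hi : s.reg 10 = i) (hA : Rep (s.arr 5) A) (hAe : A ⊆ ends v₀ el) (hst : s.reg 15 ≠ 0 ↔ st) :
    Does worstProg (1 + ((worstBody.cost + 2) * el.length + 2 + 1)) s fun s' =>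
      ∀ v ∈ A, G.Terminal v →
        ((s'.reg 11 ≠ 0 → ¬ s'.table 0 v i ≤ s'.table 0 (s'.reg 11 - 1) i) ↔
          (st → ∃ t ∈ A, G.Terminal t ∧ G.payoff t i < G.payoff v i)) := by
  have h1 : Does (.set 11 (.lit 0)) 1 s fun s' => s'.reg 11 = 0 :=
    Does.simple (.set 11 (.lit 0)) rfl (by simp [Prog.exec, Expr.eval])
  refine h1.seq fun s₁ hf₁ h11 => ?_
  have hs₁ := hs.of_frame hf₁ (by decide) (by decide)
  have h15 : s₁.reg 15 ≠ 0 ↔ st := by rw [hf₁.reg 15 (by decide)]; exact hst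
  refine Does.ite ?_ ?_
  · intro hb
    have hst' : st := h15.1 (by simpa [Test.Holds, Expr.eval] using hb)
    refine (Does.forEdges hs₁.len rfl (by decide) (by decide) (fun e s' =>
      (s'.reg 11 = 0 ∧ ∀ k < e, (edgeAt v₀ el k).2 ∈ A → ¬ G.Terminal (edgeAt v₀ el k).2) ∨
      ∃ t : Fin n, s'.reg 11 = t + 1 ∧ t ∈ A ∧ G.Terminal t ∧ ∀ k < e, (edgeAt v₀ el k).2 ∈ A →
        G.Terminal (edgeAt v₀ el k).2 → G.payoff t i ≤ G.payoff (edgeAt v₀ el k).2 i)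
      (.inl ⟨by simpa using h11, by simp⟩) ?_).mono le_rfl ?_
    · intro e s' he hf h5 hJ s'' ha hr ht
      have hs' := hs₁.of_frame hf (by decide) (by decide)
      have h2 := hs'.tgt e he
      have h10 : s'.reg 10 = i := by
        rw [hf.reg 10 (by decide), hf₁.reg 10 (by decide)]; exact hi
      have hA' : s'.arr 5 (edgeAt v₀ el e).2 ≠ 0 ↔ (edgeAt v₀ el e).2 ∈ A := by
        rw [hf.arr 5 (by decide), hf₁.arr 5 (by decide)]; exact hA _
      have hT := hs'.nonterm (edgeAt v₀ el e).2
      have hr11 := hr 11 (by decide)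
      have hskip : ((edgeAt v₀ el e).2 ∈ A → ¬ G.Terminal (edgeAt v₀ el e).2) →
          s''.reg 11 = s'.reg 11 := by
        intro hc
        rw [hr11, worstBody, Prog.exec, if_neg]
        · rfl
        · simp only [Test.Holds, Expr.eval, h5, h2, Nat.le_zero]
          rintro ⟨h6, h7, -⟩
          exact hc (hA'.1 h7) (not_not.1 fun h => hT.2 h h6)
      by_cases hc : (edgeAt v₀ el e).2 ∈ A ∧ G.Terminal (edgeAt v₀ el e).2
      · have h6 : s'.arr 6 (edgeAt v₀ el e).2 = 0 := by
          by_contra h; exact hT.1 h hc.2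
        have hset : (s'.reg 11 ≠ 0 → s'.table 0 (edgeAt v₀ el e).2 i ≤
            s'.table 0 (s'.reg 11 - 1) i) → s''.reg 11 = (edgeAt v₀ el e).2 + 1 := by
          intro hle
          rw [hr11, worstBody, Prog.exec, if_pos]
          · simp [Prog.exec, Expr.eval, h5, h2]
          · simp only [Test.Holds, Expr.eval, RExpr.eval, h5, h2, Nat.le_zero, h10]
            exact ⟨h6, hA'.2 hc.1, fun h => h.2 (hle h.1)⟩
        right
        rcases hJ with ⟨h0, hJ⟩ | ⟨t, h0, htA, htT, hJ⟩
        · refine ⟨_, hset fun h => absurd h0 h, hc.1, hc.2, fun k hk hkA hkT => ?_⟩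
          rcases Nat.lt_succ_iff_lt_or_eq.1 hk with hk' | rfl
          · exact absurd hkT (hJ k hk' hkA)
          · exact le_rfl
        · by_cases hle : G.payoff (edgeAt v₀ el e).2 i ≤ G.payoff t i
          · refine ⟨_, hset fun _ => ?_, hc.1, hc.2, fun k hk hkA hkT => ?_⟩
            · rw [h0, Nat.add_sub_cancel, hs'.payoff, hs'.payoff]; exact hle
            · rcases Nat.lt_succ_iff_lt_or_eq.1 hk with hk' | rfl
              · exact hle.trans (hJ k hk' hkA hkT)
              · exact le_rfl
          · refine ⟨t, ?_, htA, htT, fun k hk hkA hkT => ?_⟩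
            · rw [hr11, worstBody, Prog.exec, if_neg]
              · exact h0
              · simp only [Test.Holds, Expr.eval, RExpr.eval, h5, h2, Nat.le_zero, h10, h0,
                  Nat.add_sub_cancel, hs'.payoff]
                exact fun h => h.2.2 ⟨Nat.succ_ne_zero _, hle⟩
            · rcases Nat.lt_succ_iff_lt_or_eq.1 hk with hk' | rfl
              · exact hJ k hk' hkA hkT
              · exact (not_le.1 hle).le
      · have hc' : (edgeAt v₀ el e).2 ∈ A → ¬ G.Terminal (edgeAt v₀ el e).2 :=
          fun h1 h2 => hc ⟨h1, h2⟩
        rw [hskip hc']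
        refine hJ.imp (fun h => ⟨h.1, fun k hk => ?_⟩)
          (fun ⟨t, h0, htA, htT, h⟩ => ⟨t, h0, htA, htT, fun k hk => ?_⟩)
        · rcases Nat.lt_succ_iff_lt_or_eq.1 hk with hk' | rfl
          · exact h.2 k hk'
          · exact hc'
        · rcases Nat.lt_succ_iff_lt_or_eq.1 hk with hk' | rfl
          · exact h k hk'
          · exact fun h1 h2 => absurd h2 (hc' h1)
    · intro s' hf hJ v hv hvT
      have hs' := hs₁.of_frame hf (by decide) (by decide)
      have hend : ∀ v ∈ A, G.Terminal v → ∃ k < el.length, (edgeAt v₀ el k).2 = v := by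
        intro v hv hvT
        obtain ⟨k, hk, h | h⟩ := hAe hv
        · exact absurd ((hel _).1 (edgeAt_mem (v₀ := v₀) hk)) (by
            have := hvT (edgeAt v₀ el k).2
            rwa [← h] at this)
        · exact ⟨k, hk, h⟩
      rcases hJ with ⟨h0, hJ⟩ | ⟨t, h0, htA, htT, hJ⟩
      · obtain ⟨k, hk, rfl⟩ := hend v hv hvT
        exact absurd hvT (hJ k hk hv)
      · rw [h0, Nat.add_sub_cancel, hs'.payoff, hs'.payoff, not_le]
        constructor
        · exact fun h _ => ⟨t, htA, htT, h (Nat.succ_ne_zero _)⟩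
        · intro h _
          obtain ⟨u, huA, huT, hu⟩ := h hst'
          obtain ⟨k, hk, rfl⟩ := hend u huA huT
          exact (hJ k hk huA huT).trans_lt hu
  · intro hb
    have hst' : ¬ st := fun h => hb (by simpa [Test.Holds, Expr.eval] using h15.2 h)
    refine (Does.simple .skip rfl (Q := fun s' => s'.reg 11 = 0) h11).mono
      (by simp only [Prog.cost]; omega) fun s' _ h0 v _ _ => ?_
    exact ⟨fun _ h => absurd h hst', fun _ h => absurd h0 h⟩

theorem does_clear (hs : Static G v₀ el pl s) :
    Does clearBody.forEdges ((clearBody.cost + 2) * el.length + 2) s fun s' =>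
      ∀ k < el.length, s'.arr 10 (edgeAt v₀ el k).1 = 0 ∧ s'.arr 10 (edgeAt v₀ el k).2 = 0 ∧
        s'.arr 11 (edgeAt v₀ el k).1 = 0 := by
  refine Does.forEdges hs.len rfl (by decide) (by decide) (fun e s' => ∀ k < e,
      s'.arr 10 (edgeAt v₀ el k).1 = 0 ∧ s'.arr 10 (edgeAt v₀ el k).2 = 0 ∧
        s'.arr 11 (edgeAt v₀ el k).1 = 0) (fun k hk => absurd hk (Nat.not_lt_zero k)) ?_
  intro e s' he hf h5 hJ s'' ha hr ht k hk
  have hs' := hs.of_frame hf (by decide) (by decide)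
  have h1 := hs'.src e he
  have h2 := hs'.tgt e he
  have h10 : s''.arr 10 = Function.update (Function.update (s'.arr 10) (edgeAt v₀ el e).1 0)
      (edgeAt v₀ el e).2 0 := by
    simp [ha, clearBody, Prog.exec, Expr.eval, h5, h1, h2]
  have h11 : s''.arr 11 = Function.update (s'.arr 11) (edgeAt v₀ el e).1 0 := by
    simp [ha, clearBody, Prog.exec, Expr.eval, h5, h1, h2]
  rw [h10, h11]
  simp only [Function.update_apply]
  rcases Nat.lt_succ_iff_lt_or_eq.1 hk with hk' | rfl
  · obtain ⟨a, b, c⟩ := hJ k hk'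
    simp [a, b, c]
  · simp

/-- Array `11` marks the sources of the edges by which the other players can leave the row `X`. -/
theorem does_taint (hs : Static G v₀ el pl s) (hi : s.reg 10 = i)
    (hF : RepEdges v₀ el (s.arr 4) F) (hX : Rep (fun v => s.arr 9 (s.reg 9 + v)) X)
    (h0 : ∀ k < el.length, s.arr 11 (edgeAt v₀ el k).1 = 0) :
    Does taintBody.forEdges ((taintBody.cost + 2) * el.length + 2) s fun s' =>
      ∀ k < el.length, s'.arr 11 (edgeAt v₀ el k).1 ≠ 0 ↔
        ∃ l < el.length, (edgeAt v₀ el l).1 = (edgeAt v₀ el k).1 ∧ edgeAt v₀ el l ∈ F ∧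
          (edgeAt v₀ el l).2 ∉ X ∧ G.owner (edgeAt v₀ el l).1 ≠ some i := by
  refine Does.forEdges hs.len rfl (by decide) (by decide) (fun e s' =>
    ∀ k < el.length, s'.arr 11 (edgeAt v₀ el k).1 ≠ 0 ↔
        ∃ l < e, (edgeAt v₀ el l).1 = (edgeAt v₀ el k).1 ∧ edgeAt v₀ el l ∈ F ∧
          (edgeAt v₀ el l).2 ∉ X ∧ G.owner (edgeAt v₀ el l).1 ≠ some i)
    (fun k hk => by simp [h0 k hk]) ?_
  intro e s' he hf h5 hJ s'' ha hr ht k hk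
  have hs' := hs.of_frame hf (by decide) (by decide)
  have h1 := hs'.src e he
  have h2 := hs'.tgt e he
  have h10 : s'.reg 10 = i := (hf.reg 10 (by decide)).trans hi
  have hF' : s'.arr 4 e ≠ 0 ↔ edgeAt v₀ el e ∈ F := by
    rw [hf.arr 4 (by decide)]; exact hF e he
  have hX' : s'.arr 9 (s'.reg 9 + (edgeAt v₀ el e).2) = 0 ↔ (edgeAt v₀ el e).2 ∉ X := by
    rw [hf.arr 9 (by decide), hf.reg 9 (by decide), ← hX (edgeAt v₀ el e).2, not_not]
  have ho := (hs'.owner_eq (edgeAt v₀ el e).1 i).not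
  by_cases hc : edgeAt v₀ el e ∈ F ∧ (edgeAt v₀ el e).2 ∉ X ∧
      G.owner (edgeAt v₀ el e).1 ≠ some i
  · have h11 : s''.arr 11 = Function.update (s'.arr 11) (edgeAt v₀ el e).1 1 := by
      rw [ha, taintBody, Prog.exec, if_pos]
      · simp [Prog.exec, Expr.eval, h5, h1]
      · simp only [Test.Holds, Expr.eval, h5, h1, h2, h10, Nat.le_zero]
        exact ⟨hF'.2 hc.1, hX'.2 hc.2.1, fun h => ho.2 hc.2.2 (le_antisymm h.1 h.2)⟩
    rw [h11, Function.update_apply]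
    by_cases hk' : (edgeAt v₀ el k).1 = (edgeAt v₀ el e).1
    · simp only [hk', if_true]
      exact ⟨fun _ => ⟨e, Nat.lt_succ_self e, rfl, hc⟩, fun _ => one_ne_zero⟩
    · rw [if_neg (fun h => hk' (Fin.val_injective h)), hJ k hk]
      constructor
      · rintro ⟨l, hl, h⟩; exact ⟨l, Nat.lt_succ_of_lt hl, h⟩
      · rintro ⟨l, hl, h⟩
        rcases Nat.lt_succ_iff_lt_or_eq.1 hl with hl' | rfl
        · exact ⟨l, hl', h⟩
        · exact absurd h.1.symm hk'
  · have h11 : s''.arr 11 = s'.arr 11 := by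
      rw [ha, taintBody, Prog.exec, if_neg]
      · rfl
      · simp only [Test.Holds, Expr.eval, h5, h1, h2, h10, Nat.le_zero]
        rintro ⟨h3, h4, h5'⟩
        exact hc ⟨hF'.1 h3, hX'.1 h4, ho.1 fun h => h5' ⟨h.le, h.ge⟩⟩
    rw [h11, hJ k hk]
    constructor
    · rintro ⟨l, hl, h⟩; exact ⟨l, Nat.lt_succ_of_lt hl, h⟩
    · rintro ⟨l, hl, h⟩
      rcases Nat.lt_succ_iff_lt_or_eq.1 hl with hl' | rfl
      · exact ⟨l, hl', h⟩
      · exact absurd h.2 hc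

variable (v₀ el) in
/-- The queue in array `12`, of the length in register `12`, consists of the vertices in `L`,
which are those marked in array `10`. -/
structure Queue (s : State) (L : List (Fin n)) : Prop where
  nodup : L.Nodup
  len : s.reg 12 = L.length
  cell : ∀ (k : ℕ) (hk : k < L.length), s.arr 12 k = L[k]
  mark : ∀ v ∈ ends v₀ el, s.arr 10 v ≠ 0 ↔ v ∈ L

theorem Queue.push {s' : State} {L : List (Fin n)} (h : Queue v₀ el s L) {u : Fin n}
    (hu : u ∉ L) (h12 : s'.reg 12 = s.reg 12 + 1)
    (ha12 : s'.arr 12 = Function.update (s.arr 12) (s.reg 12) u)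
    (ha10 : s'.arr 10 = Function.update (s.arr 10) u 1) : Queue v₀ el s' (L ++ [u]) := by
  refine ⟨?_, ?_, ?_, ?_⟩
  · exact List.nodup_append.2 ⟨h.nodup, List.nodup_singleton u, fun a ha b hb => by
      rw [List.mem_singleton.1 hb]; rintro rfl; exact hu ha⟩
  · simp [h12, h.len]
  · intro k hk
    rw [ha12, h.len, Function.update_apply]
    split_ifs with hkl
    · subst hkl; simp
    · have : k < L.length := by simp at hk; omega
      rw [h.cell k this, List.getElem_append_left this]
  · intro v hv
    rw [ha10, Function.update_apply]
    split_ifs with hvu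
    · simp [Fin.val_injective hvu]
    · rw [h.mark v hv]
      have : v ≠ u := fun hc => hvu (congrArg _ hc)
      simp [this]

theorem Queue.of_eq {s' : State} {L : List (Fin n)} (h : Queue v₀ el s L)
    (h12 : s'.reg 12 = s.reg 12) (ha12 : s'.arr 12 = s.arr 12)
    (ha10 : s'.arr 10 = s.arr 10) : Queue v₀ el s' L :=
  ⟨h.nodup, h12 ▸ h.len, ha12 ▸ h.cell, ha10 ▸ h.mark⟩

/-- The queue consists of the vertices of the row `X` in `Good i A st`. -/
theorem does_seed (hs : Static G v₀ el pl s) (hel : ∀ e, e ∈ el ↔ e ∈ G.edges)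
    (hi : s.reg 10 = i) (hX : Rep (fun v => s.arr 9 (s.reg 9 + v)) X)
    (hXA : X ⊆ A) (hXe : X ⊆ ends v₀ el)
    (hgood : ∀ v ∈ A, G.Terminal v →
        ((s.reg 11 ≠ 0 → ¬ s.table 0 v i ≤ s.table 0 (s.reg 11 - 1) i) ↔
          (st → ∃ t ∈ A, G.Terminal t ∧ G.payoff t i < G.payoff v i)))
    (h0 : ∀ v ∈ ends v₀ el, s.arr 10 v = 0) (h12 : s.reg 12 = 0) :
    Does seedBody.forEdges ((seedBody.cost + 2) * el.length + 2) s fun s' =>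
      ∃ L, Queue v₀ el s' L ∧ ∀ v, v ∈ L ↔ v ∈ X ∧ v ∈ G.Good i A st := by
  refine (Does.forEdges hs.len rfl (by decide) (by decide) (fun e s' =>
    ∃ L, Queue v₀ el s' L ∧ ∀ v, v ∈ L ↔ (v ∈ X ∧ v ∈ G.Good i A st) ∧
      ∃ k < e, (edgeAt v₀ el k).2 = v) ⟨[], ⟨List.nodup_nil, by simpa using h12, by simp, ?_⟩,
        by simp⟩ ?_).mono le_rfl ?_
  · intro v hv
    simp [h0 v hv]
  · rintro e s' he hf h5 ⟨L, hQ, hL⟩ s'' ha hr ht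
    have hs' := hs.of_frame hf (by decide) (by decide)
    have h2 := hs'.tgt e he
    have h10 : s'.reg 10 = i := (hf.reg 10 (by decide)).trans hi
    have h11 : s'.reg 11 = s.reg 11 := hf.reg 11 (by decide)
    have hX' : s'.arr 9 (s'.reg 9 + (edgeAt v₀ el e).2) ≠ 0 ↔ (edgeAt v₀ el e).2 ∈ X := by
      rw [hf.arr 9 (by decide), hf.reg 9 (by decide)]; exact hX _
    have hT := hs'.nonterm (edgeAt v₀ el e).2
    have hmark := hQ.mark _ (tgt_mem_ends he)
    have hg := hgood (edgeAt v₀ el e).2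
    have hr12 := hr 12 (by decide)
    by_cases hc : ((edgeAt v₀ el e).2 ∈ X ∧ (edgeAt v₀ el e).2 ∈ G.Good i A st) ∧
        (edgeAt v₀ el e).2 ∉ L
    · have hb : ((Test.and (.isZero (.get 6 tgtE)) (.isZero (.get 10 tgtE))).and
          ((Test.nonzero (.get 9 (.add (.reg 9) tgtE))).and
          (.not (.and (.nonzero (.reg 11))
          (.rle (.get 0 tgtE (.reg 10)) (.get 0 (.sub (.reg 11) (.lit 1)) (.reg 10))))))).Holds
          s' := by
        simp only [Test.Holds, Expr.eval, RExpr.eval, h5, h2, h10, h11, Nat.le_zero, hf.table]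
        refine ⟨⟨?_, ?_⟩, hX'.2 hc.1.1, fun h => ?_⟩
        · by_contra h; exact hT.1 h hc.1.2.2.1
        · by_contra h; exact hc.2 (hmark.1 h)
        · exact (hg hc.1.2.1 hc.1.2.2.1).2 hc.1.2.2.2 h.1 h.2
      refine ⟨L ++ [(edgeAt v₀ el e).2], hQ.push hc.2 ?_ ?_ ?_, fun v => ?_⟩
      · rw [hr12, seedBody, Prog.exec, if_pos hb]
        simp [Prog.exec, Expr.eval]
      · rw [ha, seedBody, Prog.exec, if_pos hb]
        simp [Prog.exec, Expr.eval, h5, h2]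
      · rw [ha, seedBody, Prog.exec, if_pos hb]
        simp [Prog.exec, Expr.eval, h5, h2]
      · rw [List.mem_append, List.mem_singleton, hL]
        constructor
        · rintro (⟨h, k, hk, hk'⟩ | rfl)
          · exact ⟨h, k, Nat.lt_succ_of_lt hk, hk'⟩
          · exact ⟨hc.1, e, Nat.lt_succ_self e, rfl⟩
        · rintro ⟨h, k, hk, hk'⟩
          rcases Nat.lt_succ_iff_lt_or_eq.1 hk with hk2 | rfl
          · exact .inl ⟨h, k, hk2, hk'⟩
          · exact .inr hk'.symm
    · have hex : seedBody.exec s' = s' := by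
        rw [seedBody, Prog.exec, if_neg]
        · rfl
        · simp only [Test.Holds, Expr.eval, RExpr.eval, h5, h2, h10, h11, Nat.le_zero, hf.table]
          rintro ⟨⟨h6, h7⟩, h8, h9⟩
          have hXe := hX'.1 h8
          have hTe : G.Terminal (edgeAt v₀ el e).2 := by
            by_contra h; exact hT.2 h h6
          exact hc ⟨⟨hXe, hXA hXe, hTe, (hg (hXA hXe) hTe).1 fun ha hb => h9 ⟨ha, hb⟩⟩,
            fun h => hmark.2 h h7⟩
      refine ⟨L, hQ.of_eq ?_ ?_ ?_, fun v => ?_⟩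
      · rw [hr12, hex]
      · rw [ha, hex]
      · rw [ha, hex]
      · rw [hL]
        constructor
        · rintro ⟨h, k, hk, hk'⟩
          exact ⟨h, k, Nat.lt_succ_of_lt hk, hk'⟩
        · rintro ⟨h, k, hk, rfl⟩
          rcases Nat.lt_succ_iff_lt_or_eq.1 hk with hk2 | rfl
          · exact ⟨h, k, hk2, rfl⟩
          · by_contra hc'
            exact hc ⟨h, fun hm => hc' ((hL _).1 hm)⟩
  · rintro s' - ⟨L, hQ, hL⟩
    refine ⟨L, hQ, fun v => (hL v).trans ⟨fun h => h.1, fun h => ⟨h, ?_⟩⟩⟩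
    obtain ⟨k, hk, hv | hv⟩ := hXe h.1
    · have := h.2.2.1 (edgeAt v₀ el k).2
      rw [← hv] at this
      exact absurd ((hel _).1 (edgeAt_mem (v₀ := v₀) hk)) this
    · exact ⟨k, hk, hv⟩

end Rep

/-! ### Backward search -/

section Search

variable {n q : ℕ} {G : Game (Fin n) (Fin q)} {v₀ : Fin n} {el : List (Fin n × Fin n)}
  {pl : List (Fin q)} {F : Set (Fin n × Fin n)} {A X : Set (Fin n)} {st : Prop} {i : Fin q}
  {s : State}

/-- The visit of the edge in register `13` in the backward search: its source is put into the queue,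
if the search can proceed there and has not been there before. -/
def visitBody : Prog :=
  .ite (.and (.and (.nonzero (.get 4 (.reg 13)))
      (.nonzero (.get 9 (.add (.reg 9) (.get 0 (.reg 13))))))
      (.and (.isZero (.get 11 (.get 0 (.reg 13)))) (.isZero (.get 10 (.get 0 (.reg 13))))))
    (.seq (.put 10 (.get 0 (.reg 13)) (.lit 1)) (.seq (.put 12 (.reg 12) (.get 0 (.reg 13)))
      (.set 12 (.add (.reg 12) (.lit 1))))) .skip

/-- One step of the backward search. Register `16` is the read position of the queue, and register
`13` the position in the linked list of the edges that end in the current vertex. -/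
def searchBody : Prog :=
  .ite (.isZero (.reg 13))
    (.seq (.set 13 (.get 7 (.get 12 (.reg 16)))) (.set 16 (.add (.reg 16) (.lit 1))))
    (.seq (.set 13 (.sub (.reg 13) (.lit 1)))
      (.seq visitBody (.set 13 (.get 8 (.reg 13)))))

/-- The backward search from the vertices in the queue. -/
def searchLoop : Prog :=
  .loop (.not (.and (.le (.reg 12) (.reg 16)) (.isZero (.reg 13)))) searchBody

open Classical in
variable (v₀ el) in
/-- The edges that the search has not looked at yet, when it has taken the first `h` vertices from
the queue `L` and has reached position `c` in the list of the current vertex. -/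
noncomputable def unseen (L : List (Fin n)) (h c : ℕ) : Finset ℕ :=
  (Finset.range el.length).filter fun k => (edgeAt v₀ el k).2 ∉ L.take h ∨
    (k < c ∧ (edgeAt v₀ el k).2 = (edgeAt v₀ el (c - 1)).2)

theorem mem_unseen {L : List (Fin n)} {h c k : ℕ} : k ∈ unseen v₀ el L h c ↔ k < el.length ∧
    ((edgeAt v₀ el k).2 ∉ L.take h ∨
      (k < c ∧ (edgeAt v₀ el k).2 = (edgeAt v₀ el (c - 1)).2)) := by
  simp [unseen]

variable (v₀ el) in
/-- The invariant of the backward search: `D` are the edges along which the search proceeds, `L₀`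
is the initial queue, and `W` is a set that the search cannot leave. -/
structure SearchInv (D : Set (Fin n × Fin n)) (L₀ : List (Fin n)) (W : Set (Fin n)) (s : State)
    (L : List (Fin n)) : Prop extends Queue v₀ el s L where
  head_le : s.reg 16 ≤ L.length
  ptr_le : s.reg 13 ≤ el.length
  ptr_mem : s.reg 13 ≠ 0 → (edgeAt v₀ el (s.reg 13 - 1)).2 ∈ L.take (s.reg 16)
  init_sub : L₀ ⊆ L
  sound : ∀ v ∈ L, v ∈ W
  ends : ∀ v ∈ L, v ∈ ends v₀ el
  seen : ∀ k < el.length, k ∉ unseen v₀ el L (s.reg 16) (s.reg 13) → edgeAt v₀ el k ∈ D →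
    (edgeAt v₀ el k).1 ∈ L

/-- The backward search finds a set of vertices that contains the initial queue and is closed under
predecessors along `D`. Each step either takes a vertex from the queue, which has at most
`2 * el.length` places, or looks at an unseen edge. -/
theorem does_search {D : Set (Fin n × Fin n)} {T : Set (Fin n)} {L₀ : List (Fin n)}
    {W : Set (Fin n)} (hs : Static G v₀ el pl s)
    (hF : RepEdges v₀ el (s.arr 4) F) (hX : Rep (fun v => s.arr 9 (s.reg 9 + v)) X)
    (hT : ∀ k < el.length, s.arr 11 (edgeAt v₀ el k).1 ≠ 0 ↔ (edgeAt v₀ el k).1 ∈ T)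
    (hD : ∀ e, e ∈ D ↔ e ∈ F ∧ e.1 ∈ X ∧ e.1 ∉ T)
    (hQ : Queue v₀ el s L₀) (h16 : s.reg 16 = 0) (h13 : s.reg 13 = 0)
    (hL₀ : ∀ v ∈ L₀, v ∈ W) (hL₀e : ∀ v ∈ L₀, v ∈ ends v₀ el)
    (hW : ∀ e ∈ D, e.2 ∈ W → e.1 ∈ W) :
    Does searchLoop ((searchBody.cost + 1) * (3 * el.length) + 1) s fun s' =>
      ∃ L, Queue v₀ el s' L ∧ L₀ ⊆ L ∧ (∀ v ∈ L, v ∈ W) ∧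
        ∀ k < el.length, edgeAt v₀ el k ∈ D → (edgeAt v₀ el k).2 ∈ L → (edgeAt v₀ el k).1 ∈ L := by
  have hinit : SearchInv v₀ el D L₀ W s L₀ :=
    { hQ with
      head_le := by omega
      ptr_le := by omega
      ptr_mem := fun h => absurd h13 h
      init_sub := fun _ h => h
      sound := hL₀
      ends := hL₀e
      seen := fun k hk h => absurd (mem_unseen.2 ⟨hk, .inl (by simp [h16])⟩) h }
  refine (Does.loop (fun φ s' => ∃ L, SearchInv v₀ el D L₀ W s' L ∧
    (searchBody.cost + 1) * ((unseen v₀ el L (s'.reg 16) (s'.reg 13)).card +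
      (2 * el.length - s'.reg 16)) ≤ φ) ?_ ⟨L₀, hinit, ?_⟩).mono le_rfl ?_
  · rintro φ s' hf ⟨L, hJ, hφ⟩ hb
    have hs' := hs.of_frame hf (by decide) (by decide)
    have hlen := length_le_of_ends hJ.nodup hJ.ends
    have hcost : ∀ {L' : List (Fin n)} {h' c' : ℕ},
        (unseen v₀ el L' h' c').card + (2 * el.length - h') + 1 ≤
          (unseen v₀ el L (s'.reg 16) (s'.reg 13)).card + (2 * el.length - s'.reg 16) →
        searchBody.cost + 1 + (searchBody.cost + 1) *
          ((unseen v₀ el L' h' c').card + (2 * el.length - h')) ≤ φ := by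
      intro L' h' c' hle
      refine le_trans ?_ hφ
      have := Nat.mul_le_mul_left (searchBody.cost + 1) hle
      rw [Nat.mul_add, Nat.mul_one] at this
      omega
    by_cases hc : s'.reg 13 = 0
    · -- the next vertex is taken from the queue
      have hlt : s'.reg 16 < L.length := by
        rw [← hJ.len]
        by_contra hc'
        exact hb ⟨not_lt.1 hc', by simp [Test.Holds, Expr.eval, hc]⟩
      have hex : searchBody.exec s' = { s' with reg := Function.update (Function.update s'.reg 13
          (prevOcc v₀ el L[s'.reg 16] el.length)) 16 (s'.reg 16 + 1) } := by
        rw [searchBody, Prog.exec, if_pos (by simp [Test.Holds, Expr.eval, hc])]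
        simp [Prog.exec, Expr.eval, hJ.cell _ hlt, hs'.head]
      have hnm : L[s'.reg 16] ∉ L.take (s'.reg 16) := by
        intro hm
        obtain ⟨k, hk, he⟩ := List.mem_take_iff_getElem.1 hm
        have := (hJ.nodup.getElem_inj_iff).1 he
        omega
      refine ⟨_, Does.simple searchBody rfl ⟨_, ⟨L, ⟨hJ.toQueue.of_eq ?_ ?_ ?_, ?_, ?_, ?_,
        hJ.init_sub, hJ.sound, hJ.ends, ?_⟩, le_rfl⟩, ?_⟩⟩
      · simp [hex]
      · simp [hex]
      · simp [hex]
      · simp only [hex, Function.update_self]; omega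
      · simp [hex, prevOcc_le]
      · simp only [hex, Function.update_self, ne_eq, not_false_eq_true,
          Function.update_of_ne, Nat.reduceEqDiff]
        intro h
        rw [prevOcc_tgt v₀ el _ _ h, List.take_succ_eq_append_getElem hlt]
        exact List.mem_append_right _ (List.mem_singleton.2 rfl)
      · simp only [hex, Function.update_self, ne_eq, not_false_eq_true,
          Function.update_of_ne, Nat.reduceEqDiff]
        intro k hk hun hkD
        refine hJ.seen k hk (fun hu => hun ?_) hkD
        rw [mem_unseen] at hu ⊢
        refine ⟨hk, ?_⟩
        rw [hc] at hu
        by_cases hkv : (edgeAt v₀ el k).2 = L[s'.reg 16]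
        · have hlt' := lt_prevOcc v₀ el _ hk hkv
          refine .inr ⟨hlt', ?_⟩
          rw [prevOcc_tgt v₀ el _ _ (by omega), hkv]
        · refine .inl ?_
          rw [List.take_succ_eq_append_getElem hlt, List.mem_append, List.mem_singleton]
          exact fun h => h.elim (hu.2.resolve_right (by simp)) hkv
      · simp only [hex, Function.update_self, ne_eq, not_false_eq_true,
          Function.update_of_ne, Nat.reduceEqDiff]
        refine hcost ?_
        have : unseen v₀ el L (s'.reg 16 + 1) (prevOcc v₀ el L[s'.reg 16] el.length) ⊆
            unseen v₀ el L (s'.reg 16) (s'.reg 13) := by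
          intro k hk
          rw [mem_unseen] at hk ⊢
          refine ⟨hk.1, .inl ?_⟩
          rcases hk.2 with h | h
          · exact fun hm => h (List.take_subset_take_left L (Nat.le_succ _) hm)
          · rw [h.2, prevOcc_tgt v₀ el _ _ (by omega)]
            exact hnm
        have := Finset.card_le_card this
        omega
    · -- the search looks at the next edge of the current list
      obtain ⟨e, he⟩ := Nat.exists_eq_succ_of_ne_zero hc
      have hem : e < el.length := by have := hJ.ptr_le; omega
      have hvm : (edgeAt v₀ el e).2 ∈ L.take (s'.reg 16) := by
        have := hJ.ptr_mem hc
        rwa [he, Nat.succ_sub_one] at this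
      have h1 := hs'.src e hem
      have hF' : s'.arr 4 e ≠ 0 ↔ edgeAt v₀ el e ∈ F := by
        rw [hf.arr 4 (by decide)]; exact hF e hem
      have hX' : s'.arr 9 (s'.reg 9 + (edgeAt v₀ el e).1) ≠ 0 ↔ (edgeAt v₀ el e).1 ∈ X := by
        rw [hf.arr 9 (by decide), hf.reg 9 (by decide)]; exact hX _
      have hT' : s'.arr 11 (edgeAt v₀ el e).1 ≠ 0 ↔ (edgeAt v₀ el e).1 ∈ T := by
        rw [hf.arr 11 (by decide)]; exact hT e hem
      have hmark := hJ.mark _ (src_mem_ends (v₀ := v₀) hem)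
      have hnb : ¬ (Test.isZero (.reg 13)).Holds s' := by simp [Test.Holds, Expr.eval, hc]
      have hple := prevOcc_le v₀ el (edgeAt v₀ el e).2 e
      have hunseen : unseen v₀ el L (s'.reg 16) (prevOcc v₀ el (edgeAt v₀ el e).2 e) ⊆
          (unseen v₀ el L (s'.reg 16) (s'.reg 13)).erase e := by
        intro k hk
        rw [mem_unseen] at hk
        rw [Finset.mem_erase, mem_unseen]
        refine ⟨?_, hk.1, ?_⟩
        · rintro rfl
          rcases hk.2 with h | h
          · exact h hvm
          · omega
        · refine hk.2.imp id fun h => ⟨by omega, ?_⟩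
          rw [h.2, he, Nat.succ_sub_one, prevOcc_tgt v₀ el _ _ (by omega)]
      have hein : e ∈ unseen v₀ el L (s'.reg 16) (s'.reg 13) :=
        mem_unseen.2 ⟨hem, .inr ⟨by omega, by rw [he, Nat.succ_sub_one]⟩⟩
      have hcard := Finset.card_le_card hunseen
      rw [Finset.card_erase_of_mem hein] at hcard
      have hpos := Finset.card_pos.2 ⟨e, hein⟩
      -- an edge that has been looked at is `e` or was looked at before
      have hseen : ∀ k < el.length,
          k ∉ unseen v₀ el L (s'.reg 16) (prevOcc v₀ el (edgeAt v₀ el e).2 e) →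
          edgeAt v₀ el k ∈ D → k = e ∨ (edgeAt v₀ el k).1 ∈ L := by
        intro k hk hun hkD
        by_cases hke : k = e
        · exact .inl hke
        · refine .inr (hJ.seen k hk (fun hu => hun ?_) hkD)
          rw [mem_unseen] at hu ⊢
          refine ⟨hk, hu.2.imp id fun h => ?_⟩
          rw [he, Nat.succ_sub_one] at h
          have hlt' := lt_prevOcc v₀ el _ (lt_of_le_of_ne (Nat.lt_succ_iff.1 h.1) hke) h.2
          refine ⟨hlt', ?_⟩
          rw [prevOcc_tgt v₀ el _ _ (by omega), h.2]
      by_cases hpush : edgeAt v₀ el e ∈ D ∧ (edgeAt v₀ el e).1 ∉ L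
      · have hDe := (hD _).1 hpush.1
        have hex : searchBody.exec s' = { s' with
            reg := Function.update (Function.update (Function.update s'.reg 13 e) 12
              (s'.reg 12 + 1)) 13 (prevOcc v₀ el (edgeAt v₀ el e).2 e)
            arr := Function.update (Function.update s'.arr 10
              (Function.update (s'.arr 10) (edgeAt v₀ el e).1 1)) 12
              (Function.update (s'.arr 12) (s'.reg 12) (edgeAt v₀ el e).1) } := by
          have h10 : s'.arr 10 (edgeAt v₀ el e).1 = 0 := by
            by_contra h; exact hpush.2 (hmark.1 h)
          have h11 : s'.arr 11 (edgeAt v₀ el e).1 = 0 := by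
            by_contra h; exact hDe.2.2 (hT'.1 h)
          rw [searchBody, Prog.exec, if_neg hnb]
          simp [visitBody, Prog.exec, Expr.eval, Test.Holds, he, h1, hF'.2 hDe.1, hX'.2 hDe.2.1,
            h10, h11, hs'.next e hem]
        have htake : (L ++ [(edgeAt v₀ el e).1]).take (s'.reg 16) = L.take (s'.reg 16) :=
          List.take_append_of_le_length hJ.head_le
        have hun : ∀ c, unseen v₀ el (L ++ [(edgeAt v₀ el e).1]) (s'.reg 16) c =
            unseen v₀ el L (s'.reg 16) c := by
          intro c; ext k; rw [mem_unseen, mem_unseen, htake]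
        refine ⟨_, Does.simple searchBody rfl ⟨_, ⟨L ++ [(edgeAt v₀ el e).1],
          ⟨hJ.toQueue.push hpush.2 ?_ ?_ ?_, ?_, ?_, ?_, ?_, ?_, ?_, ?_⟩, le_rfl⟩, ?_⟩⟩
        · simp [hex]
        · simp [hex]
        · simp [hex]
        · simp only [hex, ne_eq, not_false_eq_true, Function.update_of_ne,
            Nat.reduceEqDiff, List.length_append]
          exact hJ.head_le.trans (Nat.le_add_right _ _)
        · simp only [hex, Function.update_self]; omega
        · simp only [hex, Function.update_self, ne_eq, not_false_eq_true,
            Function.update_of_ne, Nat.reduceEqDiff, htake]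
          intro h
          rwa [prevOcc_tgt v₀ el _ _ h]
        · exact fun v hv => List.mem_append_left _ (hJ.init_sub hv)
        · intro v hv
          rcases List.mem_append.1 hv with h | h
          · exact hJ.sound v h
          · rw [List.mem_singleton.1 h]
            exact hW _ hpush.1 (hJ.sound _ (List.mem_of_mem_take hvm))
        · intro v hv
          rcases List.mem_append.1 hv with h | h
          · exact hJ.ends v h
          · rw [List.mem_singleton.1 h]
            exact src_mem_ends hem
        · simp only [hex, Function.update_self, ne_eq, not_false_eq_true,
            Function.update_of_ne, Nat.reduceEqDiff, hun]
          intro k hk hu hkD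
          rcases hseen k hk hu hkD with rfl | h
          · simp
          · exact List.mem_append_left _ h
        · simp only [hex, Function.update_self, ne_eq, not_false_eq_true,
            Function.update_of_ne, Nat.reduceEqDiff]
          refine hcost ?_
          rw [hun]
          omega
      · have hex : searchBody.exec s' = { s' with
            reg := Function.update (Function.update s'.reg 13 e) 13
              (prevOcc v₀ el (edgeAt v₀ el e).2 e) } := by
          have hv : visitBody.exec { s' with reg := Function.update s'.reg 13 e } =
              { s' with reg := Function.update s'.reg 13 e } := by
            rw [visitBody, Prog.exec, if_neg]
            · rfl
            · simp only [Test.Holds, Expr.eval, Function.update_self, h1, Nat.le_zero, ne_eq,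
                not_false_eq_true, Function.update_of_ne, Nat.reduceEqDiff]
              rintro ⟨⟨h4, h9⟩, h11, h10⟩
              exact hpush ⟨(hD _).2 ⟨hF'.1 h4, hX'.1 h9, fun h => hT'.2 h h11⟩,
                fun h => hmark.2 h h10⟩
          rw [searchBody, Prog.exec, if_neg hnb]
          simp [Prog.exec, Expr.eval, he, hv, hs'.next e hem]
        refine ⟨_, Does.simple searchBody rfl ⟨_, ⟨L, ⟨hJ.toQueue.of_eq ?_ ?_ ?_, ?_, ?_, ?_,
          hJ.init_sub, hJ.sound, hJ.ends, ?_⟩, le_rfl⟩, ?_⟩⟩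
        · simp [hex]
        · simp [hex]
        · simp [hex]
        · simp only [hex, ne_eq, not_false_eq_true, Function.update_of_ne,
            Nat.reduceEqDiff]
          exact hJ.head_le
        · simp only [hex, Function.update_self]; omega
        · simp only [hex, Function.update_self, ne_eq, not_false_eq_true,
            Function.update_of_ne, Nat.reduceEqDiff]
          intro h
          rwa [prevOcc_tgt v₀ el _ _ h]
        · simp only [hex, Function.update_self, ne_eq, not_false_eq_true,
            Function.update_of_ne, Nat.reduceEqDiff]
          intro k hk hu hkD
          rcases hseen k hk hu hkD with rfl | h
          · exact by_contra fun h => hpush ⟨hkD, h⟩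
          · exact h
        · simp only [hex, Function.update_self, ne_eq, not_false_eq_true,
            Function.update_of_ne, Nat.reduceEqDiff]
          refine hcost ?_
          omega
  · have : (unseen v₀ el L₀ (s.reg 16) (s.reg 13)).card ≤ el.length := by
      refine (Finset.card_filter_le _ _).trans (by simp)
    exact Nat.mul_le_mul_left _ (by omega)
  · rintro s' - ⟨⟨φ, L, hJ, -⟩, hb⟩
    have hb' : L.length ≤ s'.reg 16 ∧ s'.reg 13 = 0 := by
      simpa [Test.Holds, Expr.eval, hJ.len] using hb
    refine ⟨L, hJ.toQueue, hJ.init_sub, hJ.sound, fun k hk hkD hkL => hJ.seen k hk ?_ hkD⟩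
    rw [mem_unseen, hb'.2, List.take_of_length_le hb'.1]
    simp [hkL]

end Search

/-! ### Rounds and rows -/

section Rows

variable {n q : ℕ} {G : Game (Fin n) (Fin q)} {v₀ : Fin n} {el : List (Fin n × Fin n)}
  {pl : List (Fin q)} {F : Set (Fin n × Fin n)} {A : Set (Fin n)} {X : ℕ → Set (Fin n)}
  {st : Prop} {i : Fin q} {s : State}

/-- The body of the loop that finds out whether the current row of array `9` is contained in the
set marked in array `10`. -/
def changeBody : Prog :=
  .ite (.not (.and (.not (.and (.nonzero (.get 9 (.add (.reg 9) srcE))) (.isZero (.get 10 srcE))))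
      (.not (.and (.nonzero (.get 9 (.add (.reg 9) tgtE))) (.isZero (.get 10 tgtE))))))
    (.set 14 (.lit 1)) .skip

/-- One step of the fixed-point iteration for the pessimist number `j`, where `j` is in
register `8`. -/
def roundProg : Prog :=
  .seq (.set 10 (.get 3 (.reg 8))) (.seq worstProg (.seq clearBody.forEdges
    (.seq taintBody.forEdges (.seq (.set 12 (.lit 0)) (.seq seedBody.forEdges
      (.seq (.seq (.set 16 (.lit 0)) (.set 13 (.lit 0))) (.seq searchLoop
        (.seq (.set 14 (.lit 0)) changeBody.forEdges))))))))

theorem does_change {X W : Set (Fin n)} (hs : Static G v₀ el pl s)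
    (hX : Rep (fun v => s.arr 9 (s.reg 9 + v)) X) (hXe : X ⊆ ends v₀ el)
    (hW : ∀ v ∈ ends v₀ el, s.arr 10 v ≠ 0 ↔ v ∈ W) (h14 : s.reg 14 = 0) :
    Does changeBody.forEdges ((changeBody.cost + 2) * el.length + 2) s
      fun s' => s'.reg 14 = 0 ↔ X ⊆ W := by
  refine (Does.forEdges hs.len rfl (by decide) (by decide) (fun e s' => s'.reg 14 = 0 ↔
    ∀ k < e, ((edgeAt v₀ el k).1 ∈ X → (edgeAt v₀ el k).1 ∈ W) ∧
      ((edgeAt v₀ el k).2 ∈ X → (edgeAt v₀ el k).2 ∈ W)) (by simp [h14]) ?_).mono le_rfl ?_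
  · intro e s' he hf h5 hJ s'' ha hr ht
    have hs' := hs.of_frame hf (by decide) (by decide)
    have h1 := hs'.src e he
    have h2 := hs'.tgt e he
    have hX' : ∀ v : Fin n, s'.arr 9 (s'.reg 9 + v) ≠ 0 ↔ v ∈ X := by
      rw [hf.arr 9 (by decide), hf.reg 9 (by decide)]; exact hX
    have hW' : ∀ v ∈ ends v₀ el, s'.arr 10 v = 0 ↔ v ∉ W := by
      rw [hf.arr 10 (by decide)]
      intro v hv
      rw [← hW v hv, not_not]
    have hr14 := hr 14 (by decide)
    by_cases hc : ((edgeAt v₀ el e).1 ∈ X → (edgeAt v₀ el e).1 ∈ W) ∧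
        ((edgeAt v₀ el e).2 ∈ X → (edgeAt v₀ el e).2 ∈ W)
    · have : s''.reg 14 = s'.reg 14 := by
        rw [hr14, changeBody, Prog.exec, if_neg]
        · rfl
        · simp only [Test.Holds, Expr.eval, h5, h1, h2, Nat.le_zero, not_not]
          refine ⟨fun h => ?_, fun h => ?_⟩
          · exact (hW' _ (src_mem_ends he)).1 h.2 (hc.1 ((hX' _).1 h.1))
          · exact (hW' _ (tgt_mem_ends he)).1 h.2 (hc.2 ((hX' _).1 h.1))
      rw [this, hJ]
      refine ⟨fun h k hk => ?_, fun h k hk => h k (Nat.lt_succ_of_lt hk)⟩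
      rcases Nat.lt_succ_iff_lt_or_eq.1 hk with hk' | rfl
      · exact h k hk'
      · exact hc
    · have : s''.reg 14 = 1 := by
        rw [hr14, changeBody, Prog.exec, if_pos]
        · simp [Prog.exec, Expr.eval]
        · simp only [Test.Holds, Expr.eval, h5, h1, h2, Nat.le_zero]
          rintro ⟨h3, h4⟩
          refine hc ⟨fun h => ?_, fun h => ?_⟩
          · exact by_contra fun hw => h3 ⟨(hX' _).2 h, (hW' _ (src_mem_ends he)).2 hw⟩
          · exact by_contra fun hw => h4 ⟨(hX' _).2 h, (hW' _ (tgt_mem_ends he)).2 hw⟩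
      rw [this]
      exact ⟨fun h => absurd h one_ne_zero, fun h => absurd (h e (Nat.lt_succ_self e)) hc⟩
  · intro s' _ hJ
    rw [hJ]
    refine ⟨fun h v hv => ?_, fun h k hk => ⟨fun hv => h hv, fun hv => h hv⟩⟩
    obtain ⟨k, hk, rfl | rfl⟩ := hXe hv
    · exact (h k hk).1 hv
    · exact (h k hk).2 hv

/-- The round computes `Att`, marks it in array `10`, and tells in register `14` whether it differs
from the current row. -/
theorem does_round {X : Set (Fin n)} (hs : Static G v₀ el pl s)
    (hel : ∀ e, e ∈ el ↔ e ∈ G.edges) (hFe : F ⊆ G.effEdges) {j : ℕ} (hj : j < pl.length)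
    (h8 : s.reg 8 = j) (hA : Rep (s.arr 5) A) (hAe : A ⊆ ends v₀ el) (hst : s.reg 15 ≠ 0 ↔ st)
    (hF : RepEdges v₀ el (s.arr 4) F) (hX : Rep (fun v => s.arr 9 (s.reg 9 + v)) X)
    (hXA : X ⊆ A) :
    Does roundProg (200 * (el.length + 1)) s fun s' =>
      (∀ v ∈ ends v₀ el, s'.arr 10 v ≠ 0 ↔ v ∈ G.Att pl[j] A F st X) ∧
      (s'.reg 14 = 0 ↔ X ⊆ G.Att pl[j] A F st X) := by
  set i := pl[j] with hi
  set W := G.Att i A F st X with hW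
  have hXe := hXA.trans hAe
  have h1 : Does (.set 10 (.get 3 (.reg 8))) 1 s fun s' => s'.reg 10 = i :=
    Does.simple (.set 10 (.get 3 (.reg 8))) rfl
      (by simp [Prog.exec, Expr.eval, h8, hs.pess j hj, hi])
  refine (h1.seq (T' := 1 + ((worstBody.cost + 2) * el.length + 2 + 1) +
    ((clearBody.cost + 2) * el.length + 2 + ((taintBody.cost + 2) * el.length + 2 +
    (1 + ((seedBody.cost + 2) * el.length + 2 + (2 + ((searchBody.cost + 1) * (3 * el.length) + 1 +
    (1 + ((changeBody.cost + 2) * el.length + 2))))))))) fun s₁ f₁ h₁ => ?_).mono ?_ fun _ _ h => h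
  · have hs₁ := hs.of_frame f₁ (by decide) (by decide)
    refine (does_worst (A := A) (st := st) hs₁ hel h₁ ?_ hAe ?_).seq fun s₂ f₂ h₂ => ?_
    · rw [f₁.arr 5 (by decide)]; exact hA
    · rw [f₁.reg 15 (by decide)]; exact hst
    have hs₂ := hs₁.of_frame f₂ (by decide) (by decide)
    refine (does_clear hs₂).seq fun s₃ f₃ h₃ => ?_
    have hs₃ := hs₂.of_frame f₃ (by decide) (by decide)
    have hi₃ : s₃.reg 10 = i := by
      rw [f₃.reg 10 (by decide), f₂.reg 10 (by decide)]; exact h₁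
    have hF₃ : RepEdges v₀ el (s₃.arr 4) F := by
      rw [f₃.arr 4 (by decide), f₂.arr 4 (by decide), f₁.arr 4 (by decide)]; exact hF
    have hX₃ : Rep (fun v => s₃.arr 9 (s₃.reg 9 + v)) X := by
      rw [f₃.arr 9 (by decide), f₂.arr 9 (by decide), f₁.arr 9 (by decide),
        f₃.reg 9 (by decide), f₂.reg 9 (by decide), f₁.reg 9 (by decide)]; exact hX
    refine (does_taint hs₃ hi₃ hF₃ hX₃ fun k hk => (h₃ k hk).2.2).seq fun s₄ f₄ h₄ => ?_
    have hs₄ := hs₃.of_frame f₄ (by decide) (by decide)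
    have h5 : Does (.set 12 (.lit 0)) 1 s₄ fun s' => s'.reg 12 = 0 :=
      Does.simple (.set 12 (.lit 0)) rfl (by simp [Prog.exec, Expr.eval])
    refine h5.seq fun s₅ f₅ h₅ => ?_
    have hs₅ := hs₄.of_frame f₅ (by decide) (by decide)
    have hX₅ : Rep (fun v => s₅.arr 9 (s₅.reg 9 + v)) X := by
      rw [f₅.arr 9 (by decide), f₄.arr 9 (by decide), f₅.reg 9 (by decide), f₄.reg 9 (by decide)]
      exact hX₃
    refine (does_seed (A := A) (st := st) hs₅ hel (i := i) ?_ hX₅ hXA hXe ?_ ?_ h₅).seq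
      fun s₆ f₆ h₆ => ?_
    · rw [f₅.reg 10 (by decide), f₄.reg 10 (by decide)]; exact hi₃
    · rw [f₅.reg 11 (by decide), f₄.reg 11 (by decide), f₃.reg 11 (by decide), f₅.table, f₄.table,
        f₃.table]
      exact h₂
    · rw [f₅.arr 10 (by decide), f₄.arr 10 (by decide)]
      rintro v ⟨k, hk, rfl | rfl⟩
      · exact (h₃ k hk).1
      · exact (h₃ k hk).2.1
    have hs₆ := hs₅.of_frame f₆ (by decide) (by decide)
    obtain ⟨L₀, hQ₀, hL₀⟩ := h₆
    have h7 : Does (.seq (.set 16 (.lit 0)) (.set 13 (.lit 0))) 2 s₆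
        fun s' => s'.reg 16 = 0 ∧ s'.reg 13 = 0 :=
      Does.simple (.seq (.set 16 (.lit 0)) (.set 13 (.lit 0))) rfl (by simp [Prog.exec, Expr.eval])
    refine h7.seq fun s₇ f₇ h₇ => ?_
    have hs₇ := hs₆.of_frame f₇ (by decide) (by decide)
    have hX₇ : Rep (fun v => s₇.arr 9 (s₇.reg 9 + v)) X := by
      rw [f₇.arr 9 (by decide), f₆.arr 9 (by decide), f₇.reg 9 (by decide), f₆.reg 9 (by decide)]
      exact hX₅
    set T : Set (Fin n) := {u | ∃ l < el.length, (edgeAt v₀ el l).1 = u ∧ edgeAt v₀ el l ∈ F ∧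
      (edgeAt v₀ el l).2 ∉ X ∧ G.owner (edgeAt v₀ el l).1 ≠ some i} with hT
    have hidx : ∀ e ∈ F, ∃ k < el.length, edgeAt v₀ el k = e := fun e he =>
      exists_edgeAt ((hel e).2 (hFe he).1)
    have hTiff : ∀ u, u ∉ T ↔ (G.owner u ≠ some i → ∀ v, (u, v) ∈ F → v ∈ X) := by
      intro u
      constructor
      · intro hu ho v hv
        obtain ⟨k, hk, hke⟩ := hidx _ hv
        by_contra hvX
        exact hu ⟨k, hk, by rw [hke], by rw [hke]; exact hv, by rw [hke]; exact hvX,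
          by rw [hke]; exact ho⟩
      · rintro hu ⟨l, hl, rfl, hlF, hlX, hlo⟩
        exact hlX (hu hlo _ hlF)
    have hLmem : ∀ v ∈ L₀, v ∈ W := fun v hv => by
      have := (hL₀ v).1 hv
      exact PathIn.base ⟨this.1, .inl this.2⟩ this.2
    refine (does_search (D := {e | e ∈ F ∧ e.1 ∈ X ∧ e.1 ∉ T}) (T := T) (L₀ := L₀) (W := W)
      (F := F) hs₇ ?_ hX₇ ?_ (fun e => Iff.rfl)
      (hQ₀.of_eq (f₇.reg 12 (by decide)) (f₇.arr 12 (by decide)) (f₇.arr 10 (by decide)))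
      h₇.1 h₇.2 hLmem (fun v hv => hXe ((hL₀ v).1 hv).1) ?_).seq fun s₈ f₈ h₈ => ?_
    · rw [f₇.arr 4 (by decide), f₆.arr 4 (by decide), f₅.arr 4 (by decide), f₄.arr 4 (by decide)]
      exact hF₃
    · rw [f₇.arr 11 (by decide), f₆.arr 11 (by decide), f₅.arr 11 (by decide)]
      exact h₄
    · rintro ⟨u, v⟩ ⟨huv, huX, huT⟩ hv
      exact PathIn.step ⟨huX, .inr ((hTiff u).1 huT)⟩ huv hv
    have hs₈ := hs₇.of_frame f₈ (by decide) (by decide)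
    obtain ⟨L, hQ, hsub, hLW, hcl⟩ := h₈
    have hLeq : ∀ v, v ∈ L ↔ v ∈ W := by
      refine fun v => ⟨hLW v, fun hv => ?_⟩
      have hp : PathIn F {u | u ∈ X ∧ (u ∈ G.Good i A st ∨
        (G.owner u ≠ some i → ∀ v, (u, v) ∈ F → v ∈ X))} (G.Good i A st) v := hv
      clear hv
      induction hp with
      | base hu hg => exact hsub ((hL₀ _).2 ⟨hu.1, hg⟩)
      | @step u v hu huv _ ih =>
        obtain ⟨k, hk, hke⟩ := hidx _ huv
        have := hcl k hk
        rw [hke] at this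
        refine this ⟨huv, hu.1, (hTiff u).2 ?_⟩ ih
        exact hu.2.resolve_left fun hg => Game.Terminal.not_mem_of_sub hFe hg.2.1 huv
    have h9 : Does (.set 14 (.lit 0)) 1 s₈ fun s' => s'.reg 14 = 0 :=
      Does.simple (.set 14 (.lit 0)) rfl (by simp [Prog.exec, Expr.eval])
    refine h9.seq fun s₉ f₉ h₉ => ?_
    have hs₉ := hs₈.of_frame f₉ (by decide) (by decide)
    have hW₉ : ∀ v ∈ ends v₀ el, s₉.arr 10 v ≠ 0 ↔ v ∈ W := by
      intro v hv
      rw [f₉.arr 10 (by decide), hQ.mark v hv, hLeq]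
    refine (does_change (W := W) hs₉ ?_ hXe hW₉ h₉).mono le_rfl fun s' f h => ⟨?_, h⟩
    · rw [f₉.arr 9 (by decide), f₈.arr 9 (by decide), f₉.reg 9 (by decide), f₈.reg 9 (by decide)]
      exact hX₇
    · rw [f.arr 10 (by decide)]
      exact hW₉
  · have c1 : worstBody.cost = 3 := rfl
    have c2 : clearBody.cost = 3 := rfl
    have c3 : taintBody.cost = 3 := rfl
    have c4 : seedBody.cost = 5 := rfl
    have c5 : searchBody.cost = 10 := rfl
    have c6 : changeBody.cost = 3 := rfl
    rw [c1, c2, c3, c4, c5, c6]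
    omega

/-- The rows of array `9` are the characteristic functions of the sets `X 0`, `X 1`, … -/
def Rows (pl : List (Fin q)) (a : ℕ → ℕ) (X : ℕ → Set (Fin n)) : Prop :=
  ∀ j < pl.length, Rep (fun v => a (j * n + v)) (X j)

theorem row_index {j j' : ℕ} {v v' : Fin n} : j * n + v = j' * n + v' ↔ j = j' ∧ v = v' := by
  constructor
  · intro h
    have hn : 0 < n := v.pos
    have h1 := congrArg (· / n) h
    simp only [Nat.mul_comm _ n, Nat.mul_add_div hn, Nat.div_eq_of_lt v.2,
      Nat.div_eq_of_lt v'.2, Nat.add_zero] at h1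
    subst h1
    exact ⟨rfl, Fin.ext (Nat.add_left_cancel h)⟩
  · rintro ⟨rfl, rfl⟩; rfl

/-- The body of the loop that copies array `a` to the current row of array `9`. -/
def copyBody (a : ℕ) : Prog :=
  .seq (.put 9 (.add (.reg 9) srcE) (.get a srcE)) (.put 9 (.add (.reg 9) tgtE) (.get a tgtE))

theorem does_copy (a : ℕ) (ha9 : a ≠ 9) {Z : Set (Fin n)} (hs : Static G v₀ el pl s) {j : ℕ}
    (h9 : s.reg 9 = j * n) (hX : Rows pl (s.arr 9) X)
    (hXe : X j ⊆ ends v₀ el) (hZ : ∀ v ∈ ends v₀ el, s.arr a v ≠ 0 ↔ v ∈ Z)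
    (hZe : Z ⊆ ends v₀ el) :
    Does (copyBody a).forEdges (4 * el.length + 2) s fun s' =>
      Rows pl (s'.arr 9) (Function.update X j Z) := by
  have hwr : (copyBody a).forEdges.wreg = [5, 5] := rfl
  have hwa : (copyBody a).forEdges.warr = [9, 9] := rfl
  refine (Does.forEdges hs.len rfl (by simp [copyBody, Prog.wreg]) (by simp [copyBody, Prog.wreg])
    (fun e s' => ∀ j' < pl.length, ∀ v : Fin n, s'.arr 9 (j' * n + v) ≠ 0 ↔
      (v ∈ if j' = j ∧ ∃ k < e, (edgeAt v₀ el k).1 = v ∨ (edgeAt v₀ el k).2 = v then Z else X j'))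
    (by simpa [Rows, Rep] using hX) ?_).mono le_rfl ?_
  · intro e s' he hf h5 hJ s'' ha hr ht j' hj' v
    have hs' := hs.of_frame hf (by rw [hwr]; decide) (by rw [hwa]; decide)
    have h1 := hs'.src e he
    have h2 := hs'.tgt e he
    have hr9 : s'.reg 9 = j * n := by rw [hf.reg 9 (by rw [hwr]; decide)]; exact h9
    have hra : s'.arr a = s.arr a := hf.arr a (by rw [hwa]; simpa using ha9)
    have hnew : s''.arr 9 = Function.update (Function.update (s'.arr 9)
        (j * n + (edgeAt v₀ el e).1) (s.arr a (edgeAt v₀ el e).1))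
        (j * n + (edgeAt v₀ el e).2) (s.arr a (edgeAt v₀ el e).2) := by
      simp [ha, copyBody, Prog.exec, Expr.eval, h5, h1, h2, hr9, hra, ha9]
    rw [hnew]
    simp only [Function.update_apply, row_index]
    by_cases hjj : j' = j
    · subst hjj
      simp only [true_and]
      by_cases hv2 : v = (edgeAt v₀ el e).2
      · subst hv2
        rw [if_pos rfl, if_pos ⟨e, Nat.lt_succ_self e, .inr rfl⟩]
        exact hZ _ (tgt_mem_ends he)
      · rw [if_neg hv2]
        by_cases hv1 : v = (edgeAt v₀ el e).1
        · subst hv1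
          rw [if_pos rfl, if_pos ⟨e, Nat.lt_succ_self e, .inl rfl⟩]
          exact hZ _ (src_mem_ends he)
        · rw [if_neg hv1, hJ j' hj' v]
          have : (∃ k < e, (edgeAt v₀ el k).1 = v ∨ (edgeAt v₀ el k).2 = v) ↔
              ∃ k < e + 1, (edgeAt v₀ el k).1 = v ∨ (edgeAt v₀ el k).2 = v := by
            refine ⟨fun ⟨k, hk, h⟩ => ⟨k, Nat.lt_succ_of_lt hk, h⟩, fun ⟨k, hk, h⟩ => ?_⟩
            rcases Nat.lt_succ_iff_lt_or_eq.1 hk with hk' | rfl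
            · exact ⟨k, hk', h⟩
            · exact (h.elim (fun h => hv1 h.symm) (fun h => hv2 h.symm)).elim
          simp only [true_and, this]
    · have := hJ j' hj' v
      simpa [hjj] using this
  · intro s' _ hJ j' hj' v
    refine (hJ j' hj' v).trans ?_
    by_cases hjj : j' = j
    · subst hjj
      rw [Function.update_self]
      by_cases hv : v ∈ ends v₀ el
      · rw [if_pos ⟨rfl, hv⟩]
      · rw [if_neg fun h => hv h.2]
        exact ⟨fun h => absurd (hXe h) hv, fun h => absurd (hZe h) hv⟩
    · rw [Function.update_of_ne hjj, if_neg fun h => hjj h.1]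

/-- Copy array `5` to all the rows of array `9`. -/
def rowsProg : Prog :=
  .seq (.seq (.set 8 (.lit 0)) (.set 9 (.lit 0))) (.loop (.not (.le (.reg 3) (.reg 8)))
    (.seq (copyBody 5).forEdges
      (.seq (.set 8 (.add (.reg 8) (.lit 1))) (.set 9 (.add (.reg 9) (.reg 0))))))

theorem does_rows (hs : Static G v₀ el pl s) (hX : Rows pl (s.arr 9) X)
    (hXe : ∀ j < pl.length, X j ⊆ ends v₀ el) (hA : Rep (s.arr 5) A) (hAe : A ⊆ ends v₀ el) :
    Does rowsProg (5 * (el.length + 1) * pl.length + 3) s fun s' =>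
      Rows pl (s'.arr 9) fun _ => A := by
  have h1 : Does (.seq (.set 8 (.lit 0)) (.set 9 (.lit 0))) 2 s
      fun s' => s'.reg 8 = 0 ∧ s'.reg 9 = 0 :=
    Does.simple (.seq (.set 8 (.lit 0)) (.set 9 (.lit 0))) rfl (by simp [Prog.exec, Expr.eval])
  refine (h1.seq (T' := 5 * (el.length + 1) * pl.length + 1) fun s₁ f₁ h₁ => ?_).mono (by omega)
    fun _ _ h => h
  have hs₁ := hs.of_frame f₁ (by decide) (by decide)
  refine (Does.loop (fun φ s' => ∃ j ≤ pl.length, s'.reg 8 = j ∧ s'.reg 9 = j * n ∧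
    Rows pl (s'.arr 9) (fun j' => if j' < j then A else X j') ∧
    5 * (el.length + 1) * (pl.length - j) ≤ φ) ?_ ⟨0, Nat.zero_le _, h₁.1, by simp [h₁.2], ?_,
      by simp⟩).mono le_rfl ?_
  · rintro φ s' hf ⟨j, hj, h8, h9, hrows, hφ⟩ hb
    have hs' := hs₁.of_frame hf (by decide) (by decide)
    have hlt : j < pl.length := by simpa [Test.Holds, Expr.eval, h8, hs'.plen] using hb
    refine ⟨_, (does_copy 5 (by decide) (Z := A) hs' h9 hrows ?_ ?_ hAe).seq (T' := 2)
      fun s₂ f₂ h₂ => ?_⟩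
    · simpa using hXe j hlt
    · rw [hf.arr 5 (by decide), f₁.arr 5 (by decide)]
      exact fun v _ => hA v
    have hs₂ := hs'.of_frame f₂ (by decide) (by decide)
    refine Does.simple (.seq (.set 8 (.add (.reg 8) (.lit 1))) (.set 9 (.add (.reg 9) (.reg 0))))
      rfl ⟨5 * (el.length + 1) * (pl.length - (j + 1)), ⟨j + 1, hlt, ?_, ?_, ?_, le_rfl⟩, ?_⟩
    · simp [Prog.exec, Expr.eval, f₂.reg 8 (by decide), h8]
    · simp [Prog.exec, Expr.eval, f₂.reg 9 (by decide), h9, hs₂.size, Nat.succ_mul]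
    · intro j' hj'
      have h₃ : Rep (fun v => s₂.arr 9 (j' * n + v))
          (Function.update (fun j' => if j' < j then A else X j') j A j') := h₂ j' hj'
      have h₄ : (if j' < j + 1 then A else X j') =
          Function.update (fun j' => if j' < j then A else X j') j A j' := ?_
      · rw [← h₄] at h₃
        exact h₃
      by_cases hjj : j' = j
      · subst hjj; simp
      · rw [Function.update_of_ne hjj]
        simp only [Nat.lt_succ_iff_lt_or_eq, hjj, or_false]
    · refine le_trans ?_ hφ
      obtain ⟨k, hk⟩ := Nat.exists_eq_add_of_lt hlt
      have e1 : pl.length - (j + 1) = k := by omega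
      have e2 : pl.length - j = k + 1 := by omega
      rw [e1, e2, Nat.mul_add _ k 1]
      omega
  · rw [f₁.arr 9 (by decide)]
    simpa using hX
  · rintro s' hf ⟨⟨φ, j, hj, h8, -, hrows, -⟩, hb⟩
    have hs' := hs₁.of_frame hf (by decide) (by decide)
    have hge : pl.length ≤ j := by simpa [Test.Holds, Expr.eval, h8, hs'.plen] using hb
    intro j' hj'
    have h₃ := hrows j' hj'
    simp only [if_pos (show j' < j by omega)] at h₃
    exact h₃

end Rows

/-! ### Sweeps over the pessimists -/

section Sweep

variable {n q : ℕ} {G : Game (Fin n) (Fin q)} {v₀ : Fin n} {el : List (Fin n × Fin n)}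
  {pl : List (Fin q)} {P : Set (Fin q)} {F : Set (Fin n × Fin n)} {A : Set (Fin n)}
  {X : ℕ → Set (Fin n)} {st : Prop} {d j : ℕ} {s : State}

variable (G v₀ el pl P) in
/-- The state of the elimination process as represented in the memory: the remaining edges are
marked in array `4`, the live vertices in array `5`. -/
structure Core (A : Set (Fin n)) (F : Set (Fin n × Fin n)) (st : Prop) (s : State) : Prop
    extends Static G v₀ el pl s where
  edges : RepEdges v₀ el (s.arr 4) F
  live : Rep (s.arr 5) A
  started : s.reg 15 ≠ 0 ↔ st
  inv : G.Inv v₀ P A F st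
  live_ends : A ⊆ ends v₀ el

theorem Core.of_frame {c : Prog} {s' : State} (h : Core G v₀ el pl P A F st s) (hf : Frame c s s')
    (hr : ∀ x ∈ [0, 2, 3, 4, 15], x ∉ c.wreg)
    (ha : ∀ a ∈ [0, 1, 2, 3, 4, 5, 6, 7, 8], a ∉ c.warr) : Core G v₀ el pl P A F st s' := by
  refine ⟨h.toStatic.of_frame hf (fun x hx => hr x ?_) fun a hx => ha a ?_, ?_, ?_, ?_,
    h.inv, h.live_ends⟩
  · simp only [List.mem_cons, List.not_mem_nil, or_false] at hx ⊢; omega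
  · simp only [List.mem_cons, List.not_mem_nil, or_false] at hx ⊢; omega
  · rw [hf.arr 4 (ha 4 (by simp))]; exact h.edges
  · rw [hf.arr 5 (ha 5 (by simp))]; exact h.live
  · rw [hf.reg 15 (hr 15 (by simp))]; exact h.started

variable (G pl) in
/-- The rows bound the `Win` sets of the pessimists from above. -/
def Sound (A : Set (Fin n)) (F : Set (Fin n × Fin n)) (st : Prop) (X : ℕ → Set (Fin n)) : Prop :=
  ∀ (j : ℕ) (hj : j < pl.length), X j ⊆ A ∧ ∀ S, G.Win pl[j] A F st S → S ⊆ X j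

variable (G v₀ el pl P) in
/-- The invariant of a sweep that has treated the first `j` pessimists, after `d` sweeps without an
elimination. Register `7` tells whether a pessimist has been found who can win from `v₀`, and
register `6` whether another sweep is needed. Each row that still contains `v₀` has lost a
vertex in every sweep. -/
structure SweepInv (A : Set (Fin n)) (F : Set (Fin n × Fin n)) (st : Prop) (d j : ℕ)
    (X : ℕ → Set (Fin n)) (s : State) : Prop where
  idx : s.reg 8 = j
  off : s.reg 9 = j * n
  rows : Rows pl (s.arr 9) X
  sound : Sound G pl A F st X
  go : s.reg 6 ≠ 0 → d + 1 ≤ A.ncard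
  quiet : s.reg 7 = 0 → s.reg 6 = 0 → ∀ j' < j, v₀ ∉ X j'
  shrunk : s.reg 7 = 0 → ∀ j' < pl.length, v₀ ∈ X j' →
    (X j').ncard + (if j' < j then d + 1 else d) ≤ A.ncard
  found : s.reg 7 ≠ 0 → s.reg 6 ≠ 0 ∧ ∃ i ∈ P, ∃ W, G.Win i A F st W ∧ v₀ ∈ W ∧
    (∀ S, G.Win i A F st S → S ⊆ W) ∧ (∀ v ∈ ends v₀ el, s.arr 10 v ≠ 0 ↔ v ∈ W) ∧
    W.ncard + d ≤ A.ncard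

/-- Treat the next pessimist: perform a round if this pessimist may win from `v₀`. If the row does
not change, then it is the largest `Win` set; otherwise it is updated. -/
def stepProg : Prog :=
  .seq (.ite (.and (.isZero (.reg 7)) (.nonzero (.get 9 (.add (.reg 9) (.reg 4)))))
      (.seq roundProg (.ite (.nonzero (.reg 14))
        (.seq (copyBody 10).forEdges (.set 6 (.lit 1)))
        (.seq (.set 7 (.lit 1)) (.set 6 (.lit 1))))) .skip)
    (.seq (.set 8 (.add (.reg 8) (.lit 1))) (.set 9 (.add (.reg 9) (.reg 0))))

theorem does_step (hc : Core G v₀ el pl P A F st s) (hel : ∀ e, e ∈ el ↔ e ∈ G.edges)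
    (hpl : ∀ i ∈ pl, i ∈ P) (hj : j < pl.length) (h : SweepInv G v₀ el pl P A F st d j X s) :
    Does stepProg (210 * (el.length + 1)) s
      fun s' => ∃ X', SweepInv G v₀ el pl P A F st d (j + 1) X' s' := by
  have hrow : Rep (fun v => s.arr 9 (s.reg 9 + v)) (X j) := by
    rw [h.off]; exact h.rows j hj
  obtain ⟨hXA, hXs⟩ := h.sound j hj
  have hfin : ∀ S : Set (Fin n), S.Finite := fun S => S.toFinite
  -- the invariant before the index is advanced
  have key : Does (.ite (.and (.isZero (.reg 7)) (.nonzero (.get 9 (.add (.reg 9) (.reg 4)))))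
      (.seq roundProg (.ite (.nonzero (.reg 14))
        (.seq (copyBody 10).forEdges (.set 6 (.lit 1)))
        (.seq (.set 7 (.lit 1)) (.set 6 (.lit 1))))) .skip)
      (200 * (el.length + 1) + (4 * el.length + 3 + 1) + 1) s fun s' => s'.reg 8 = j ∧
        s'.reg 9 = j * n ∧ s'.reg 0 = n ∧ ∃ X', SweepInv G v₀ el pl P A F st d (j + 1) X'
          { s' with reg := Function.update (Function.update s'.reg 8 (j + 1)) 9 ((j + 1) * n) } := by
    refine Does.ite ?_ ?_
    · intro hb
      simp only [Test.Holds, Expr.eval, Nat.le_zero, hc.init] at hb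
      have hv : v₀ ∈ X j := (hrow v₀).1 hb.2
      have hsh := h.shrunk hb.1 j hj hv
      rw [if_neg (lt_irrefl j)] at hsh
      have hpos : 0 < (X j).ncard := (Set.ncard_pos (hfin _)).2 ⟨_, hv⟩
      refine (does_round hc.toStatic hel hc.inv.sub hj h.idx hc.live hc.live_ends hc.started
        hc.edges hrow hXA).seq fun s₁ f₁ h₁ => ?_
      have hs₁ := hc.toStatic.of_frame f₁ (by decide) (by decide)
      have hXe : X j ⊆ ends v₀ el := hXA.trans hc.live_ends
      have hAtt := Game.Att_subset (G := G) (i := pl[j]) (A := A) (F := F) (st := st) (X j)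
      have h8 : s₁.reg 8 = j := (f₁.reg 8 (by decide)).trans h.idx
      have h9 : s₁.reg 9 = j * n := (f₁.reg 9 (by decide)).trans h.off
      have h7 : s₁.reg 7 = 0 := (f₁.reg 7 (by decide)).trans hb.1
      have hrows₁ : Rows pl (s₁.arr 9) X := by
        rw [f₁.arr 9 (by decide)]; exact h.rows
      refine Does.ite ?_ ?_
      · intro h14
        have hne : ¬ X j ⊆ G.Att pl[j] A F st (X j) := by
          intro hsub
          exact (by simpa [Test.Holds, Expr.eval] using h14 : s₁.reg 14 ≠ 0) (h₁.2.2 hsub)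
        have hlt : (G.Att pl[j] A F st (X j)).ncard < (X j).ncard :=
          Set.ncard_lt_ncard ⟨hAtt, hne⟩ (hfin _)
        refine ((does_copy 10 (by decide) hs₁ h9 hrows₁ hXe h₁.1 (hAtt.trans hXe)).seq (T' := 1)
          fun s₂ f₂ h₂ => ?_).mono (by omega) fun _ _ h => h
        have h8₂ : s₂.reg 8 = j := (f₂.reg 8 (by decide)).trans h8
        have h9₂ : s₂.reg 9 = j * n := (f₂.reg 9 (by decide)).trans h9
        have h7₂ : s₂.reg 7 = 0 := (f₂.reg 7 (by decide)).trans h7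
        have h0₂ : s₂.reg 0 = n := (hs₁.of_frame f₂ (by decide) (by decide)).size
        refine Does.simple (.set 6 (.lit 1)) rfl ⟨?_, ?_, ?_, _, ⟨?_, ?_, h₂, ?_, ?_, ?_, ?_, ?_⟩⟩
        · simp [Prog.exec, h8₂]
        · simp [Prog.exec, h9₂]
        · simp [Prog.exec, h0₂]
        · simp
        · simp
        · intro j' hj'
          by_cases hjj : j' = j
          · subst hjj
            rw [Function.update_self]
            exact ⟨hAtt.trans hXA, fun S hS => hS.subset_Att (hXs S hS)⟩
          · rw [Function.update_of_ne hjj]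
            exact h.sound j' hj'
        · intro _
          omega
        · simp [Prog.exec, Expr.eval]
        · intro _ j' hj' hv'
          by_cases hjj : j' = j
          · subst hjj
            rw [Function.update_self, if_pos (Nat.lt_succ_self _)]
            omega
          · rw [Function.update_of_ne hjj] at hv' ⊢
            have := h.shrunk hb.1 j' hj' hv'
            have e1 : j' < j + 1 ↔ j' < j := by omega
            simpa only [e1] using this
        · intro hc'
          simp [Prog.exec, h7₂] at hc'
      · intro h14
        have hsub : X j ⊆ G.Att pl[j] A F st (X j) :=
          h₁.2.1 (by simpa [Test.Holds, Expr.eval] using h14)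
        have heq := Set.Subset.antisymm hsub hAtt
        refine (Does.simple (.seq (.set 7 (.lit 1)) (.set 6 (.lit 1))) rfl
          ⟨?_, ?_, ?_, X, ⟨?_, ?_, ?_, h.sound, ?_, ?_, ?_, ?_⟩⟩).mono
          (by simp only [Prog.cost]; omega) fun _ _ h => h
        · simp [Prog.exec, h8]
        · simp [Prog.exec, h9]
        · simp [Prog.exec, hs₁.size]
        · simp
        · simp
        · exact hrows₁
        · intro _
          omega
        · simp [Prog.exec, Expr.eval]
        · simp [Prog.exec, Expr.eval]
        · intro _
          refine ⟨by simp [Prog.exec, Expr.eval], pl[j], hpl _ (List.getElem_mem hj), X j,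
            Game.Win.of_Att_eq hc.inv.sub hXA hsub, hv, hXs, ?_, hsh⟩
          have := h₁.1
          rw [← heq] at this
          exact this
    · intro hb
      simp only [Test.Holds, Expr.eval, Nat.le_zero, hc.init] at hb
      have hv : s.reg 7 = 0 → v₀ ∉ X j := fun h7 hv => hb ⟨h7, (hrow v₀).2 hv⟩
      refine (Does.simple .skip rfl
          ⟨h.idx, h.off, hc.size, X, ⟨?_, ?_, h.rows, h.sound, ?_, ?_, ?_, ?_⟩⟩).mono
          (by simp only [Prog.cost]; omega) fun _ _ h => h
      · simp
      · simp
      · simpa [Prog.exec] using h.go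
      · intro h7 h6 j' hj'
        have h7' : s.reg 7 = 0 := by simpa [Prog.exec] using h7
        have h6' : s.reg 6 = 0 := by simpa [Prog.exec] using h6
        rcases Nat.lt_succ_iff_lt_or_eq.1 hj' with hj' | rfl
        · exact h.quiet h7' h6' j' hj'
        · exact hv h7'
      · intro h7 j' hj' hv'
        have h7' : s.reg 7 = 0 := by simpa [Prog.exec] using h7
        have := h.shrunk h7' j' hj' hv'
        by_cases hjj : j' = j
        · subst hjj; exact absurd hv' (hv h7')
        · have e1 : j' < j + 1 ↔ j' < j := by omega
          simpa only [e1] using this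
      · intro h7
        have h7' : s.reg 7 ≠ 0 := by simpa [Prog.exec] using h7
        simpa [Prog.exec] using h.found h7'
  refine (key.seq (T' := 2) fun s₁ f₁ h₁ => ?_).mono (by omega) fun _ _ h => h
  obtain ⟨h8, h9, h0, X', hX'⟩ := h₁
  refine Does.simple (.seq (.set 8 (.add (.reg 8) (.lit 1))) (.set 9 (.add (.reg 9) (.reg 0))))
    rfl ⟨X', ?_⟩
  simpa [Prog.exec, Expr.eval, h8, h9, h0, Nat.succ_mul] using hX'

end Sweep

/-! ### Eliminations and the main loop -/

section Main

variable {n q : ℕ} {G : Game (Fin n) (Fin q)} {v₀ : Fin n} {el : List (Fin n × Fin n)}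
  {pl : List (Fin q)} {P : Set (Fin q)} {F : Set (Fin n × Fin n)} {A : Set (Fin n)}
  {X : ℕ → Set (Fin n)} {st : Prop} {d j : ℕ} {s : State} {i : Fin q}

/-- The body of the loop that removes the edges leaving the set `W` marked in array `10`, and the
live vertices outside `W`. -/
def elimBody : Prog :=
  .seq (.ite (.and (.nonzero (.get 10 srcE)) (.isZero (.get 10 tgtE)))
      (.put 4 (.reg 5) (.lit 0)) .skip)
    (.seq (.put 5 srcE (.get 10 srcE)) (.put 5 tgtE (.get 10 tgtE)))

/-- The elimination step for a set `W` marked in array `10`. -/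
def elimProg : Prog :=
  .seq (.set 15 (.lit 1)) (.seq elimBody.forEdges rowsProg)

theorem does_elimBody (hs : Static G v₀ el pl s) (hF : RepEdges v₀ el (s.arr 4) F)
    (hA : Rep (s.arr 5) A) (hAe : A ⊆ ends v₀ el) {W : Set (Fin n)} (hWe : W ⊆ ends v₀ el)
    (hW : ∀ v ∈ ends v₀ el, s.arr 10 v ≠ 0 ↔ v ∈ W) :
    Does elimBody.forEdges ((elimBody.cost + 2) * el.length + 2) s fun s' =>
      RepEdges v₀ el (s'.arr 4) (F \ {e | e.1 ∈ W ∧ e.2 ∉ W}) ∧ Rep (s'.arr 5) W := by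
  refine (Does.forEdges hs.len rfl (by decide) (by decide) (fun e s' =>
    (∀ k < el.length, s'.arr 4 k ≠ 0 ↔ edgeAt v₀ el k ∈ F ∧
      ¬ (k < e ∧ (edgeAt v₀ el k).1 ∈ W ∧ (edgeAt v₀ el k).2 ∉ W)) ∧
    ∀ v : Fin n, s'.arr 5 v ≠ 0 ↔
      (v ∈ if ∃ k < e, (edgeAt v₀ el k).1 = v ∨ (edgeAt v₀ el k).2 = v then W else A))
    ⟨?_, ?_⟩ ?_).mono le_rfl ?_
  · intro k hk
    simpa using hF k hk
  · intro v
    simpa using hA v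
  · rintro e s' he hf h5 ⟨hJ, hJ'⟩ s'' ha hr ht
    have hs' := hs.of_frame hf (by decide) (by decide)
    have h1 := hs'.src e he
    have h2 := hs'.tgt e he
    have h10 : s'.arr 10 = s.arr 10 := hf.arr 10 (by decide)
    have hW1 := hW _ (src_mem_ends (v₀ := v₀) he)
    have hW2 := hW _ (tgt_mem_ends (v₀ := v₀) he)
    constructor
    · intro k hk
      by_cases hc : (edgeAt v₀ el e).1 ∈ W ∧ (edgeAt v₀ el e).2 ∉ W
      · have h4 : s''.arr 4 = Function.update (s'.arr 4) e 0 := by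
          have hb : s.arr 10 (edgeAt v₀ el e).2 = 0 := by
            by_contra h; exact hc.2 (hW2.1 h)
          simp [ha, elimBody, Prog.exec, Expr.eval, Test.Holds, h5, h1, h2, h10, hW1.2 hc.1, hb]
        rw [h4, Function.update_apply]
        split_ifs with hke
        · subst hke
          exact ⟨fun h => absurd rfl h, fun h => absurd ⟨Nat.lt_succ_self k, hc⟩ h.2⟩
        · have e1 : k < e + 1 ↔ k < e := by omega
          rw [hJ k hk, e1]
      · have h4 : s''.arr 4 = s'.arr 4 := by
          have hb : ¬ (s.arr 10 (edgeAt v₀ el e).1 ≠ 0 ∧ s.arr 10 (edgeAt v₀ el e).2 = 0) :=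
            fun h => hc ⟨hW1.1 h.1, fun hw => hW2.2 hw h.2⟩
          have hb' : ¬ ((Test.nonzero (.get 10 srcE)).and (.isZero (.get 10 tgtE))).Holds s' := by
            simpa only [Test.Holds, Expr.eval, h5, h1, h2, h10, Nat.le_zero] using hb
          simp only [ha, elimBody, Prog.exec, if_neg hb']
          simp
        rw [h4, hJ k hk]
        refine and_congr_right fun _ => not_congr ⟨fun h => ⟨by omega, h.2⟩, fun h => ?_⟩
        rcases Nat.lt_succ_iff_lt_or_eq.1 h.1 with hk' | rfl
        · exact ⟨hk', h.2⟩
        · exact absurd h.2 hc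
    · intro v
      have h5' : s''.arr 5 = Function.update (Function.update (s'.arr 5) (edgeAt v₀ el e).1
          (s.arr 10 (edgeAt v₀ el e).1)) (edgeAt v₀ el e).2 (s.arr 10 (edgeAt v₀ el e).2) := by
        by_cases hb : ((Test.nonzero (.get 10 srcE)).and (.isZero (.get 10 tgtE))).Holds s'
        · simp only [ha, elimBody, Prog.exec, if_pos hb]
          simp [Expr.eval, h5, h1, h2, h10]
        · simp only [ha, elimBody, Prog.exec, if_neg hb]
          simp [Expr.eval, h5, h1, h2, h10]
      rw [h5']
      simp only [Function.update_apply, Fin.val_inj]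
      by_cases hv2 : v = (edgeAt v₀ el e).2
      · subst hv2
        rw [if_pos rfl, if_pos ⟨e, Nat.lt_succ_self e, .inr rfl⟩]
        exact hW2
      · rw [if_neg hv2]
        by_cases hv1 : v = (edgeAt v₀ el e).1
        · subst hv1
          rw [if_pos rfl, if_pos ⟨e, Nat.lt_succ_self e, .inl rfl⟩]
          exact hW1
        · rw [if_neg hv1, hJ' v]
          have : (∃ k < e, (edgeAt v₀ el k).1 = v ∨ (edgeAt v₀ el k).2 = v) ↔
              ∃ k < e + 1, (edgeAt v₀ el k).1 = v ∨ (edgeAt v₀ el k).2 = v := by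
            refine ⟨fun ⟨k, hk, h⟩ => ⟨k, Nat.lt_succ_of_lt hk, h⟩, fun ⟨k, hk, h⟩ => ?_⟩
            rcases Nat.lt_succ_iff_lt_or_eq.1 hk with hk' | rfl
            · exact ⟨k, hk', h⟩
            · exact (h.elim (fun h => hv1 h.symm) (fun h => hv2 h.symm)).elim
          simp only [this]
  · rintro s' - ⟨hJ, hJ'⟩
    refine ⟨fun k hk => (hJ k hk).trans ?_, fun v => (hJ' v).trans ?_⟩
    · exact and_congr_right fun _ => not_congr ⟨fun h => h.2, fun h => ⟨hk, h⟩⟩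
    · by_cases hv : v ∈ ends v₀ el
      · have hv' : ∃ k < el.length, (edgeAt v₀ el k).1 = v ∨ (edgeAt v₀ el k).2 = v := hv
        rw [if_pos hv']
      · have hv' : ¬ ∃ k < el.length, (edgeAt v₀ el k).1 = v ∨ (edgeAt v₀ el k).2 = v := hv
        rw [if_neg hv']
        exact ⟨fun h => absurd (hAe h) hv, fun h => absurd (hWe h) hv⟩

variable (G v₀ el pl P) in
/-- The state between two sweeps, `d` sweeps after the last elimination. -/
structure BetweenInv (A : Set (Fin n)) (F : Set (Fin n × Fin n)) (st : Prop) (d : ℕ)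
    (X : ℕ → Set (Fin n)) (s : State) : Prop extends Core G v₀ el pl P A F st s where
  rows : Rows pl (s.arr 9) X
  sound : Sound G pl A F st X
  shrunk : ∀ j < pl.length, v₀ ∈ X j → (X j).ncard + d ≤ A.ncard
  le : d ≤ A.ncard

/-- After the elimination, the search for `Win` sets starts again with all the live vertices. -/
theorem does_elim (hc : Core G v₀ el pl P A F st s) (hi : i ∈ P) (hX : Rows pl (s.arr 9) X)
    (hXA : ∀ j < pl.length, X j ⊆ A) {W : Set (Fin n)} (hW : G.Win i A F st W)
    (hv : v₀ ∈ W) (hmax : ∀ S, G.Win i A F st S → S ⊆ W)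
    (hrep : ∀ v ∈ ends v₀ el, s.arr 10 v ≠ 0 ↔ v ∈ W) :
    Does elimProg (8 * (el.length + 1) + 5 * (el.length + 1) * pl.length) s
      (BetweenInv G v₀ el pl P W (F \ {e | e.1 ∈ W ∧ e.2 ∉ W}) True 0 fun _ => W) := by
  have hWe := hW.1.trans hc.live_ends
  have h1 : Does (.set 15 (.lit 1)) 1 s fun s' => s'.reg 15 = 1 :=
    Does.simple (.set 15 (.lit 1)) rfl (by simp [Prog.exec, Expr.eval])
  refine (h1.seq (T' := (elimBody.cost + 2) * el.length + 2 +
    (5 * (el.length + 1) * pl.length + 3)) fun s₁ f₁ h₁ => ?_).mono ?_ fun _ _ h => h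
  · have hs₁ := hc.toStatic.of_frame f₁ (by decide) (by decide)
    refine (does_elimBody (A := A) (F := F) hs₁ ?_ ?_ hc.live_ends hWe ?_).seq fun s₂ f₂ h₂ => ?_
    · rw [f₁.arr 4 (by decide)]; exact hc.edges
    · rw [f₁.arr 5 (by decide)]; exact hc.live
    · rw [f₁.arr 10 (by decide)]; exact hrep
    have hs₂ := hs₁.of_frame f₂ (by decide) (by decide)
    refine (does_rows hs₂ (X := X) ?_ (fun j hj => (hXA j hj).trans hc.live_ends) h₂.2 hWe).mono
      le_rfl fun s₃ f₃ h₃ => ?_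
    · rw [f₂.arr 9 (by decide), f₁.arr 9 (by decide)]; exact hX
    refine ⟨⟨hs₂.of_frame f₃ (by decide) (by decide), ?_, ?_, ?_, hc.inv.elim hi hW hv hmax, hWe⟩,
      h₃, fun j hj => ⟨subset_rfl, fun S hS => hS.1⟩, fun _ _ _ => le_rfl, Nat.zero_le _⟩
    · rw [f₃.arr 4 (by decide)]; exact h₂.1
    · rw [f₃.arr 5 (by decide)]; exact h₂.2
    · rw [f₃.reg 15 (by decide), f₂.reg 15 (by decide), h₁]; simp
  · have c1 : elimBody.cost = 5 := rfl
    rw [c1]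
    omega

/-- A sweep over the pessimists, followed by an elimination if one of them can win. -/
def sweepProg : Prog :=
  .seq (.seq (.seq (.set 6 (.lit 0)) (.set 7 (.lit 0))) (.seq (.set 8 (.lit 0)) (.set 9 (.lit 0))))
    (.seq (.loop (.not (.le (.reg 3) (.reg 8))) stepProg) (.ite (.nonzero (.reg 7)) elimProg .skip))

open Classical in
/-- A bound for the number of sweeps that may still follow. A sweep without an elimination increases
`d`. A sweep with an elimination replaces `A` by a set of at most `A.ncard - d` vertices and resets
`d`; that it also decreases the potential is due to the coefficient `2`, if the elimination removes
a vertex, and to the second summand, if it is the first one. -/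
noncomputable def potential (A : Set (Fin n)) (st : Prop) (d : ℕ) : ℕ :=
  2 * A.ncard + (if st then 1 else 3) - d

/-- If register `6` asks for another sweep, then the potential has decreased; otherwise the process
is in a final state. -/
theorem does_sweep (h : BetweenInv G v₀ el pl P A F st d X s)
    (hel : ∀ e, e ∈ el ↔ e ∈ G.edges) (hpl : ∀ i ∈ pl, i ∈ P) :
    Does sweepProg (399 * ((el.length + 1) * (pl.length + 1))) s fun s' =>
      ∃ A' F' st' d' X', BetweenInv G v₀ el pl P A' F' st' d' X' s' ∧
        (s'.reg 6 ≠ 0 → potential A' st' d' + 1 ≤ potential A st d) ∧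
        (s'.reg 6 = 0 → ∀ j < pl.length, v₀ ∉ X' j) := by
  have h1 : Does (.seq (.seq (.set 6 (.lit 0)) (.set 7 (.lit 0)))
      (.seq (.set 8 (.lit 0)) (.set 9 (.lit 0)))) 4 s
      fun s' => s'.reg 6 = 0 ∧ s'.reg 7 = 0 ∧ s'.reg 8 = 0 ∧ s'.reg 9 = 0 :=
    Does.simple (.seq (.seq (.set 6 (.lit 0)) (.set 7 (.lit 0)))
      (.seq (.set 8 (.lit 0)) (.set 9 (.lit 0)))) rfl (by simp [Prog.exec, Expr.eval])
  refine (h1.seq (T' := 211 * (el.length + 1) * pl.length + 1 +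
    (8 * (el.length + 1) + 5 * (el.length + 1) * pl.length + 1)) fun s₁ f₁ h₁ => ?_).mono ?_
    fun _ _ h => h
  · have hc₁ : Core G v₀ el pl P A F st s₁ := h.toCore.of_frame f₁ (by decide) (by decide)
    have hinit : SweepInv G v₀ el pl P A F st d 0 X s₁ := by
      refine ⟨h₁.2.2.1, by simp [h₁.2.2.2], ?_, h.sound, fun hc => absurd h₁.1 hc,
        fun _ _ j' hj' => absurd hj' (Nat.not_lt_zero j'), fun _ j' hj' hv => ?_,
        fun hc => absurd h₁.2.1 hc⟩
      · rw [f₁.arr 9 (by decide)]; exact h.rows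
      · rw [if_neg (Nat.not_lt_zero j')]; exact h.shrunk j' hj' hv
    have h2 := Does.loop (b := .not (.le (.reg 3) (.reg 8))) (c := stepProg) (s := s₁)
      (fun φ s' => ∃ j ≤ pl.length, ∃ X', SweepInv G v₀ el pl P A F st d j X' s' ∧
        211 * (el.length + 1) * (pl.length - j) ≤ φ)
      (by
        rintro φ s' hf ⟨j, hj, X', hX', hφ⟩ hb
        have hc' : Core G v₀ el pl P A F st s' := hc₁.of_frame hf (by decide) (by decide)
        have hlt : j < pl.length := by simpa [Test.Holds, Expr.eval, hX'.idx, hc'.plen] using hb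
        refine ⟨_, (does_step hc' hel hpl hlt hX').mono le_rfl fun s'' _ ⟨X'', hX''⟩ =>
          ⟨211 * (el.length + 1) * (pl.length - (j + 1)), ⟨j + 1, hlt, X'', hX'', le_rfl⟩, ?_⟩⟩
        refine le_trans ?_ hφ
        obtain ⟨k, hk⟩ := Nat.exists_eq_add_of_lt hlt
        have e1 : pl.length - (j + 1) = k := by omega
        have e2 : pl.length - j = k + 1 := by omega
        rw [e1, e2, Nat.mul_add _ k 1]
        omega)
      (φ := 211 * (el.length + 1) * pl.length) ⟨0, Nat.zero_le _, X, hinit, by simp⟩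
    refine h2.seq fun s₂ f₂ h₂ => ?_
    obtain ⟨⟨φ, j, hj, X', hX', -⟩, hb⟩ := h₂
    have hc₂ : Core G v₀ el pl P A F st s₂ := hc₁.of_frame f₂ (by decide) (by decide)
    have hjp : j = pl.length := by
      have : pl.length ≤ j := by simpa [Test.Holds, Expr.eval, hX'.idx, hc₂.plen] using hb
      omega
    subst hjp
    refine Does.ite ?_ ?_
    · intro h7
      have h7' : s₂.reg 7 ≠ 0 := by simpa [Test.Holds, Expr.eval] using h7
      obtain ⟨h6, i, hi, W, hW, hv, hmax, hrep, hcard⟩ := hX'.found h7'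
      refine (does_elim hc₂ hi hX'.rows (fun j hj => (hX'.sound j hj).1) hW hv hmax hrep).mono
        le_rfl fun s₃ f₃ h₃ => ⟨W, _, True, 0, _, h₃, fun _ => ?_, fun h0 => ?_⟩
      · unfold potential
        rw [if_pos trivial]
        have hgo := hX'.go h6
        by_cases hst : st
        · have hst' : st = True := eq_true hst
          subst hst'
          have := Set.ncard_lt_ncard (hW.ssubset hc₂.inv.sub hv) (Set.toFinite A)
          rw [if_pos trivial]
          omega
        · rw [if_neg hst]
          omega
      · rw [f₃.reg 6 (by decide)] at h0
        exact absurd h0 h6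
    · intro h7
      have h7' : s₂.reg 7 = 0 := by simpa [Test.Holds, Expr.eval] using h7
      refine (Does.simple .skip rfl (Q := fun s' => s' = s₂) rfl).mono
        (by simp only [Prog.cost]; omega) fun s₃ _ h₃ => ?_
      subst h₃
      by_cases h6 : s₃.reg 6 = 0
      · -- no pessimist can win, so that the number of sweeps does not matter any more
        have hq := hX'.quiet h7' h6
        exact ⟨A, F, st, 0, X', ⟨hc₂, hX'.rows, hX'.sound, fun j hj hv => absurd hv (hq j hj),
          Nat.zero_le _⟩, fun hc => absurd h6 hc, fun _ => hq⟩
      · have hgo := hX'.go h6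
        refine ⟨A, F, st, d + 1, X', ⟨hc₂, hX'.rows, hX'.sound, fun j hj hv => ?_, hgo⟩,
          fun _ => ?_, fun hc => absurd hc h6⟩
        · have := hX'.shrunk h7' j hj hv
          rwa [if_pos hj] at this
        · unfold potential
          split_ifs <;> omega
  · have : (el.length + 1) * (pl.length + 1) = (el.length + 1) * pl.length + (el.length + 1) := by
      rw [Nat.mul_add, Nat.mul_one]
    rw [this, Nat.mul_assoc, Nat.mul_assoc]
    omega

/-- Sweeps are repeated until all the pessimists have failed since the last elimination. -/
def mainLoop : Prog := .loop (.nonzero (.reg 6)) sweepProg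

/-- The main loop reaches a state in which no row contains `v₀`. -/
theorem does_main (h : BetweenInv G v₀ el pl P A F st d X s)
    (hel : ∀ e, e ∈ el ↔ e ∈ G.edges) (hpl : ∀ i ∈ pl, i ∈ P) (h6 : s.reg 6 ≠ 0) :
    Does mainLoop (400 * ((el.length + 1) * (pl.length + 1)) * potential A st d + 1) s fun s' =>
      ∃ A' F' st' d' X', BetweenInv G v₀ el pl P A' F' st' d' X' s' ∧
        ∀ j < pl.length, v₀ ∉ X' j := by
  refine (Does.loop (fun φ s' => ∃ A' F' st' d' X', BetweenInv G v₀ el pl P A' F' st' d' X' s' ∧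
    (s'.reg 6 ≠ 0 → 400 * ((el.length + 1) * (pl.length + 1)) * potential A' st' d' ≤ φ) ∧
    (s'.reg 6 = 0 → ∀ j < pl.length, v₀ ∉ X' j)) ?_
    ⟨A, F, st, d, X, h, fun _ => le_rfl, fun hc => absurd hc h6⟩).mono le_rfl ?_
  · rintro φ s' - ⟨A', F', st', d', X', h', hφ, -⟩ hb
    have h6' : s'.reg 6 ≠ 0 := by simpa [Test.Holds, Expr.eval] using hb
    refine ⟨_, (does_sweep h' hel hpl).mono le_rfl ?_⟩
    rintro s'' - ⟨A'', F'', st'', d'', X'', h'', hp, hq⟩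
    have hφ' := hφ h6'
    have hone : 1 ≤ (el.length + 1) * (pl.length + 1) := Nat.mul_pos (by omega) (by omega)
    generalize (el.length + 1) * (pl.length + 1) = K at hone hφ' ⊢
    by_cases h60 : s''.reg 6 = 0
    · refine ⟨0, ⟨A'', F'', st'', d'', X'', h'', fun hc => absurd h60 hc, hq⟩, ?_⟩
      have hpos : 1 ≤ potential A' st' d' := by
        have := h'.le
        unfold potential
        split_ifs <;> omega
      have := Nat.mul_le_mul_left (400 * K) hpos
      omega
    · refine ⟨_, ⟨A'', F'', st'', d'', X'', h'', fun _ => le_rfl, hq⟩, ?_⟩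
      have := Nat.mul_le_mul_left (400 * K) (hp h60)
      rw [Nat.mul_add, Nat.mul_one] at this
      omega
  · rintro s' - ⟨⟨φ, A', F', st', d', X', h', -, hq⟩, hb⟩
    have h60 : s'.reg 6 = 0 := by simpa [Test.Holds, Expr.eval] using hb
    exact ⟨A', F', st', d', X', h', hq h60⟩

end Main

/-! ### Initialisation and running time -/

section Init

variable {n q : ℕ} {G : Game (Fin n) (Fin q)} {v₀ : Fin n} {el : List (Fin n × Fin n)}
  {pl : List (Fin q)} {P : Finset (Fin q)} {s : State}

theorem input_inputState : Input G v₀ el pl (inputState G v₀ el pl) where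
  size := rfl
  len := rfl
  plen := rfl
  init := rfl
  src k hk := by simp [inputState, edgeAt, hk]
  tgt k hk := by simp [inputState, edgeAt, hk]
  owner u := by simp [inputState]
  pess j hj := by simp [inputState, hj]
  payoff v i := by simp [inputState]
  prob k hk := by simp [inputState, edgeAt, hk]

/-- The body of the loop that marks the vertices with outgoing edges (array `6`), the endpoints
of edges (array `5`) and the edges that can be taken (array `4`), and builds the lists of the
edges that end in a vertex (arrays `7` and `8`). -/
def initBody : Prog :=
  .seq (.ite (.and (.isZero (.get 2 srcE)) (.rle (.get 1 (.reg 5) (.lit 0)) .zero)) .skip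
      (.put 4 (.reg 5) (.lit 1)))
    (.seq (.seq (.put 6 srcE (.lit 1)) (.seq (.put 5 srcE (.lit 1)) (.put 5 tgtE (.lit 1))))
      (.seq (.put 8 (.reg 5) (.get 7 tgtE)) (.put 7 tgtE (.add (.reg 5) (.lit 1)))))

variable (G v₀ el) in
/-- The invariant of the initial loop, after `e` edges. -/
structure InitInv (e : ℕ) (s : State) : Prop where
  edges : ∀ k, s.arr 4 k ≠ 0 ↔ k < e ∧ edgeAt v₀ el k ∈ G.effEdges
  ends : ∀ v : Fin n, s.arr 5 v ≠ 0 ↔ ∃ k < e, (edgeAt v₀ el k).1 = v ∨ (edgeAt v₀ el k).2 = v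
  nonterm : ∀ v : Fin n, s.arr 6 v ≠ 0 ↔ ∃ k < e, (edgeAt v₀ el k).1 = v
  head : ∀ v : Fin n, s.arr 7 v = prevOcc v₀ el v e
  next : ∀ k < e, s.arr 8 k = prevOcc v₀ el (edgeAt v₀ el k).2 k

theorem exists_lt_succ {p : ℕ → Prop} {e : ℕ} : (∃ k < e + 1, p k) ↔ (∃ k < e, p k) ∨ p e := by
  constructor
  · rintro ⟨k, hk, h⟩
    rcases Nat.lt_succ_iff_lt_or_eq.1 hk with hk' | rfl
    · exact .inl ⟨k, hk', h⟩
    · exact .inr h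
  · rintro (⟨k, hk, h⟩ | h)
    · exact ⟨k, Nat.lt_succ_of_lt hk, h⟩
    · exact ⟨e, Nat.lt_succ_self e, h⟩

theorem does_initBody (hs : Input G v₀ el pl s) (h0 : ∀ a, 4 ≤ a → ∀ k, s.arr a k = 0)
    (hel : ∀ e, e ∈ el ↔ e ∈ G.edges) :
    Does initBody.forEdges ((initBody.cost + 2) * el.length + 2) s
      (InitInv G v₀ el el.length) := by
  refine Does.forEdges hs.len rfl (by decide) (by decide) (InitInv G v₀ el) ⟨?_, ?_, ?_, ?_, ?_⟩ ?_
  · intro k; simp [h0]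
  · intro v; simp [h0]
  · intro v; simp [h0]
  · intro v; simp [h0, prevOcc]
  · exact fun k hk => absurd hk (Nat.not_lt_zero k)
  · intro e s' he hf h5 hJ s'' ha _ _
    have hs' := hs.of_frame hf (by decide) (by decide)
    have h1 := hs'.src e he
    have h2 := hs'.tgt e he
    have hb : (Test.and (.isZero (.get 2 srcE)) (.rle (.get 1 (.reg 5) (.lit 0)) .zero)).Holds s' ↔
        edgeAt v₀ el e ∉ G.effEdges := by
      have hp : (G.prob (edgeAt v₀ el e).1 (edgeAt v₀ el e).2).toReal ≤ 0 ↔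
          G.prob (edgeAt v₀ el e).1 (edgeAt v₀ el e).2 = 0 := by
        rw [le_antisymm_iff.trans (and_iff_left ENNReal.toReal_nonneg) |>.symm,
          ENNReal.toReal_eq_zero_iff, or_iff_left (PMF.apply_ne_top _ _)]
      have ho : s'.arr 2 (edgeAt v₀ el e).1 = 0 ↔ G.owner (edgeAt v₀ el e).1 = none := by
        rw [hs'.owner]
        rcases G.owner (edgeAt v₀ el e).1 with _ | i <;> simp
      simp only [Test.Holds, Expr.eval, RExpr.eval, h5, h1, hs'.prob e he, hp, Nat.le_zero, ho]
      have := (hel _).1 (edgeAt_mem (v₀ := v₀) he)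
      simp [Game.effEdges, this]
    obtain ⟨a4, a5, a6, a7, a8⟩ :
        (∀ k, s''.arr 4 k ≠ 0 ↔ k < e + 1 ∧ edgeAt v₀ el k ∈ G.effEdges) ∧
        s''.arr 5 = Function.update (Function.update (s'.arr 5) (edgeAt v₀ el e).1 1)
          (edgeAt v₀ el e).2 1 ∧
        s''.arr 6 = Function.update (s'.arr 6) (edgeAt v₀ el e).1 1 ∧
        s''.arr 7 = Function.update (s'.arr 7) (edgeAt v₀ el e).2 (e + 1) ∧
        s''.arr 8 = Function.update (s'.arr 8) e (s'.arr 7 (edgeAt v₀ el e).2) := by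
      by_cases hc : edgeAt v₀ el e ∈ G.effEdges
      · simp only [ha, initBody, Prog.exec, if_neg (fun h => hb.1 h hc)]
        refine ⟨fun k => ?_, by simp [Expr.eval, h5, h1, h2]⟩
        by_cases hk : k = e
        · simpa [Expr.eval, h5, hk] using hc
        · rw [Nat.lt_succ_iff, Nat.le_iff_lt_or_eq, or_iff_left hk]
          simpa [Expr.eval, h5, hk] using hJ.edges k
      · simp only [ha, initBody, Prog.exec, if_pos (hb.2 hc)]
        refine ⟨fun k => ?_, by simp [Expr.eval, h5, h1, h2]⟩
        by_cases hk : k = e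
        · simpa [Expr.eval, h5, hk, hc] using hJ.edges e
        · rw [Nat.lt_succ_iff, Nat.le_iff_lt_or_eq, or_iff_left hk]
          simpa [Expr.eval, h5, hk] using hJ.edges k
    refine ⟨a4, fun v => ?_, fun v => ?_, fun v => ?_, fun k hk => ?_⟩
    · rw [exists_lt_succ, a5, ← hJ.ends v]
      simp only [Function.update_apply, Fin.val_inj]
      by_cases hv2 : v = (edgeAt v₀ el e).2
      · simp [hv2]
      · by_cases hv1 : v = (edgeAt v₀ el e).1
        · simp [hv1]
        · simp [hv1, hv2, Ne.symm hv1, Ne.symm hv2, eq_comm]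
    · rw [exists_lt_succ, a6, ← hJ.nonterm v]
      simp only [Function.update_apply, Fin.val_inj]
      by_cases hv1 : v = (edgeAt v₀ el e).1
      · simp [hv1]
      · simp [hv1, eq_comm]
    · rw [a7, prevOcc, Function.update_apply, hJ.head v]
      simp only [Fin.val_inj, eq_comm]
    · rw [a8, Function.update_apply]
      split_ifs with hke
      · rw [hke, hJ.head]
      · exact hJ.next k (by omega)

/-- The program that computes a representation of a stationary equilibrium. If `v₀` is terminal,
then there is nothing to be done after the initialisation.

Arrays: `4` remaining edges, `5` live vertices, `6` non-terminal vertices, `7` and `8` lists of the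
edges that end in a vertex, `9` rows with upper bounds for the `Win` sets of the pessimists, `10`
result of a round, `11` vertices that the search has to avoid, `12` queue.

Registers: `5` current edge, `6` whether another sweep is needed, `7` whether a pessimist can win,
`8` and `9` current pessimist and offset of the row, `10` current player, `11` worst terminal
vertex, `12` length of the queue, `13` and `16` position of the search, `14` whether the round has
changed the row, `15` whether an elimination has taken place. -/
def program : Prog :=
  .seq initBody.forEdges (.seq rowsProg
    (.seq (.set 6 (.lit 1)) (.ite (.nonzero (.get 6 (.reg 4))) mainLoop .skip)))

theorem outputEdges_eq {F : Set (Fin n × Fin n)} (hF : RepEdges v₀ el (s.arr 4) F)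
    (hFe : F ⊆ {e | e ∈ el}) : outputEdges el s = F := by
  ext e
  constructor
  · rintro ⟨k, hk, h⟩
    obtain ⟨hk', rfl⟩ := List.getElem?_eq_some_iff.1 hk
    have := (hF k hk').1 h
    rwa [edgeAt, List.getD_eq_getElem _ _ hk'] at this
  · intro he
    obtain ⟨k, hk, h⟩ := exists_edgeAt (v₀ := v₀) (hFe he)
    refine ⟨k, ?_, (hF k hk).2 (h ▸ he)⟩
    rw [List.getElem?_eq_getElem hk, ← h, edgeAt, List.getD_eq_getElem _ _ hk]

theorem does_program (hG : G.NonnegRewards) (hel : ∀ e, e ∈ el ↔ e ∈ G.edges)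
    (hpl : ∀ i, i ∈ pl ↔ i ∈ P) :
    Does program (2000 * (el.length + 1) * (el.length + 1) * (pl.length + 1))
      (inputState G v₀ el pl) fun s => G.RepresentsXRSE v₀ P (outputEdges el s) := by
  have hin : Input G v₀ el pl (inputState G v₀ el pl) := input_inputState
  have hz : ∀ a, 4 ≤ a → ∀ k, (inputState G v₀ el pl).arr a k = 0 := by
    intro a ha k
    match a, ha with
    | a + 4, _ => rfl
  have key : Does program ((initBody.cost + 2) * el.length + 2 +
      (5 * (el.length + 1) * pl.length + 3 + (1 +
        (400 * ((el.length + 1) * (pl.length + 1)) * potential (ends v₀ el) False 0 + 1 + 1))))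
      (inputState G v₀ el pl) fun s => G.RepresentsXRSE v₀ P (outputEdges el s) := by
    refine (does_initBody hin hz hel).seq fun s₁ f₁ h₁ => ?_
    have hs₁ : Static G v₀ el pl s₁ := by
      refine ⟨hin.of_frame f₁ (by decide) (by decide), fun v => (h₁.nonterm v).trans ?_,
        h₁.head, h₁.next⟩
      constructor
      · rintro ⟨k, hk, rfl⟩ hT
        exact hT _ ((hel _).1 (edgeAt_mem (v₀ := v₀) hk))
      · intro hT
        obtain ⟨w, hw⟩ := not_forall_not.1 hT
        obtain ⟨k, hk, h⟩ := exists_edgeAt (v₀ := v₀) ((hel _).2 hw)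
        exact ⟨k, hk, by rw [h]⟩
    have hout : ∀ F ⊆ G.effEdges, F ⊆ {e | e ∈ el} := fun F hF e he => (hel e).2 (hF he).1
    refine (does_rows hs₁ (X := fun _ => ∅) ?_ (fun _ _ => Set.empty_subset _) (A := ends v₀ el)
      h₁.ends subset_rfl).seq fun s₂ f₂ h₂ => ?_
    · intro j _ v
      rw [f₁.arr 9 (by decide)]
      simp [hz]
    have hs₂ := hs₁.of_frame f₂ (by decide) (by decide)
    refine (Does.simple (.set 6 (.lit 1)) rfl (Q := fun s' => s'.reg 6 = 1)
      (by simp [Prog.exec, Expr.eval])).seq fun s₃ f₃ h₃ => ?_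
    have hs₃ := hs₂.of_frame f₃ (by decide) (by decide)
    have hE : RepEdges v₀ el (s₃.arr 4) G.effEdges := by
      rw [f₃.arr 4 (by decide), f₂.arr 4 (by decide)]
      exact fun k hk => (h₁.edges k).trans (and_iff_right hk)
    refine Does.ite (fun hb => ?_) fun hb => ?_
    · have hT : ¬ G.Terminal v₀ := by
        rw [← hs₃.nonterm v₀]
        simpa [Test.Holds, Expr.eval, hs₃.init] using hb
      have hinv : G.Inv v₀ P (ends v₀ el) G.effEdges False := by
        refine Game.Inv.start Game.exists_effEdge ?_ (fun u _ v huv => ?_) False.elim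
        · obtain ⟨w, hw⟩ := not_forall_not.1 hT
          obtain ⟨k, hk, h⟩ := exists_edgeAt (v₀ := v₀) ((hel _).2 hw)
          exact ⟨k, hk, .inl (by rw [h])⟩
        · obtain ⟨k, hk, h⟩ := exists_edgeAt (v₀ := v₀) ((hel _).2 huv.1)
          exact ⟨k, hk, .inr (by rw [h])⟩
      have hbet : BetweenInv G v₀ el pl P (ends v₀ el) G.effEdges False 0
          (fun _ => ends v₀ el) s₃ := by
        refine ⟨⟨hs₃, hE, ?_, ?_, hinv, subset_rfl⟩, ?_, fun j hj => ⟨subset_rfl, fun S hS => hS.1⟩,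
          fun _ _ _ => le_rfl, Nat.zero_le _⟩
        · rw [f₃.arr 5 (by decide), f₂.arr 5 (by decide)]; exact h₁.ends
        · rw [f₃.reg 15 (by decide), f₂.reg 15 (by decide), f₁.reg 15 (by decide)]
          simp [inputState]
        · rw [f₃.arr 9 (by decide)]; exact h₂
      refine (does_main hbet hel (fun i hi => (hpl i).1 hi) (by omega)).mono le_rfl ?_
      rintro s₄ - ⟨A, F, st, d, X, h, hX⟩
      rw [outputEdges_eq h.edges (hout F h.inv.sub)]
      refine h.inv.representsXRSE hG fun i hi S hS hv => ?_
      obtain ⟨j, hj, rfl⟩ := List.getElem_of_mem ((hpl i).2 hi)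
      exact hX j hj ((h.sound j hj).2 S hS hv)
    · have hT : G.Terminal v₀ := by
        by_contra hT
        rw [← hs₃.nonterm v₀] at hT
        exact hT (by simpa [Test.Holds, Expr.eval, hs₃.init] using hb)
      refine (Does.simple .skip rfl (Q := fun s' => s' = s₃) rfl).mono
        (by simp only [Prog.cost]; omega) fun s₄ _ h₄ => ?_
      subst h₄
      rw [outputEdges_eq hE (hout _ subset_rfl)]
      have hinv : G.Inv v₀ P {v₀} G.effEdges True := by
        refine Game.Inv.start Game.exists_effEdge rfl (fun u hu v huv => ?_) fun _ u hu => ?_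
        · rw [Set.mem_singleton_iff] at hu
          subst hu
          exact absurd huv.1 (hT v)
        · rw [Set.mem_singleton_iff] at hu
          subst hu
          exact .base rfl hT
      refine hinv.representsXRSE hG fun i hi S hS hv => ?_
      -- the only live vertex is worst, hence not good
      have hgood : ∀ u, ¬ PathIn G.effEdges S (G.Good i {v₀} True) u := by
        intro u hu
        induction hu with
        | base _ ht =>
          obtain ⟨ht, -, h⟩ := ht
          obtain ⟨s, hs, -, hlt⟩ := h trivial
          rw [Set.mem_singleton_iff] at hs ht
          subst hs ht
          exact absurd hlt (lt_irrefl _)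
        | step _ _ _ ih => exact ih
      exact hgood v₀ (hS.2.2 v₀ hv)
  refine key.mono ?_ fun _ _ h => h
  have hc : initBody.cost = 8 := rfl
  have hp : potential (ends v₀ el) False 0 ≤ 4 * el.length + 3 := by
    have := ncard_ends_le (v₀ := v₀) (el := el)
    simp only [potential, if_false]
    omega
  have := Nat.mul_le_mul_left (400 * ((el.length + 1) * (pl.length + 1))) hp
  rw [hc]
  refine le_trans (Nat.add_le_add_left (Nat.add_le_add_left (Nat.add_le_add_left
    (Nat.add_le_add_right (Nat.add_le_add_right this _) _) _) _) _) ?_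
  nlinarith [Nat.zero_le el.length, Nat.zero_le pl.length,
    Nat.zero_le (el.length * pl.length), Nat.zero_le (el.length * el.length),
    Nat.zero_le (el.length * el.length * pl.length)]

end Init

end StochGame

theorem mainTheorem2 :
    (∀ (V I : Type*) [Finite V] [Finite I] [MeasurableSpace V] [DiscreteMeasurableSpace V]
        (G : StochGame.Game V I) (v₀ : V) (P : Set I),
        G.NonnegRewards → ∃ σ : G.Profile v₀, σ.Stationary ∧ σ.IsXRSE P) ∧
    (∃ (c : StochGame.Prog) (C : ℕ),
        ∀ (n q : ℕ) (G : StochGame.Game (Fin n) (Fin q)) (v₀ : Fin n) (P : Finset (Fin q))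
          (el : List (Fin n × Fin n)) (pl : List (Fin q)),
          G.NonnegRewards →
          el.Nodup → (∀ e, e ∈ el ↔ e ∈ G.edges) →
          pl.Nodup → (∀ i, i ∈ pl ↔ i ∈ P) →
          ∃ (s : StochGame.State) (t : ℕ),
            StochGame.Runs c (StochGame.inputState G v₀ el pl) s t ∧
            t ≤ C * (max 1 G.edges.card) ^ 2 * max 1 P.card ∧
            G.RepresentsXRSE v₀ P (StochGame.outputEdges el s)) := by
  refine ⟨fun V I _ _ _ _ G v₀ P hG => StochGame.Game.exists_stationary_isXRSE G v₀ P hG,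
    StochGame.program, 16000, fun n q G v₀ P el pl hG hnd hel hnd' hpl => ?_⟩
  obtain ⟨s, t, hr, ht, hs⟩ := StochGame.does_program (v₀ := v₀) hG hel hpl
  refine ⟨s, t, hr, ht.trans ?_, hs⟩
  have hm : G.edges.card = el.length := by
    rw [← List.toFinset_card_of_nodup hnd]
    congr 1
    ext e
    rw [List.mem_toFinset, hel]
  have hp : P.card = pl.length := by
    rw [← List.toFinset_card_of_nodup hnd']
    congr 1
    ext e
    rw [List.mem_toFinset, hpl]
  have h1 : el.length + 1 ≤ 2 * max 1 el.length := by omega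
  have h2 : pl.length + 1 ≤ 2 * max 1 pl.length := by omega
  rw [hm, hp]
  calc 2000 * (el.length + 1) * (el.length + 1) * (pl.length + 1)
      ≤ 2000 * (2 * max 1 el.length) * (2 * max 1 el.length) * (2 * max 1 pl.length) := by gcongr
    _ = 16000 * (max 1 el.length) ^ 2 * max 1 pl.length := by ring
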